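/- **Conventions.** For integers $p,q\ge1$ let $$Z_{p,q}=\{f\in C([0,1],M_p\otimes M_q)\mid f(0)\in M_p\otimes 1_q,\ f(1)\in 1_p\otimes M_q\},$$ which is called prime if $\gcd(p,q)=1$. For $f\in Z_{p,q}$ write $f(\infty_0)\in M_p$ and $f(\infty_1)\in M_q$ for the matrices with $f(0)=f(\infty_0)\otimes 1_q$ and $f(1)=1_p\otimes f(\infty_1)$. A *Lipschitz family* in $A=Z_{p,q}$ is a set $\mathcal L=u\,\mathrm{Lip}(u^*Au)\,u^*\subseteq A$, where $u\in C([0,1],M_{pq})$ is a continuous path of unitaries such that $u(0)$ and $u(1)$ are permutation matrices, and $\mathrm{Lip}(u^*Au)$ is the set of self-adjoint $h\in u^*Au$ with $\|h\|\le1$ and $\|h(x)-h(y)\|\le|x-y|$ for all $x,y\in[0,1]$. For $^*$-homomorphisms $\varphi,\psi\colon A\to B$ into a unital $C^*$-algebra $B$, put $$d_{\mathcal U}(\varphi,\psi)=\sup_{F\subseteq\mathcal L\text{ finite}}\ \inf_{u\in\mathcal U(B)}\ \sup_{f\in F}\|u\varphi(f)u^*-\psi(f)\|,\qquad d_W(\varphi,\psi)=\sup_{f\in\mathcal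 L}d_W(\varphi(f),\psi(f)),$$ where for self-adjoint $c,d\in B$ $$d_W(c,d)=\sup_{U\subseteq\mathbb R\text{ open}}\inf\{r>0\mid f_U(c)\precsim f_{U_r}(d),\ f_U(d)\precsim f_{U_r}(c)\}.$$ Here $\precsim$ is Cuntz subequivalence in $B$, $f_O$ is any nonnegative continuous function on $\mathbb R$ with open support $O$, and $U_r$ is the open $r$-neighbourhood of $U$ in $\mathbb R$. For a $^*$-homomorphism $\varphi\colon Z_{p,q}\to Z_{p',q'}$, say that continuous maps $\xi_1\le\dots\le\xi_l$ from $[0,1]$ to $[0,1]$ are *associated* to $\varphi$ *with residual multiplicities* $a,b\ge0$ if $p'q'=lpq+ap+bq$ and there are unitaries $u(t)\in M_{p'q'}$, $t\in[0,1]$, such that for all $f\in Z_{p,q}$ and $t\in[0,1]$ $$\varphi(f)(t)=u(t)\,\mathrm{diag}\big(f(\xi_1(t)),\dots,f(\xi_l(t)),\underbrace{f(\infty_0)}_{a},\underbrace{f(\infty_1)}_{b}\big)u(t)^*.$$ (For $a=b=0$, this says that $\varphi$ is diagonal with associated maps $\xi_1,\dots,\xi_l$.) **Proposition.** Let $A=Z_{p,q}$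 and $B=Z_{p',q'}$ be prime dimension drop algebras, let $\varphi,\psi\colon A\to B$ be $^*$-monomorphisms, and let $\mathcal L\subseteq A$ be a Lipschitz family. Then $\varphi$ and $\psi$ are unital, and there are integers $l\ge0$, $0\le a<q$ and $0\le b<p$ such that both $\varphi$ and $\psi$ have $l$ associated maps with residual multiplicities $a,b$. Moreover, whenever $l,a,b\ge0$ are integers and $\xi_1\le\dots\le\xi_l$ and $\eta_1\le\dots\le\eta_l$ are maps associated to $\varphi$ and to $\psi$, respectively, with residual multiplicities $a,b$, the diagonal distance $d_\partial(\varphi,\psi)=\sup_{t\in[0,1]}\max_{1\le i\le l}|\xi_i(t)-\eta_i(t)|$ satisfies, relative to $\mathcal L$, $$d_{\mathcal U}(\varphi,\psi)=d_\partial(\varphi,\psi)=d_W(\varphi,\psi),$$ and $d_W(\varphi,\psi)$ does not change if only the open sets $U\subseteq\mathbb R$ with $U\subseteq[0,\infty)$ are used in its definition. -/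

import Mathlib

open scoped unitInterval Kronecker Matrix.Norms.L2Operator ENNReal Topology

noncomputable section

namespace DimDrop

/-! ### Dimension drop algebras -/

/-- `M_p ⊗ M_q`, realised (through the Kronecker product) as the matrices indexed by
`Fin p × Fin q`. The norm is the C*-norm, i.e. the operator norm on Euclidean space. -/
abbrev MatPQ (p q : ℕ) : Type := Matrix (Fin p × Fin q) (Fin p × Fin q) ℂ

/-- The dimension drop algebra
`Z_{p,q} = {f ∈ C([0,1], M_p ⊗ M_q) | f(0) ∈ M_p ⊗ 1_q, f(1) ∈ 1_p ⊗ M_q}`. -/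
def Z (p q : ℕ) : StarSubalgebra ℂ C(I, MatPQ p q) where
  carrier := {f | (∃ x : Matrix (Fin p) (Fin p) ℂ, f 0 = x ⊗ₖ (1 : Matrix (Fin q) (Fin q) ℂ)) ∧
    (∃ y : Matrix (Fin q) (Fin q) ℂ, f 1 = (1 : Matrix (Fin p) (Fin p) ℂ) ⊗ₖ y)}
  mul_mem' := by
    rintro f g ⟨⟨x, hx⟩, y, hy⟩ ⟨⟨x', hx'⟩, y', hy'⟩
    refine ⟨⟨x * x', ?_⟩, y * y', ?_⟩
    · simp [hx, hx', ← Matrix.mul_kronecker_mul]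
    · simp [hy, hy', ← Matrix.mul_kronecker_mul]
  add_mem' := by
    rintro f g ⟨⟨x, hx⟩, y, hy⟩ ⟨⟨x', hx'⟩, y', hy'⟩
    refine ⟨⟨x + x', ?_⟩, y + y', ?_⟩
    · simp [hx, hx', Matrix.add_kronecker]
    · simp [hy, hy', Matrix.kronecker_add]
  algebraMap_mem' := by
    intro c
    refine ⟨⟨c • 1, ?_⟩, c • 1, ?_⟩
    · rw [Matrix.smul_kronecker, Matrix.one_kronecker_one, algebraMap_apply]
    · rw [Matrix.kronecker_smul, Matrix.one_kronecker_one, algebraMap_apply]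
  star_mem' := by
    rintro f ⟨⟨x, hx⟩, y, hy⟩
    refine ⟨⟨star x, ?_⟩, star y, ?_⟩
    · simp [hx, Matrix.star_eq_conjTranspose, Matrix.conjTranspose_kronecker]
    · simp [hy, Matrix.star_eq_conjTranspose, Matrix.conjTranspose_kronecker]

/-- `Z_{p,q}` is norm closed; through Mathlib's instance for closed star subalgebras
it is therefore a C*-algebra. -/
instance Z_isClosed (p q : ℕ) : IsClosed (Z p q : Set C(I, MatPQ p q)) := by
  let L₀ : Matrix (Fin p) (Fin p) ℂ →ₗ[ℂ] MatPQ p q :=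
    { toFun := fun x => x ⊗ₖ (1 : Matrix (Fin q) (Fin q) ℂ)
      map_add' := fun x y => Matrix.add_kronecker x y _
      map_smul' := fun c x => Matrix.smul_kronecker c x _ }
  let L₁ : Matrix (Fin q) (Fin q) ℂ →ₗ[ℂ] MatPQ p q :=
    { toFun := fun y => (1 : Matrix (Fin p) (Fin p) ℂ) ⊗ₖ y
      map_add' := fun x y => Matrix.kronecker_add _ x y
      map_smul' := fun c x => Matrix.kronecker_smul c _ x }
  have h₀ := (Submodule.closed_of_finiteDimensional (LinearMap.range L₀)).preimage
    (continuous_eval_const (F := C(I, MatPQ p q)) (0 : I))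
  have h₁ := (Submodule.closed_of_finiteDimensional (LinearMap.range L₁)).preimage
    (continuous_eval_const (F := C(I, MatPQ p q)) (1 : I))
  convert h₀.inter h₁ using 1
  ext f
  constructor
  · rintro ⟨⟨x, hx⟩, y, hy⟩
    exact ⟨⟨x, hx.symm⟩, y, hy.symm⟩
  · rintro ⟨⟨x, hx⟩, y, hy⟩
    exact ⟨⟨x, hx.symm⟩, y, hy.symm⟩

variable {p q p' q' : ℕ}

/-- The irreducible representation of `Z_{p,q}` at the first point at infinity:
the matrix `x ∈ M_p` with `f(0) = x ⊗ 1_q` (unique when `q ≠ 0`). -/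
def infZero (f : Z p q) : Matrix (Fin p) (Fin p) ℂ := Classical.choose f.2.1

/-- The irreducible representation of `Z_{p,q}` at the second point at infinity:
the matrix `y ∈ M_q` with `f(1) = 1_p ⊗ y` (unique when `p ≠ 0`). -/
def infOne (f : Z p q) : Matrix (Fin q) (Fin q) ℂ := Classical.choose f.2.2

theorem infZero_spec (f : Z p q) :
    (f : C(I, MatPQ p q)) 0 = infZero f ⊗ₖ (1 : Matrix (Fin q) (Fin q) ℂ) :=
  Classical.choose_spec f.2.1

theorem infOne_spec (f : Z p q) :
    (f : C(I, MatPQ p q)) 1 = (1 : Matrix (Fin p) (Fin p) ℂ) ⊗ₖ infOne f :=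
  Classical.choose_spec f.2.2

/-! ### Lipschitz families -/

/-- For a set `S ⊆ C([0,1], M_n)`, the contractive self-adjoint elements of `S` that are
`1`-Lipschitz as functions on `[0,1]`. -/
def lip (S : Set C(I, MatPQ p q)) : Set C(I, MatPQ p q) :=
  {h | h ∈ S ∧ IsSelfAdjoint h ∧ ‖h‖ ≤ 1 ∧ ∀ x y : I, ‖h x - h y‖ ≤ |(x : ℝ) - (y : ℝ)|}

/-- `𝓛 ⊆ Z_{p,q}` is a Lipschitz family: `𝓛 = u Lip(u* Z_{p,q} u) u*` for some continuous path
`u` of unitaries whose end points are permutation matrices. -/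
def IsLipschitzFamily (𝓛 : Set (Z p q)) : Prop :=
  ∃ u : C(I, MatPQ p q),
    (∀ t, u t ∈ Matrix.unitaryGroup (Fin p × Fin q) ℂ) ∧
    (∃ π : Equiv.Perm (Fin p × Fin q), u 0 = π.permMatrix ℂ) ∧
    (∃ π : Equiv.Perm (Fin p × Fin q), u 1 = π.permMatrix ℂ) ∧
    𝓛 = {f : Z p q | ∃ h ∈ lip ((fun g => star u * g * u) '' (Z p q : Set C(I, MatPQ p q))),
      (f : C(I, MatPQ p q)) = u * h * star u}

/-! ### Associated eigenvalue maps and the diagonal distance -/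

/-- The block diagonal matrix
`diag(f(s_1), …, f(s_l), f(∞_0), …, f(∞_0), f(∞_1), …, f(∞_1))`
with `a` copies of `f(∞_0) ∈ M_p` and `b` copies of `f(∞_1) ∈ M_q`. -/
def diagMat (l a b : ℕ) (s : Fin l → I) (f : Z p q) :
    Matrix (((Fin p × Fin q) × Fin l) ⊕ (Fin p × Fin a) ⊕ (Fin q × Fin b))
      (((Fin p × Fin q) × Fin l) ⊕ (Fin p × Fin a) ⊕ (Fin q × Fin b)) ℂ :=
  Matrix.fromBlocks (Matrix.blockDiagonal fun i => (f : C(I, MatPQ p q)) (s i)) 0 0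
    (Matrix.fromBlocks (Matrix.blockDiagonal fun _ : Fin a => infZero f) 0 0
      (Matrix.blockDiagonal fun _ : Fin b => infOne f))

/-- The continuous maps `ξ_1 ≤ … ≤ ξ_l` are associated to `φ : Z_{p,q} → Z_{p',q'}`, with `a` and
`b` residual copies of the two points at infinity: for every `t` there is a unitary `u(t)` with
`φ(f)(t) = u(t) diag(f(ξ_1(t)), …, f(ξ_l(t)), f(∞_0) (a times), f(∞_1) (b times)) u(t)*` for all
`f`. The enumeration `e` of the basis expresses `p'q' = lpq + ap + bq`. For `a = b = 0` this says
that `φ` is diagonal with associated maps `ξ_i`. -/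
def IsAssociated (φ : Z p q →⋆ₙₐ[ℂ] Z p' q') (l a b : ℕ) (ξ : Fin l → C(I, I)) : Prop :=
  (∀ i j, i ≤ j → ∀ t, ξ i t ≤ ξ j t) ∧
  ∃ e : ((Fin p × Fin q) × Fin l) ⊕ (Fin p × Fin a) ⊕ (Fin q × Fin b) ≃ Fin p' × Fin q',
    ∀ t : I, ∃ u ∈ Matrix.unitaryGroup (Fin p' × Fin q') ℂ, ∀ f : Z p q,
      (φ f : C(I, MatPQ p' q')) t =
        u * Matrix.reindex e e (diagMat l a b (fun i => ξ i t) f) * star u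

/-- The diagonal distance `sup_t max_i |ξ_i(t) - η_i(t)|` of two families of eigenvalue maps. -/
def diagDist {l : ℕ} (ξ η : Fin l → C(I, I)) : ℝ≥0∞ :=
  ⨆ t : I, ⨆ i : Fin l, ENNReal.ofReal |(ξ i t : ℝ) - (η i t : ℝ)|

/-! ### The Cuntz distance and the unitary distance -/

section Distances

variable {A B : Type*} [CStarAlgebra B]

/-- Cuntz subequivalence `c ≾ d`: there are `x_n` with `x_n d x_n* → c`. -/
def CuntzLE (c d : B) : Prop :=
  ∃ x : ℕ → B, Filter.Tendsto (fun n => x n * d * star (x n)) Filter.atTop (𝓝 c)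

/-- `f` is a nonnegative continuous function with open support `O`. -/
def HasOpenSupport (f : ℝ → ℝ) (O : Set ℝ) : Prop :=
  Continuous f ∧ (∀ x, 0 ≤ f x) ∧ Function.support f = O

/-- `f_O(c) ≾ f_{O'}(d)` for self-adjoint `c`, `d` and open `O`, `O'`, where `f_O` is any
nonnegative continuous function with open support `O` (the Cuntz class of `f_O(c)` depends
only on `O`). -/
def OpenLE (c d : B) (O O' : Set ℝ) : Prop :=
  ∃ f g : ℝ → ℝ, HasOpenSupport f O ∧ HasOpenSupport g O' ∧ CuntzLE (cfc f c) (cfc g d)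

/-- The Cuntz distance between self-adjoint elements, computed with the open sets `U ⊆ S`. -/
def cuntzDist (S : Set ℝ) (c d : B) : ℝ≥0∞ :=
  ⨆ (U : Set ℝ) (_ : IsOpen U) (_ : U ⊆ S),
    ⨅ (r : ℝ) (_ : 0 < r) (_ : OpenLE c d U (Metric.thickening r U))
      (_ : OpenLE d c U (Metric.thickening r U)), ENNReal.ofReal r

/-- The Cuntz distance `d_W(φ,ψ) = sup_{f ∈ 𝓛} d_W(φ(f),ψ(f))` relative to `𝓛`, computed with the
open sets `U ⊆ S`. -/
def dW (S : Set ℝ) (𝓛 : Set A) (φ ψ : A → B) : ℝ≥0∞ :=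
  ⨆ f ∈ 𝓛, cuntzDist S (φ f) (ψ f)

/-- The unitary distance
`d_U(φ,ψ) = sup_{F ⊆ 𝓛 finite} inf_{u ∈ U(B)} sup_{f ∈ F} ‖u φ(f) u* - ψ(f)‖` relative to `𝓛`,
for a unital C*-algebra `B`. -/
def dU (𝓛 : Set A) (φ ψ : A → B) : ℝ≥0∞ :=
  ⨆ (F : Finset A) (_ : (F : Set A) ⊆ 𝓛),
    ⨅ u : unitary B, ⨆ f ∈ F, ENNReal.ofReal ‖(u : B) * φ f * star (u : B) - ψ f‖

end Distances

end DimDrop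

end

/-!
The three distances are compared in a cycle, diagonal distance `≤` Cuntz distance over `U ⊆ [0,∞)`
`≤` Cuntz distance `≤` unitary distance `≤` diagonal distance.

*Representations.* A unital representation of `Z_{p,q}` on a finite-dimensional space is a direct sum
of evaluations at points of `[0,1]`, at `∞_0` and at `∞_1` (`exists_isDiag`): an eigenvector of the
coordinate function for the eigenvalue `t` only sees the fibre at `t`, which is a full matrix
algebra. As `q` copies of `∞_0` make up the point `0` and `p` copies of `∞_1` the point `1`, one
can arrange `a < q` and `b < p`, and then coprimality makes `l`, `a`, `b` functions of the dimension
(`multiplicities_unique`). The sorted eigenvalues are determined by the traces of scalar functions,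
which vary continuously (`eq_of_sum_eq`, `continuous_of_continuous_sum`); hence the associated maps
exist. A monomorphism is unital since the rank of a projection in `Z_{p',q'}` is divisible
by `p'` and by `q'` (`eq_zero_or_one_of_idempotent`).

*Cuntz distance at most unitary distance* (`dW_le_dU`). In any C*-algebra, `‖c - d‖ < r` implies
`f_U(c) ≾ f_{U_r}(d)`. For an interval this is an operator inequality between spectral
cutoffs; in general one sums over the finitely many relevant components of `U_r`.

*Diagonal distance at most Cuntz distance* (`diagDist_le_dW`). The coordinate function lies in every
Lipschitz family. Comparing the ranks of its spectral cutoffs over `U = (s,∞)` at a point `t` counts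
the eigenvalues `ξ_i(t) > s` against the eigenvalues `η_i(t) > s - r`.

*Unitary distance at most diagonal distance* (`dU_le_diagDist`). Let the Lipschitz family
be `U Lip U*`. At each `t`, the unitaries `Y G X*`, where `X` and `Y` diagonalize `φ` and `ψ` at `t`
and `G` is block diagonal with blocks `U(η_i(t)) U(ξ_i(t))*`, conjugate `φ(f)(t)` to `ψ(f)(t)` within
the diagonal distance, for every `f` in the family. They form a set depending on `t` in a closed
way, and it is path connected, because the unitary commutant of a representation is path connected.
Hence a continuous path of unitaries passes arbitrarily close to these sets
(`exists_continuous_selection`). At the end points the path can be started and stopped at unitaries of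
the form `x ⊗ 1` and `1 ⊗ y`: diagonalize the fibres at `∞_0` and `∞_1`, amplify, and use uniqueness of
reduced diagonal forms (`exists_tensor_mem_twists`). So the path is a unitary of `Z_{p',q'}`.
-/

noncomputable section

namespace DimDrop

/-! ### Cuntz comparison of spectral cutoffs on an interval -/

section Cuntz

variable {B : Type*} [CStarAlgebra B]

theorem cfc_mul_cfc {f g : ℝ → ℝ} (hf : Continuous f) (hg : Continuous g) (a : B) :
    cfc f a * cfc g a = cfc (fun t => f t * g t) a :=
  (cfc_mul f g a hf.continuousOn hg.continuousOn).symm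

theorem cfc_mul_self_mul_cfc {f : ℝ → ℝ} (hf : Continuous f) {a : B} (ha : IsSelfAdjoint a) :
    cfc f a * a * cfc f a = cfc (fun t => f t * t * f t) a := by
  conv_lhs => rw [← cfc_id' ℝ a ha]
  rw [cfc_id' ℝ a ha]
  have h1 : cfc f a * a = cfc (fun t => f t * t) a := by
    rw [← cfc_mul_cfc hf continuous_id' a, cfc_id' ℝ a ha]
  rw [h1, cfc_mul_cfc (f := fun t => f t * t) (hf.mul continuous_id') hf]

/-- If `0 ≤ a ≤ d`, then `a` is a limit of elements `z d z*`: take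
`z = a^{1/2} d^{1/2} (d + δ)⁻¹` with `δ` small. -/
theorem exists_conj_approx_of_le [PartialOrder B] [StarOrderedRing B] {a d : B} (ha : 0 ≤ a)
    (had : a ≤ d) {ε : ℝ} (hε : 0 < ε) : ∃ z : B, ‖z * d * star z - a‖ < ε := by
  have hd : 0 ≤ d := ha.trans had
  have hdsa : IsSelfAdjoint d := .of_nonneg hd
  obtain ⟨δ, hδ, hδε⟩ : ∃ δ : ℝ, 0 < δ ∧ 2 * δ < ε := ⟨ε / 3, by positivity, by linarith⟩
  have hpos : ∀ t : ℝ, 0 < |t| + δ := fun t => by positivity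
  have hfrac : ∀ t : ℝ, t ^ 2 / (|t| + δ) ^ 2 ≤ 1 := fun t => by
    rw [div_le_one (pow_pos (hpos t) 2), ← sq_abs t]
    have := abs_nonneg t
    gcongr; linarith
  obtain ⟨k, hk, hkd⟩ : ∃ k : ℝ → ℝ, Continuous k ∧ ∀ t, k t = √|t| / (|t| + δ) :=
    ⟨fun t => √|t| / (|t| + δ),
      Continuous.div (by fun_prop) (by fun_prop) fun t => (hpos t).ne', fun _ => rfl⟩
  obtain ⟨w, hw, hww⟩ : ∃ w : ℝ → ℝ, Continuous w ∧
      ∀ t, w t * w t = 1 - t ^ 2 / (|t| + δ) ^ 2 := by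
    refine ⟨fun t => √(1 - t ^ 2 / (|t| + δ) ^ 2), ?_, fun t => ?_⟩
    · refine Real.continuous_sqrt.comp (continuous_const.sub ?_)
      exact Continuous.div (by fun_prop) (by fun_prop) fun t => (pow_pos (hpos t) 2).ne'
    · exact Real.mul_self_sqrt (sub_nonneg.2 (hfrac t))
  obtain ⟨s, hs, hss⟩ : ∃ s : B, IsSelfAdjoint s ∧ s * s = a :=
    ⟨CFC.sqrt a, .of_nonneg (CFC.sqrt_nonneg a), CFC.sqrt_mul_sqrt_self a ha⟩
  have hQ : IsSelfAdjoint (cfc w d) := cfc_predicate w d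
  have key : cfc k d * d * cfc k d = 1 - cfc w d * cfc w d := by
    rw [cfc_mul_self_mul_cfc hk hdsa, cfc_mul_cfc hw hw, ← cfc_const_one ℝ d,
      ← cfc_sub (fun _ => (1 : ℝ)) (fun t => w t * w t) d continuousOn_const
        (hw.mul hw).continuousOn]
    refine cfc_congr fun t ht => ?_
    have ht0 : 0 ≤ t := spectrum_nonneg_of_nonneg hd ht
    simp only [hkd, hww]
    rw [abs_of_nonneg ht0]
    have hne : t + δ ≠ 0 := by positivity
    field_simp
    rw [Real.sq_sqrt ht0]; ring
  have hka : IsSelfAdjoint (cfc k d) := cfc_predicate k d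
  have h5 : cfc w d * d * cfc w d = cfc (fun t => w t * t * w t) d :=
    cfc_mul_self_mul_cfc hw hdsa
  have h8 : ‖cfc w d * d * cfc w d‖ ≤ 2 * δ := by
    rw [h5]
    refine norm_cfc_le (by positivity) fun t ht => ?_
    have ht0 : 0 ≤ t := spectrum_nonneg_of_nonneg hd ht
    have h6 : w t * t * w t = t * (1 - t ^ 2 / (|t| + δ) ^ 2) := by
      rw [← hww]; ring
    rw [h6, Real.norm_of_nonneg (mul_nonneg ht0 (sub_nonneg.2 (hfrac t))), abs_of_nonneg ht0]
    have h7 : t * (1 - t ^ 2 / (t + δ) ^ 2) = t * (2 * t * δ + δ ^ 2) / (t + δ) ^ 2 := by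
      have hne : t + δ ≠ 0 := by positivity
      field_simp; ring
    rw [h7, div_le_iff₀ (by positivity)]
    nlinarith [mul_nonneg ht0 hδ.le, mul_nonneg ht0 (sq_nonneg δ), pow_pos hδ 3]
  generalize cfc w d = Q at *
  generalize cfc k d = K at *
  refine ⟨s * K, ?_⟩
  have e1 : s * K * d * star (s * K) - a = -(star (Q * s) * (Q * s)) := by
    rw [star_mul, star_mul, hs.star_eq, hQ.star_eq, hka.star_eq]
    calc s * K * d * (K * s) - a = s * (K * d * K) * s - s * s := by
          rw [hss]; noncomm_ring
      _ = _ := by rw [key]; noncomm_ring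
  rw [e1, norm_neg, CStarRing.norm_star_mul_self, ← CStarRing.norm_self_mul_star, star_mul,
    hs.star_eq, hQ.star_eq]
  have e2 : Q * s * (s * Q) = Q * a * Q := by rw [← hss]; noncomm_ring
  rw [e2]
  exact (CStarAlgebra.norm_le_norm_of_nonneg_of_le (hQ.conjugate_nonneg ha)
    (hQ.conjugate_le_conjugate had)).trans_lt (h8.trans_lt hδε)

/-- A quadratic perturbation estimate: if `‖d - c‖ ≤ r`, then
`(1 + r/s) (s² - c²) ≤ (s + r)² - d²`. The difference of the two sides is
`(rs)⁻¹ (rc - s(d-c))² + (1 + s/r) (r² - (d-c)²)`. -/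
theorem sq_sub_sq_le [PartialOrder B] [StarOrderedRing B] {c d : B} (hc : IsSelfAdjoint c)
    (hd : IsSelfAdjoint d) {s r : ℝ} (hs : 0 < s) (hr : 0 < r) (hcd : ‖d - c‖ ≤ r) :
    (1 + r / s) • (algebraMap ℝ B (s ^ 2) - c * c) ≤ algebraMap ℝ B ((s + r) ^ 2) - d * d := by
  obtain ⟨e, rfl⟩ : ∃ e, d = c + e := ⟨d - c, by simp⟩
  rw [add_sub_cancel_left] at hcd
  have he : IsSelfAdjoint e := by simpa using hd.sub hc
  have h1 : e * e ≤ algebraMap ℝ B (r ^ 2) := by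
    have h1 : e * e ≤ algebraMap ℝ B ‖e * e‖ := by
      refine IsSelfAdjoint.le_algebraMap_norm_self ?_
      rw [isSelfAdjoint_iff, star_mul, he.star_eq]
    refine h1.trans (algebraMap_mono B ?_)
    calc ‖e * e‖ ≤ ‖e‖ * ‖e‖ := norm_mul_le _ _
      _ ≤ r ^ 2 := by rw [sq]; gcongr
  have h2 : 0 ≤ (r • c - s • e) * (r • c - s • e) := by
    have hsa : IsSelfAdjoint (r • c - s • e) :=
      ((IsSelfAdjoint.all r).smul hc).sub ((IsSelfAdjoint.all s).smul he)
    exact hsa.mul_self_nonneg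
  rw [← sub_nonneg]
  have key : algebraMap ℝ B ((s + r) ^ 2) - (c + e) * (c + e)
        - (1 + r / s) • (algebraMap ℝ B (s ^ 2) - c * c)
      = (s * r)⁻¹ • ((r • c - s • e) * (r • c - s • e))
        + (1 + s / r) • (algebraMap ℝ B (r ^ 2) - e * e) := by
    simp only [Algebra.algebraMap_eq_smul_one, mul_add, add_mul, mul_sub, sub_mul, smul_mul_assoc,
      mul_smul_comm]
    match_scalars <;> field_simp <;> ring
  rw [key]
  exact add_nonneg (smul_nonneg (by positivity) h2)
    (smul_nonneg (by positivity) (sub_nonneg.2 h1))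

theorem cfc_quadratic {c : B} (hc : IsSelfAdjoint c) (m k s : ℝ) :
    cfc (fun t => k * (s ^ 2 - (t - m) ^ 2)) c =
      k • (algebraMap ℝ B (s ^ 2) - (c - algebraMap ℝ B m) * (c - algebraMap ℝ B m)) := by
  have hC : c - algebraMap ℝ B m = cfc (fun t : ℝ => t - m) c := by
    rw [cfc_sub (fun t : ℝ => t) (fun _ => m) c (continuousOn_id' _) continuousOn_const,
      cfc_id' ℝ c hc, cfc_const m c hc]
  rw [hC, cfc_mul_cfc (by fun_prop) (by fun_prop), ← cfc_const (s ^ 2) c hc,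
    ← cfc_sub (fun _ => s ^ 2) (fun t : ℝ => (t - m) * (t - m)) c continuousOn_const
      (by fun_prop), ← cfc_const_mul k _ c (by fun_prop)]
  exact cfc_congr fun t _ => by ring

/-- Comparison of two self-adjoint elements at distance at most `r` on a single interval: functions
of `c` supported well inside `(m - s, m + s)` are approximately dominated by a function of `d` with
open support `(m - s - r, m + s + r)`. -/
theorem interval_approx {c d : B} (hc : IsSelfAdjoint c) (hd : IsSelfAdjoint d) {m s' s r : ℝ}
    (hs' : 0 ≤ s') (hs : s' < s) (hr : 0 < r) (hcd : ‖c - d‖ ≤ r) {h : ℝ → ℝ} (hh : Continuous h)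
    (h0 : ∀ t, 0 ≤ h t) (hsupp : ∀ t ∈ spectrum ℝ c, h t ≠ 0 → |t - m| ≤ s') {ε : ℝ} (hε : 0 < ε) :
    ∃ x : B, ‖x * cfc (fun t => max 0 ((s + r) ^ 2 - (t - m) ^ 2)) d * star x - cfc h c‖ < ε := by
  let _ := CStarAlgebra.spectralOrder B
  let _ := CStarAlgebra.spectralOrderedRing B
  have hs0 : 0 < s := hs'.trans_lt hs
  have hκ : 0 < 1 + r / s := by positivity
  obtain ⟨δ, hδ, hδe⟩ : ∃ δ, 0 < δ ∧ δ = (1 + r / s) * (s ^ 2 - s' ^ 2) :=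
    ⟨_, mul_pos hκ (by nlinarith), rfl⟩
  obtain ⟨x, hxd⟩ : ∃ x : ℝ → ℝ, x = fun t => (1 + r / s) * (s ^ 2 - (t - m) ^ 2) := ⟨_, rfl⟩
  have hx : Continuous x := by rw [hxd]; fun_prop
  obtain ⟨p, hp, hpp⟩ : ∃ p : ℝ → ℝ, Continuous p ∧ ∀ t, p t * p t = h t / max δ (x t) := by
    refine ⟨fun t => √(h t / max δ (x t)), Real.continuous_sqrt.comp (hh.div (by fun_prop) fun t =>
      (lt_max_of_lt_left hδ).ne'), fun t => ?_⟩
    exact Real.mul_self_sqrt (div_nonneg (h0 t) (hδ.le.trans (le_max_left _ _)))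
  have hpx : ∀ t ∈ spectrum ℝ c, p t * x t * p t = h t := fun t htc => by
    rw [mul_right_comm, hpp]
    by_cases ht : h t = 0
    · simp [ht]
    · have hxt : δ ≤ x t := by
        have : (t - m) ^ 2 ≤ s' ^ 2 := by
          rw [← sq_abs]; gcongr; exact hsupp t htc ht
        simp only [hδe, hxd]; gcongr
      rw [max_eq_right hxt, div_mul_cancel₀ _ (hδ.trans_le hxt).ne']
  have hP : IsSelfAdjoint (cfc p c) := cfc_predicate p c
  have hPX : cfc p c * cfc x c * cfc p c = cfc h c := by
    rw [cfc_mul_cfc hp hx, cfc_mul_cfc (f := fun t => p t * x t) (hp.mul hx) hp]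
    exact cfc_congr fun t ht => hpx t ht
  have hC : IsSelfAdjoint (c - algebraMap ℝ B m) := hc.sub (IsSelfAdjoint.algebraMap B (.all m))
  have hD : IsSelfAdjoint (d - algebraMap ℝ B m) := hd.sub (IsSelfAdjoint.algebraMap B (.all m))
  have hCD : ‖(d - algebraMap ℝ B m) - (c - algebraMap ℝ B m)‖ ≤ r := by
    rw [sub_sub_sub_cancel_right, norm_sub_rev]; exact hcd
  have h1 := sq_sub_sq_le hC hD hs0 hr hCD
  rw [← cfc_quadratic hc, ← hxd] at h1
  have h2 := cfc_quadratic hd m 1 (s + r)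
  rw [one_smul] at h2
  rw [← h2] at h1
  have h3 : cfc (fun t => 1 * ((s + r) ^ 2 - (t - m) ^ 2)) d ≤
      cfc (fun t => max 0 ((s + r) ^ 2 - (t - m) ^ 2)) d :=
    cfc_mono (fun t _ => by rw [one_mul]; exact le_max_right _ _) (by fun_prop) (by fun_prop)
  have h4 : 0 ≤ cfc h c := cfc_nonneg fun t _ => h0 t
  have h5 := hP.conjugate_le_conjugate (h1.trans h3)
  rw [hPX] at h5
  obtain ⟨z, hz⟩ := exists_conj_approx_of_le h4 h5 hε
  refine ⟨z * cfc p c, ?_⟩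
  rw [star_mul, hP.star_eq]
  convert hz using 3
  noncomm_ring

/-- A function whose support is contained in that of `g` is approximated by functions `y g y`. -/
theorem exists_sandwich_approx {d : B} {e g : ℝ → ℝ} (he : Continuous e)
    (hg : Continuous g) (he0 : ∀ t, 0 ≤ e t) (hg0 : ∀ t, 0 ≤ g t)
    (hsupp : Function.support e ⊆ Function.support g) {ε : ℝ} (hε : 0 < ε) :
    ∃ y : ℝ → ℝ, Continuous y ∧ Function.support y ⊆ Function.support e ∧
      ‖cfc (fun t => y t * g t * y t) d - cfc e d‖ ≤ ε := by
  have hK : IsCompact (spectrum ℝ d) := spectrum.isCompact d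
  obtain ⟨M, hM⟩ : ∃ M, ∀ t ∈ spectrum ℝ d, e t ≤ M := by
    obtain ⟨M, hM⟩ := (hK.image he).bddAbove
    exact ⟨M, fun t ht => hM ⟨t, ht, rfl⟩⟩
  obtain ⟨m, hm, hgm⟩ : ∃ m, 0 < m ∧ ∀ t ∈ spectrum ℝ d, ε ≤ e t → m ≤ g t := by
    have hK' : IsCompact (spectrum ℝ d ∩ {t | ε ≤ e t}) :=
      hK.inter_right (isClosed_le continuous_const he)
    rcases (spectrum ℝ d ∩ {t | ε ≤ e t}).eq_empty_or_nonempty with h | h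
    · refine ⟨1, one_pos, fun t ht hte => ?_⟩
      have : t ∈ spectrum ℝ d ∩ {t | ε ≤ e t} := ⟨ht, hte⟩
      simp [h] at this
    · obtain ⟨t₀, ht₀, hmin⟩ := hK'.exists_isMinOn h hg.continuousOn
      refine ⟨g t₀, ?_, fun t ht hte => hmin ⟨ht, hte⟩⟩
      exact lt_of_le_of_ne (hg0 t₀) (Ne.symm (hsupp (hε.trans_le ht₀.2).ne'))
  obtain ⟨δ, hδ, hδM⟩ : ∃ δ, 0 < δ ∧ M * δ ≤ ε * m := by
    refine ⟨ε * m / (|M| + 1), by positivity, ?_⟩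
    rw [mul_div_assoc', div_le_iff₀ (by positivity)]
    nlinarith [le_abs_self M, mul_pos hε hm]
  have hpos : ∀ t, 0 < g t + δ := fun t => add_pos_of_nonneg_of_pos (hg0 t) hδ
  refine ⟨fun t => √(e t / (g t + δ)), Real.continuous_sqrt.comp (he.div (by fun_prop) fun t =>
    (hpos t).ne'), fun t ht h => ht (by simp [h]), ?_⟩
  rw [← cfc_sub _ _ d (by
    have : Continuous fun t => √(e t / (g t + δ)) :=
      Real.continuous_sqrt.comp (he.div (by fun_prop) fun t => (hpos t).ne')
    fun_prop) he.continuousOn]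
  refine norm_cfc_le hε.le fun t ht => ?_
  have e1 : √(e t / (g t + δ)) * g t * √(e t / (g t + δ)) - e t = -(e t * δ / (g t + δ)) := by
    rw [mul_right_comm, Real.mul_self_sqrt (div_nonneg (he0 t) (hpos t).le)]
    field_simp [(hpos t).ne']
    ring
  rw [e1, norm_neg, Real.norm_of_nonneg (div_nonneg (mul_nonneg (he0 t) hδ.le) (hpos t).le),
    div_le_iff₀ (hpos t)]
  rcases le_total ε (e t) with h | h
  · have h1 := hgm t ht h
    have h2 := hM t ht
    nlinarith
  · nlinarith [hg0 t]

theorem exists_hasOpenSupport {O : Set ℝ} (hO : IsOpen O) : ∃ f, HasOpenSupport f O := by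
  rcases Oᶜ.eq_empty_or_nonempty with h | h
  · refine ⟨fun _ => 1, continuous_const, fun _ => zero_le_one, ?_⟩
    rw [Set.compl_empty_iff.1 h]; ext; simp
  · refine ⟨fun t => Metric.infDist t Oᶜ, Metric.continuous_infDist_pt _,
      fun _ => Metric.infDist_nonneg, ?_⟩
    ext t
    rw [Function.mem_support, ← not_iff_not, not_not, ← Set.mem_compl_iff,
      hO.isClosed_compl.mem_iff_infDist_zero h]

theorem cuntzLE_of_forall_approx {c d : B}
    (h : ∀ ε > 0, ∃ x : B, ‖x * d * star x - c‖ < ε) : CuntzLE c d := by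
  choose x hx using fun n : ℕ => h (1 / ((n : ℝ) + 1)) (by positivity)
  refine ⟨x, tendsto_iff_norm_sub_tendsto_zero.2 ?_⟩
  exact squeeze_zero (fun _ => norm_nonneg _) (fun n => (hx n).le)
    tendsto_one_div_add_atTop_nhds_zero_nat

/-- The part of `f` living on a connected component of an open set containing its support is
continuous. -/
theorem continuous_indicator_connectedComponentIn {f : ℝ → ℝ} (hf : Continuous f) {V : Set ℝ}
    (hV : IsOpen V) (hfV : Function.support f ⊆ V) (x : ℝ) :
    Continuous ((connectedComponentIn V x).indicator f) := by
  have hJ : IsOpen (connectedComponentIn V x) := hV.connectedComponentIn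
  refine continuous_iff_continuousAt.2 fun t => ?_
  by_cases ht : t ∈ V
  · by_cases htJ : t ∈ connectedComponentIn V x
    · refine hf.continuousAt.congr ?_
      filter_upwards [hJ.mem_nhds htJ] with y hy
      rw [Set.indicator_of_mem hy]
    · refine (continuousAt_const (y := (0 : ℝ))).congr ?_
      filter_upwards [hV.connectedComponentIn.mem_nhds (mem_connectedComponentIn ht)] with y hy
      rw [Set.indicator_of_notMem]
      intro hy'
      refine htJ ?_
      rw [connectedComponentIn_eq hy', ← connectedComponentIn_eq hy]
      exact mem_connectedComponentIn ht
  · have h0 : f t = 0 := by_contra fun h => ht (hfV h)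
    classical
    rw [ContinuousAt, Set.indicator_apply]
    simp only [h0, ite_self]
    rw [tendsto_zero_iff_abs_tendsto_zero]
    have h1 : Filter.Tendsto (fun y => |f y|) (𝓝 t) (𝓝 0) := by
      have := hf.continuousAt (x := t)
      rw [ContinuousAt, h0, tendsto_zero_iff_abs_tendsto_zero] at this
      exact this
    refine squeeze_zero (fun _ => abs_nonneg _) (fun y => ?_) h1
    rw [Function.comp_apply, Set.indicator_apply]
    split_ifs
    · exact le_rfl
    · simp

theorem mem_component_of_near {U : Set ℝ} {r : ℝ} {x : ℝ} {S : Set ℝ}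
    (hSU : S ⊆ U) (hSJ : S ⊆ connectedComponentIn (Metric.thickening r U) x) (hr : 0 < r)
    {u u' t : ℝ} (hu : u ∈ S) (hu' : u' ∈ S) (h1 : u < t + r) (h2 : t - r < u') :
    t ∈ connectedComponentIn (Metric.thickening r U) x := by
  have hball : ∀ v ∈ S, Metric.ball v r ⊆ connectedComponentIn (Metric.thickening r U) x := by
    intro v hv
    rw [connectedComponentIn_eq (hSJ hv)]
    exact (convex_ball v r).isPreconnected.subset_connectedComponentIn (Metric.mem_ball_self hr)
      (Metric.ball_subset_thickening (hSU hv) r)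
  by_cases h3 : t < u + r
  · exact hball u hu (by rw [Metric.mem_ball, Real.dist_eq, abs_lt]; constructor <;> linarith)
  by_cases h4 : u' - r < t
  · exact hball u' hu' (by rw [Metric.mem_ball, Real.dist_eq, abs_lt]; constructor <;> linarith)
  exact isPreconnected_connectedComponentIn.ordConnected.out (hSJ hu) (hSJ hu')
    ⟨by linarith, by linarith⟩

/-- The single-component step in comparing functions of `c` and `d`. -/
theorem component_approx {c d : B} (hc : IsSelfAdjoint c) (hd : IsSelfAdjoint d) {r : ℝ}
    (hcd : ‖c - d‖ < r) {U : Set ℝ} {x : ℝ} {g h : ℝ → ℝ} (hg : Continuous g)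
    (hg0 : ∀ t, 0 ≤ g t) (hgU : Function.support g = Metric.thickening r U)
    (hh : Continuous h) (h0 : ∀ t, 0 ≤ h t)
    (hhU : Function.support h ⊆ U ∩ connectedComponentIn (Metric.thickening r U) x)
    {ε : ℝ} (hε : 0 < ε) :
    ∃ (z : B) (y : ℝ → ℝ), Continuous y ∧
      Function.support y ⊆ connectedComponentIn (Metric.thickening r U) x ∧
      ‖(z * cfc y d) * cfc g d * star (z * cfc y d) - cfc h c‖ < ε := by
  have hr : 0 < r := (norm_nonneg _).trans_lt hcd
  set S := spectrum ℝ c ∩ Function.support h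
  rcases S.eq_empty_or_nonempty with hS | hS
  · refine ⟨0, fun _ => 0, continuous_const, by simp, ?_⟩
    have : cfc h c = 0 := by
      rw [cfc_congr (g := fun _ => 0) fun t ht => by_contra fun hne => ?_, cfc_const_zero]
      have : t ∈ S := ⟨ht, hne⟩
      simp [hS] at this
    simpa [this] using hε
  have hbdd : Bornology.IsBounded S := (spectrum.isCompact c).isBounded.subset Set.inter_subset_left
  have hSU : S ⊆ U := fun t ht => (hhU ht.2).1
  have hSJ : S ⊆ connectedComponentIn (Metric.thickening r U) x := fun t ht => (hhU ht.2).2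
  have hα : ∀ t ∈ S, sInf S ≤ t := fun t ht => csInf_le hbdd.bddBelow ht
  have hβ : ∀ t ∈ S, t ≤ sSup S := fun t ht => le_csSup hbdd.bddAbove ht
  have hJ : ∀ t, sInf S - r < t → t < sSup S + r →
      t ∈ connectedComponentIn (Metric.thickening r U) x := by
    intro t h1 h2
    obtain ⟨u, hu, hut⟩ := exists_lt_of_csInf_lt hS (show sInf S < t + r by linarith)
    obtain ⟨u', hu', hut'⟩ := exists_lt_of_lt_csSup hS (show t - r < sSup S by linarith)
    exact mem_component_of_near hSU hSJ hr hu hu' hut hut'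
  obtain ⟨t₀, ht₀⟩ := hS
  have hαβ := (hα t₀ ht₀).trans (hβ t₀ ht₀)
  -- a radius between `‖c - d‖` and `r` makes the inner interval open around `S`
  obtain ⟨r', hr1, hr2⟩ := exists_between hcd
  have hr'0 : 0 < r' := (norm_nonneg _).trans_lt hr1
  obtain ⟨z, hz⟩ := interval_approx hc hd (m := (sInf S + sSup S) / 2)
    (s' := (sSup S - sInf S) / 2) (s := (sSup S - sInf S) / 2 + (r - r')) (r := r')
    (by linarith) (by linarith) hr'0 hr1.le hh h0
    (fun t ht hne => by
      have h1 := hα t ⟨ht, hne⟩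
      have h2 := hβ t ⟨ht, hne⟩
      rw [abs_le]; constructor <;> linarith) (half_pos hε)
  set e : ℝ → ℝ := fun t => max 0 (((sSup S - sInf S) / 2 + (r - r') + r') ^ 2 -
    (t - (sInf S + sSup S) / 2) ^ 2)
  have he : Function.support e ⊆ connectedComponentIn (Metric.thickening r U) x := by
    intro t ht
    have h1 : 0 < ((sSup S - sInf S) / 2 + (r - r') + r') ^ 2 -
        (t - (sInf S + sSup S) / 2) ^ 2 := by
      by_contra hle
      exact ht (max_eq_left (not_lt.1 hle))
    have h2 : |t - (sInf S + sSup S) / 2| < (sSup S - sInf S) / 2 + (r - r') + r' :=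
      abs_lt_of_sq_lt_sq (sub_pos.1 h1) (by linarith)
    rw [abs_lt] at h2
    exact hJ t (by linarith [h2.1]) (by linarith [h2.2])
  have hec : Continuous e := by fun_prop
  have he0 : ∀ t, 0 ≤ e t := fun t => le_max_left _ _
  clear_value e
  obtain ⟨y, hy, hye, hyn⟩ := exists_sandwich_approx (d := d) hec hg
    he0 hg0
    (he.trans ((connectedComponentIn_subset _ _).trans hgU.ge))
    (ε := ε / 2 / (‖z‖ * ‖z‖ + 1)) (by positivity)
  refine ⟨z, y, hy, hye.trans he, ?_⟩
  have hys : IsSelfAdjoint (cfc y d) := cfc_predicate y d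
  have e1 : z * cfc y d * cfc g d * star (z * cfc y d) - cfc h c
      = z * (cfc (fun t => y t * g t * y t) d - cfc e d) * star z
        + (z * cfc e d * star z - cfc h c) := by
    rw [← cfc_mul_cfc (f := fun t => y t * g t) (hy.mul hg) hy, ← cfc_mul_cfc hy hg, star_mul,
      hys.star_eq]
    noncomm_ring
  rw [e1]
  have h3 : ‖z * (cfc (fun t => y t * g t * y t) d - cfc e d) * star z‖ ≤ ε / 2 := by
    calc _ ≤ ‖z‖ * ‖cfc (fun t => y t * g t * y t) d - cfc e d‖ * ‖z‖ := by
          refine (norm_mul_le _ _).trans ?_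
          rw [norm_star]
          gcongr
          exact norm_mul_le _ _
      _ ≤ ‖z‖ * (ε / 2 / (‖z‖ * ‖z‖ + 1)) * ‖z‖ := by gcongr
      _ = ε / 2 * (‖z‖ * ‖z‖ / (‖z‖ * ‖z‖ + 1)) := by ring
      _ ≤ ε / 2 * 1 := by
          gcongr
          rw [div_le_one (by positivity)]; linarith
      _ = ε / 2 := mul_one _
  calc _ ≤ _ := norm_add_le _ _
    _ < ε / 2 + ε / 2 := add_lt_add_of_le_of_lt h3 hz
    _ = ε := add_halves ε

end Cuntz

/-! ### The Cuntz distance is at most the unitary distance -/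

section CuntzGlobal

variable {B : Type*} [CStarAlgebra B]

/-- Elements at distance less than `r` satisfy `f_U(c) ≾ f_{U_r}(d)` for every open set `U`. The
connected components of `U_r` reduce this to single intervals; by compactness of the spectrum only
finitely many of them matter, and their contributions on the side of `d` are orthogonal. -/
theorem openLE_of_norm_sub_lt {c d : B} (hc : IsSelfAdjoint c) (hd : IsSelfAdjoint d) {r : ℝ}
    (hcd : ‖c - d‖ < r) {U : Set ℝ} (hU : IsOpen U) : OpenLE c d U (Metric.thickening r U) := by
  classical
  have hr : 0 < r := (norm_nonneg _).trans_lt hcd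
  obtain ⟨f, hf⟩ := exists_hasOpenSupport hU
  obtain ⟨g, hg⟩ := exists_hasOpenSupport (Metric.isOpen_thickening (δ := r) (E := U))
  refine ⟨f, g, hf, hg, cuntzLE_of_forall_approx fun ε hε => ?_⟩
  set V := Metric.thickening r U with hV
  have hVo : IsOpen V := Metric.isOpen_thickening
  have hUV : U ⊆ V := Metric.self_subset_thickening hr U
  -- cut `f` off, so that it lives on a compact subset `K` of `U`
  set k : ℝ → ℝ := fun t => max 0 (f t - ε / 4)
  have hk : Continuous k := continuous_const.max (hf.1.sub continuous_const)
  have hk0 : ∀ t, 0 ≤ k t := fun t => le_max_left _ _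
  have hkf : ‖cfc k c - cfc f c‖ ≤ ε / 4 := by
    rw [← cfc_sub k f c hk.continuousOn hf.1.continuousOn]
    refine norm_cfc_le (by positivity) fun t _ => ?_
    rw [Real.norm_eq_abs, abs_le]
    have := hf.2.1 t
    constructor
    · linarith [le_max_right 0 (f t - ε / 4)]
    · have : k t ≤ f t := max_le this (by linarith)
      linarith
  have hkε : ∀ t, k t ≠ 0 → ε / 4 ≤ f t := fun t ht => by
    by_contra hlt
    exact ht (max_eq_left (by linarith))
  have hkU : Function.support k ⊆ U := fun t ht => by
    rw [← hf.2.2]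
    exact ne_of_gt (lt_of_lt_of_le (by positivity) (hkε t ht))
  have hK : IsCompact (spectrum ℝ c ∩ {t | ε / 4 ≤ f t}) :=
    (spectrum.isCompact c).inter_right (isClosed_le continuous_const hf.1)
  have hKV : spectrum ℝ c ∩ {t | ε / 4 ≤ f t} ⊆ V := fun t ht => hUV (by
    rw [← hf.2.2]
    exact ne_of_gt (lt_of_lt_of_le (by positivity) ht.2))
  obtain ⟨T, hT⟩ := hK.elim_finite_subcover (fun t => connectedComponentIn V t)
    (fun t => hVo.connectedComponentIn)
    (fun t ht => Set.mem_iUnion.2 ⟨t, mem_connectedComponentIn (hKV ht)⟩)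
  set 𝒥 : Finset (Set ℝ) := T.image fun t => connectedComponentIn V t
  have hdisj : ∀ J ∈ 𝒥, ∀ J' ∈ 𝒥, ∀ t, t ∈ J → t ∈ J' → J = J' := by
    intro J hJ J' hJ' t ht ht'
    obtain ⟨x, -, rfl⟩ := Finset.mem_image.1 hJ
    obtain ⟨x', -, rfl⟩ := Finset.mem_image.1 hJ'
    rw [connectedComponentIn_eq ht, connectedComponentIn_eq ht']
  have hkJ : ∀ J ∈ 𝒥, Continuous (J.indicator k) := by
    intro J hJ
    obtain ⟨x, -, rfl⟩ := Finset.mem_image.1 hJ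
    exact continuous_indicator_connectedComponentIn hk hVo (hkU.trans hUV) x
  have hsum : cfc k c = ∑ J ∈ 𝒥, cfc (J.indicator k) c := by
    rw [← cfc_sum _ c 𝒥 fun J hJ => (hkJ J hJ).continuousOn]
    refine cfc_congr fun t ht => ?_
    rw [Finset.sum_apply]
    by_cases h : k t = 0
    · rw [h, Finset.sum_eq_zero]
      intro J _
      by_cases htJ : t ∈ J <;> simp [htJ, h]
    · have h1 : t ∈ ⋃ i ∈ T, connectedComponentIn V i := hT ⟨ht, hkε t h⟩
      simp only [Set.mem_iUnion] at h1
      obtain ⟨i, hi, hti⟩ := h1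
      have hJ : connectedComponentIn V i ∈ 𝒥 := Finset.mem_image_of_mem _ hi
      rw [Finset.sum_eq_single_of_mem _ hJ, Set.indicator_of_mem hti]
      intro J hJ' hne
      exact Set.indicator_of_notMem (fun htJ => hne (hdisj J hJ' _ hJ t htJ hti)) _
  have hη : 0 < ε / (4 * (𝒥.card + 1)) := by positivity
  have hpiece : ∀ J : Set ℝ, ∃ (z : B) (y : ℝ → ℝ), J ∈ 𝒥 → Continuous y ∧ Function.support y ⊆ J ∧
      ‖(z * cfc y d) * cfc g d * star (z * cfc y d) - cfc (J.indicator k) c‖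
        < ε / (4 * (𝒥.card + 1)) := by
    intro J
    by_cases hJ : J ∈ 𝒥
    · obtain ⟨x, -, hx⟩ := Finset.mem_image.1 hJ
      obtain ⟨z, y, h1, h2, h3⟩ := component_approx hc hd hcd (x := x) hg.1 hg.2.1 hg.2.2
        (hkJ J hJ) (fun t => Set.indicator_nonneg (fun t _ => hk0 t) t)
        (fun t ht => by
          have htJ : t ∈ J := by
            by_contra hn
            exact ht (Set.indicator_of_notMem hn _)
          rw [Function.mem_support, Set.indicator_of_mem htJ] at ht
          exact ⟨hkU ht, by rw [← hV]; exact hx.symm ▸ htJ⟩) hη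
      rw [← hV] at h2
      exact ⟨z, y, fun _ => ⟨h1, hx ▸ h2, h3⟩⟩
    · exact ⟨0, 0, fun h => absurd h hJ⟩
  choose z y hzy using hpiece
  have horth : ∀ J ∈ 𝒥, ∀ J' ∈ 𝒥, J ≠ J' → cfc (y J) d * cfc g d * cfc (y J') d = 0 := by
    intro J hJ J' hJ' hne
    rw [cfc_mul_cfc (hzy J hJ).1 hg.1,
      cfc_mul_cfc (f := fun t => y J t * g t) ((hzy J hJ).1.mul hg.1) (hzy J' hJ').1,
      ← cfc_const_zero ℝ d]
    refine cfc_congr fun t _ => ?_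
    by_cases h1 : y J t = 0
    · simp [h1]
    by_cases h2 : y J' t = 0
    · simp [h2]
    exact absurd (hdisj J hJ J' hJ' t ((hzy J hJ).2.1 h1) ((hzy J' hJ').2.1 h2)) hne
  refine ⟨∑ J ∈ 𝒥, z J * cfc (y J) d, ?_⟩
  have hprod : (∑ J ∈ 𝒥, z J * cfc (y J) d) * cfc g d * star (∑ J ∈ 𝒥, z J * cfc (y J) d)
      = ∑ J ∈ 𝒥, (z J * cfc (y J) d) * cfc g d * star (z J * cfc (y J) d) := by
    rw [star_sum, Finset.sum_mul, Finset.sum_mul]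
    refine Finset.sum_congr rfl fun J hJ => ?_
    rw [Finset.mul_sum, Finset.sum_eq_single_of_mem J hJ]
    intro J' hJ' hne
    have h1 : IsSelfAdjoint (cfc (y J') d) := cfc_predicate _ d
    rw [star_mul, h1.star_eq]
    calc z J * cfc (y J) d * cfc g d * (cfc (y J') d * star (z J'))
        = z J * (cfc (y J) d * cfc g d * cfc (y J') d) * star (z J') := by noncomm_ring
      _ = 0 := by rw [horth J hJ J' hJ' hne.symm]; simp
  have hsmall : ‖(∑ J ∈ 𝒥, (z J * cfc (y J) d) * cfc g d * star (z J * cfc (y J) d)) - cfc k c‖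
      ≤ ε / 4 := by
    rw [hsum, ← Finset.sum_sub_distrib]
    refine (norm_sum_le_of_le 𝒥 fun J hJ => (hzy J hJ).2.2.le).trans ?_
    rw [Finset.sum_const, nsmul_eq_mul, mul_div_assoc', div_le_div_iff₀ (by positivity)
      (by positivity)]
    nlinarith
  rw [hprod]
  calc _ ≤ _ := norm_sub_le_norm_sub_add_norm_sub _ (cfc k c) _
    _ ≤ ε / 4 + ε / 4 := add_le_add hsmall hkf
    _ < ε := by linarith

theorem cfc_unitary_conj (u : unitary B) {c : B} (hc : IsSelfAdjoint c) {f : ℝ → ℝ}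
    (hf : Continuous f) : cfc f ((u : B) * c * star (u : B)) = u * cfc f c * star (u : B) := by
  have hcont : Continuous (Unitary.conjStarAlgAut ℂ B u) := by
    change Continuous fun x => (u : B) * x * star (u : B)
    fun_prop
  have h1 : IsSelfAdjoint (Unitary.conjStarAlgAut ℂ B u c) := by
    simpa using hc.conjugate (u : B)
  exact (StarAlgHomClass.map_cfc (S := ℂ) (Unitary.conjStarAlgAut ℂ B u) f c hf.continuousOn hcont
    hc h1).symm

theorem OpenLE.of_conj_left {u : unitary B} {c d : B} (hc : IsSelfAdjoint c) {O O' : Set ℝ}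
    (h : OpenLE ((u : B) * c * star (u : B)) d O O') : OpenLE c d O O' := by
  obtain ⟨f, g, hf, hg, x, hx⟩ := h
  refine ⟨f, g, hf, hg, fun n => star (u : B) * x n, ?_⟩
  rw [cfc_unitary_conj u hc hf.1] at hx
  have h1 := (hx.const_mul (star (u : B))).mul_const (u : B)
  convert h1 using 2
  · simp [mul_assoc]
  · have : star (u : B) * u = 1 := Unitary.coe_star_mul_self u
    calc cfc f c = (star (u : B) * u) * cfc f c * (star (u : B) * u) := by rw [this]; simp
      _ = _ := by noncomm_ring

theorem OpenLE.of_conj_right {u : unitary B} {c d : B} (hc : IsSelfAdjoint c) {O O' : Set ℝ}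
    (h : OpenLE d ((u : B) * c * star (u : B)) O O') : OpenLE d c O O' := by
  obtain ⟨f, g, hf, hg, x, hx⟩ := h
  refine ⟨f, g, hf, hg, fun n => x n * u, ?_⟩
  rw [cfc_unitary_conj u hc hg.1] at hx
  convert hx using 2
  simp [mul_assoc]

theorem cuntzDist_le_of_conj (S : Set ℝ) {c d : B} (hc : IsSelfAdjoint c) (hd : IsSelfAdjoint d)
    (u : unitary B) {r : ℝ} (hr : ‖(u : B) * c * star (u : B) - d‖ < r) :
    cuntzDist S c d ≤ ENNReal.ofReal r := by
  have hr0 : 0 < r := (norm_nonneg _).trans_lt hr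
  refine iSup_le fun U => iSup_le fun hU => iSup_le fun _ => ?_
  have hc' : IsSelfAdjoint ((u : B) * c * star (u : B)) := hc.conjugate _
  refine iInf_le_of_le r (iInf_le_of_le hr0 (iInf_le_of_le ?_ (iInf_le_of_le ?_ le_rfl)))
  · exact (openLE_of_norm_sub_lt hc' hd hr hU).of_conj_left hc
  · rw [norm_sub_rev] at hr
    exact (openLE_of_norm_sub_lt hd hc' hr hU).of_conj_right hc

theorem dW_le_dU {A : Type*} (S : Set ℝ) (𝓛 : Set A) (φ ψ : A → B)
    (hφ : ∀ f ∈ 𝓛, IsSelfAdjoint (φ f)) (hψ : ∀ f ∈ 𝓛, IsSelfAdjoint (ψ f)) :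
    dW S 𝓛 φ ψ ≤ dU 𝓛 φ ψ := by
  refine iSup₂_le fun f hf => ?_
  have h1 : (⨅ u : unitary B, ⨆ f' ∈ ({f} : Finset A),
      ENNReal.ofReal ‖(u : B) * φ f' * star (u : B) - ψ f'‖) ≤ dU 𝓛 φ ψ :=
    le_iSup₂_of_le {f} (by simpa using hf) le_rfl
  refine le_trans (le_of_forall_gt fun b hb => ?_) h1
  rw [iInf_lt_iff] at hb
  obtain ⟨u, hu⟩ := hb
  simp only [Finset.mem_singleton, iSup_iSup_eq_left] at hu
  obtain ⟨b', h2, h3⟩ := exists_between hu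
  have hb' : b' ≠ ⊤ := (h3.trans_le le_top).ne
  lift b' to NNReal using hb'
  refine lt_of_le_of_lt (cuntzDist_le_of_conj S (hφ f hf) (hψ f hf) u (r := b') ?_) (by simpa)
  rw [← ENNReal.ofReal_coe_nnreal] at h2
  exact (ENNReal.ofReal_lt_ofReal_iff_of_nonneg (norm_nonneg _)).1 h2

end CuntzGlobal

open Matrix

/-! ### Block diagonal matrices -/

section Block

variable {p q : ℕ} {ι α β : Type*}

/-- The index set of the block diagonal matrices with `ι` blocks from `M_p ⊗ M_q`, `α` blocks from
`M_p` and `β` blocks from `M_q`. -/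
abbrev Idx (p q : ℕ) (ι α β : Type*) : Type _ :=
  ((Fin p × Fin q) × ι) ⊕ (Fin p × α) ⊕ (Fin q × β)

variable [DecidableEq ι] [DecidableEq α] [DecidableEq β]

/-- The block diagonal matrix with blocks `F i` for `i : ι`, the block `x` repeated `α` times and
the block `y` repeated `β` times. -/
def blk (α β : Type*) [DecidableEq α] [DecidableEq β] (F : ι → MatPQ p q)
    (x : Matrix (Fin p) (Fin p) ℂ) (y : Matrix (Fin q) (Fin q) ℂ) :
    Matrix (Idx p q ι α β) (Idx p q ι α β) ℂ :=
  fromBlocks (blockDiagonal F) 0 0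
    (fromBlocks (blockDiagonal fun _ : α => x) 0 0 (blockDiagonal fun _ : β => y))

theorem blk_mul [Fintype ι] [Fintype α] [Fintype β] (F F' : ι → MatPQ p q)
    (x x' : Matrix (Fin p) (Fin p) ℂ) (y y' : Matrix (Fin q) (Fin q) ℂ) :
    blk α β F x y * blk α β F' x' y' = blk α β (fun i => F i * F' i) (x * x') (y * y') := by
  simp [blk, fromBlocks_multiply, blockDiagonal_mul]

theorem blk_conjTranspose (F : ι → MatPQ p q)
    (x : Matrix (Fin p) (Fin p) ℂ) (y : Matrix (Fin q) (Fin q) ℂ) :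
    (blk α β F x y)ᴴ = blk α β (fun i => (F i)ᴴ) xᴴ yᴴ := by
  simp [blk, fromBlocks_conjTranspose, blockDiagonal_conjTranspose]

theorem blk_one : blk α β (fun _ : ι => (1 : MatPQ p q)) 1 1 = 1 := by
  have h1 : blockDiagonal (fun _ : ι => (1 : MatPQ p q)) = 1 := blockDiagonal_one
  have h2 : blockDiagonal (fun _ : α => (1 : Matrix (Fin p) (Fin p) ℂ)) = 1 := blockDiagonal_one
  have h3 : blockDiagonal (fun _ : β => (1 : Matrix (Fin q) (Fin q) ℂ)) = 1 := blockDiagonal_one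
  rw [blk, h1, h2, h3, fromBlocks_one, fromBlocks_one]

theorem blk_sub (F F' : ι → MatPQ p q)
    (x x' : Matrix (Fin p) (Fin p) ℂ) (y y' : Matrix (Fin q) (Fin q) ℂ) :
    blk α β F x y - blk α β F' x' y' = blk α β (fun i => F i - F' i) (x - x') (y - y') := by
  have h1 : blockDiagonal (fun i => F i - F' i) = blockDiagonal F - blockDiagonal F' :=
    blockDiagonal_sub F F'
  have h2 : blockDiagonal (fun _ : α => x - x') =
    blockDiagonal (fun _ : α => x) - blockDiagonal (fun _ => x') := blockDiagonal_sub _ _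
  have h3 : blockDiagonal (fun _ : β => y - y') =
    blockDiagonal (fun _ : β => y) - blockDiagonal (fun _ => y') := blockDiagonal_sub _ _
  rw [blk, blk, blk, h1, h2, h3]
  simp only [sub_eq_add_neg, fromBlocks_neg, fromBlocks_add, neg_zero, add_zero]

theorem trace_blk [Fintype ι] [Fintype α] [Fintype β] (F : ι → MatPQ p q)
    (x : Matrix (Fin p) (Fin p) ℂ) (y : Matrix (Fin q) (Fin q) ℂ) :
    (blk α β F x y).trace =
      ∑ i, (F i).trace + Fintype.card α * x.trace + Fintype.card β * y.trace := by
  simp [blk, trace, Fintype.sum_sum_type, Fintype.sum_prod_type_right, blockDiagonal_apply, add_assoc]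

theorem continuous_blk [Fintype ι] {T : Type*} [TopologicalSpace T] {F : T → ι → MatPQ p q}
    (hF : ∀ i, Continuous fun t => F t i)
    (x : Matrix (Fin p) (Fin p) ℂ) (y : Matrix (Fin q) (Fin q) ℂ) :
    Continuous fun t => blk α β (F t) x y := by
  have h : Continuous fun t => blockDiagonal (F t) :=
    (continuous_pi hF).matrix_blockDiagonal
  exact h.matrix_fromBlocks continuous_const continuous_const continuous_const

end Block

/-! ### The irreducible representations of a dimension drop algebra -/

section Points

variable {p q : ℕ}

theorem infZero_eq (hq : 0 < q) {f : Z p q} {x : Matrix (Fin p) (Fin p) ℂ}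
    (h : (f : C(I, MatPQ p q)) 0 = x ⊗ₖ (1 : Matrix (Fin q) (Fin q) ℂ)) : infZero f = x := by
  have h1 := (infZero_spec f).symm.trans h
  ext i j
  have h2 := congrFun (congrFun h1 (i, ⟨0, hq⟩)) (j, ⟨0, hq⟩)
  simpa [kroneckerMap_apply] using h2

theorem infOne_eq (hp : 0 < p) {f : Z p q} {y : Matrix (Fin q) (Fin q) ℂ}
    (h : (f : C(I, MatPQ p q)) 1 = (1 : Matrix (Fin p) (Fin p) ℂ) ⊗ₖ y) : infOne f = y := by
  have h1 := (infOne_spec f).symm.trans h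
  ext i j
  have h2 := congrFun (congrFun h1 (⟨0, hp⟩, i)) (⟨0, hp⟩, j)
  simpa [kroneckerMap_apply] using h2

/-- Evaluation at `t ∈ [0,1]` as a *-homomorphism. -/
def evalHom (t : I) : Z p q →⋆ₙₐ[ℂ] MatPQ p q where
  toFun f := (f : C(I, MatPQ p q)) t
  map_smul' _ _ := rfl
  map_zero' := rfl
  map_add' _ _ := rfl
  map_mul' _ _ := rfl
  map_star' _ := rfl

@[simp] theorem evalHom_apply (t : I) (f : Z p q) : evalHom t f = (f : C(I, MatPQ p q)) t := rfl

/-- The representation `f ↦ f(∞_0)` as a *-homomorphism. -/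
def infZeroHom (hq : 0 < q) : Z p q →⋆ₙₐ[ℂ] Matrix (Fin p) (Fin p) ℂ where
  toFun := infZero
  map_smul' c f := infZero_eq hq (by
    rw [smul_kronecker]; exact congrArg (c • ·) (infZero_spec f))
  map_zero' := infZero_eq hq (by rw [zero_kronecker]; rfl)
  map_add' f g := infZero_eq hq (by
    rw [add_kronecker, ← infZero_spec, ← infZero_spec]; rfl)
  map_mul' f g := infZero_eq hq (by
    rw [← one_mul (1 : Matrix (Fin q) (Fin q) ℂ), mul_kronecker_mul, ← infZero_spec,
      ← infZero_spec]; rfl)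
  map_star' f := infZero_eq hq (by
    have h1 : (1 : Matrix (Fin q) (Fin q) ℂ) = (1 : Matrix (Fin q) (Fin q) ℂ)ᴴ := by simp
    rw [h1, star_eq_conjTranspose, ← conjTranspose_kronecker, ← infZero_spec]; rfl)

/-- The representation `f ↦ f(∞_1)` as a *-homomorphism. -/
def infOneHom (hp : 0 < p) : Z p q →⋆ₙₐ[ℂ] Matrix (Fin q) (Fin q) ℂ where
  toFun := infOne
  map_smul' c f := infOne_eq hp (by
    rw [kronecker_smul]; exact congrArg (c • ·) (infOne_spec f))
  map_zero' := infOne_eq hp (by rw [kronecker_zero]; rfl)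
  map_add' f g := infOne_eq hp (by
    rw [kronecker_add, ← infOne_spec, ← infOne_spec]; rfl)
  map_mul' f g := infOne_eq hp (by
    rw [← one_mul (1 : Matrix (Fin p) (Fin p) ℂ), mul_kronecker_mul, ← infOne_spec,
      ← infOne_spec]; rfl)
  map_star' f := infOne_eq hp (by
    have h1 : (1 : Matrix (Fin p) (Fin p) ℂ) = (1 : Matrix (Fin p) (Fin p) ℂ)ᴴ := by simp
    rw [h1, star_eq_conjTranspose, ← conjTranspose_kronecker, ← infOne_spec]; rfl)

/-- The scalar function `g · 1`, an element of the centre of `Z_{p,q}`. -/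
def scal (g : C(I, ℂ)) : Z p q :=
  ⟨⟨fun t => g t • 1, by fun_prop⟩,
    ⟨g 0 • 1, by simp [smul_kronecker]⟩, ⟨g 1 • 1, by simp [kronecker_smul]⟩⟩

@[simp] theorem scal_apply (g : C(I, ℂ)) (t : I) :
    (scal g : Z p q).1 t = g t • (1 : MatPQ p q) := rfl

theorem infZero_scal (hq : 0 < q) (g : C(I, ℂ)) : infZero (scal g : Z p q) = g 0 • 1 :=
  infZero_eq hq (by simp [smul_kronecker])

theorem infOne_scal (hp : 0 < p) (g : C(I, ℂ)) : infOne (scal g : Z p q) = g 1 • 1 :=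
  infOne_eq hp (by simp [kronecker_smul])

theorem ext_Z {f g : Z p q} (h : ∀ t, f.1 t = g.1 t) : f = g :=
  Subtype.ext (ContinuousMap.ext h)

theorem evalHom_surjective {t : I} (h0 : t ≠ 0) (h1 : t ≠ 1) :
    Function.Surjective (evalHom t : Z p q →⋆ₙₐ[ℂ] MatPQ p q) := by
  intro x
  have ht : ((t : ℝ) : ℂ) * (1 - (t : ℝ)) ≠ 0 := by
    have h0' : (t : ℝ) ≠ 0 := fun h => h0 (Subtype.ext h)
    have h1' : (1 : ℝ) - t ≠ 0 := fun h => h1 (Subtype.ext (sub_eq_zero.1 h).symm)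
    exact_mod_cast mul_ne_zero h0' h1'
  refine ⟨⟨⟨fun s => ((((s : ℝ) : ℂ) * (1 - (s : ℝ))) / (((t : ℝ) : ℂ) * (1 - (t : ℝ)))) • x,
    by fun_prop⟩, ⟨0, by simp⟩, ⟨0, by simp⟩⟩, ?_⟩
  simp [div_self ht]

theorem infZeroHom_surjective (hq : 0 < q) :
    Function.Surjective (infZeroHom hq : Z p q →⋆ₙₐ[ℂ] Matrix (Fin p) (Fin p) ℂ) := by
  intro x
  refine ⟨⟨⟨fun s => (1 - ((s : ℝ) : ℂ)) • (x ⊗ₖ (1 : Matrix (Fin q) (Fin q) ℂ)), by fun_prop⟩,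
    ⟨x, by simp⟩, ⟨0, by simp⟩⟩, infZero_eq hq (by simp)⟩

theorem infOneHom_surjective (hp : 0 < p) :
    Function.Surjective (infOneHom hp : Z p q →⋆ₙₐ[ℂ] Matrix (Fin q) (Fin q) ℂ) := by
  intro x
  refine ⟨⟨⟨fun s => ((s : ℝ) : ℂ) • ((1 : Matrix (Fin p) (Fin p) ℂ) ⊗ₖ x), by fun_prop⟩,
    ⟨0, by simp⟩, ⟨x, by simp⟩⟩, infOne_eq hp (by simp)⟩

end Points

/-! ### Copies of an irreducible representation -/

section Irreducible

variable {n k : Type*} [Fintype n] [DecidableEq n] [Fintype k] [DecidableEq k]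

open scoped ComplexOrder in
/-- If a vector `v` fixed by a matrix `P` commuting with the representation `ρ` is killed by the
kernel of a representation `π` onto a full matrix algebra, then the range of `P` contains a copy of
`π`: for matrix units `e_{ij}`, the vectors `ρ(e_{i j}) v` with `j` fixed span it. -/
theorem exists_isometry_of_ker_le {A : Type*} [Ring A] [StarRing A] [Algebra ℂ A]
    (ρ : A →⋆ₙₐ[ℂ] Matrix n n ℂ) (hρ : ρ 1 = 1) {P : Matrix n n ℂ}
    (hP : ∀ f, P * ρ f = ρ f * P) {v : n → ℂ} (hv : v ≠ 0) (hPv : P *ᵥ v = v)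
    (π : A →⋆ₙₐ[ℂ] Matrix k k ℂ) (hπ : Function.Surjective π) (hπ1 : π 1 = 1)
    (hker : ∀ f, π f = 0 → ρ f *ᵥ v = 0) :
    ∃ Y : Matrix n k ℂ, Yᴴ * Y = 1 ∧ (∀ f, ρ f * Y = Y * π f) ∧ P * Y = Y := by
  choose e he using fun i j => hπ (single i j 1)
  have hstar : ∀ i j, π (star (e i j)) = single j i 1 := fun i j => by
    rw [map_star π, he, star_eq_conjTranspose, conjTranspose_single, star_one]
  have hcongr : ∀ f g, π f = π g → ρ f *ᵥ v = ρ g *ᵥ v := by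
    intro f g h
    rw [← sub_eq_zero, ← sub_mulVec, ← map_sub]
    exact hker _ (by rw [map_sub, h, sub_self])
  obtain ⟨x₀, hx₀⟩ : ∃ x, ρ (e x x) *ᵥ v ≠ 0 := by
    by_contra! h
    refine hv ?_
    have h1 : π 1 = π (∑ x, e x x) := by
      rw [hπ1, map_sum, ← sum_single_one]
      exact Finset.sum_congr rfl fun x _ => (he x x).symm
    calc v = ρ 1 *ᵥ v := by rw [hρ, one_mulVec]
      _ = ρ (∑ x, e x x) *ᵥ v := hcongr _ _ h1
      _ = 0 := by
        rw [map_sum, sum_mulVec]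
        exact Finset.sum_eq_zero fun x _ => h x
  set w := ρ (e x₀ x₀) *ᵥ v
  obtain ⟨c, hc, hcw⟩ : ∃ c : ℝ, 0 < c ∧ star w ⬝ᵥ w = (c : ℂ) := by
    have h1 : 0 < star w ⬝ᵥ w := dotProduct_star_self_pos_iff.2 hx₀
    obtain ⟨h2, h3⟩ := Complex.pos_iff.1 h1
    exact ⟨_, h2, Complex.ext rfl (by simp [← h3])⟩
  have hinner : ∀ f g, star (ρ f *ᵥ v) ⬝ᵥ (ρ g *ᵥ v) = star v ⬝ᵥ (ρ (star f * g) *ᵥ v) := by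
    intro f g
    rw [star_mulVec, ← dotProduct_mulVec, mulVec_mulVec, map_mul, map_star]; rfl
  set Y₀ : Matrix n k ℂ := of fun a x => (ρ (e x x₀) *ᵥ v) a
  have hcol : ∀ (M : Matrix n n ℂ) a x, (M * Y₀) a x = (M *ᵥ (ρ (e x x₀) *ᵥ v)) a := by
    intro M a x
    simp [Y₀, mul_apply, mulVec, dotProduct]
  have hYY : Y₀ᴴ * Y₀ = (c : ℂ) • 1 := by
    ext x y
    have h1 : (Y₀ᴴ * Y₀) x y = star (ρ (e x x₀) *ᵥ v) ⬝ᵥ (ρ (e y x₀) *ᵥ v) := by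
      simp [Y₀, mul_apply, dotProduct]
    rw [h1, hinner, Matrix.smul_apply, one_apply]
    by_cases hxy : x = y
    · subst hxy
      rw [if_pos rfl, smul_eq_mul, mul_one, ← hcw, hinner]
      congr 1
      refine hcongr _ _ ?_
      simp [he, hstar]
    · rw [if_neg hxy, smul_zero, hcongr _ 0 (by simp [he, hstar, hxy])]
      simp
  have hint : ∀ f, ρ f * Y₀ = Y₀ * π f := by
    intro f
    ext a y
    have h1 : π (f * e y x₀) = π (∑ x, π f x y • e x x₀) := by
      rw [map_mul, map_sum, he]
      ext i j
      simp [he, mul_apply, Matrix.sum_apply, single_apply, ite_and]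
    rw [hcol, mulVec_mulVec, ← map_mul, hcongr _ _ h1, map_sum, sum_mulVec, mul_apply,
      Finset.sum_apply]
    refine Finset.sum_congr rfl fun x _ => ?_
    rw [map_smul, smul_mulVec, Pi.smul_apply, smul_eq_mul, mul_comm]; rfl
  have hPY : P * Y₀ = Y₀ := by
    ext a x
    rw [hcol, mulVec_mulVec, hP, ← mulVec_mulVec, hPv]; rfl
  have hs : (√c : ℂ)⁻¹ * (√c : ℂ)⁻¹ * c = 1 := by
    have : (√c)⁻¹ * (√c)⁻¹ * c = 1 := by
      rw [← mul_inv, Real.mul_self_sqrt hc.le, inv_mul_cancel₀ hc.ne']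
    exact_mod_cast this
  refine ⟨(√c : ℂ)⁻¹ • Y₀, ?_, fun f => ?_, ?_⟩
  · rw [conjTranspose_smul, Matrix.smul_mul, Matrix.mul_smul, hYY, smul_smul, smul_smul]
    have : star ((√c : ℂ)⁻¹) = (√c : ℂ)⁻¹ := by simp
    rw [this, hs, one_smul]
  · rw [Matrix.mul_smul, hint, Matrix.smul_mul]
  · rw [Matrix.mul_smul, hPY]

end Irreducible

/-! ### Eigenvectors of the coordinate function -/

section Localization

variable {p q : ℕ} {n : Type*} [Fintype n] [DecidableEq n]

/-- The identity function of the interval, as a complex function. -/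
def idC : C(I, ℂ) := ⟨fun t => ((t : ℝ) : ℂ), by fun_prop⟩

@[simp] theorem idC_apply (t : I) : idC t = ((t : ℝ) : ℂ) := rfl

omit [DecidableEq n] in
theorem eq_zero_of_sub_smul_invertible {A : Type*} [Ring A] [StarRing A] [Algebra ℂ A]
    (ρ : A →⋆ₙₐ[ℂ] Matrix n n ℂ) {v : n → ℂ} {μ : ℂ} {c g : A} (hρ : ρ 1 *ᵥ v = v)
    (hμ : ρ c *ᵥ v = μ • v) (h1 : g * (c - μ • 1) = 1) : v = 0 := by
  have h2 := congrArg (fun f => ρ f *ᵥ v) h1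
  simp only [map_mul, map_sub, map_smul, ← mulVec_mulVec, sub_mulVec, smul_mulVec,
    hρ, hμ, sub_self, mulVec_zero] at h2
  exact h2.symm

omit [DecidableEq n] in
theorem mulVec_mul_sub_smul {A : Type*} [Ring A] [StarRing A] [Algebra ℂ A]
    (ρ : A →⋆ₙₐ[ℂ] Matrix n n ℂ) {v : n → ℂ} {μ : ℂ} {c : A} (hρ : ρ 1 *ᵥ v = v)
    (hμ : ρ c *ᵥ v = μ • v) (f g : A) : ρ (f * (g * (c - μ • 1))) *ᵥ v = 0 := by
  simp only [map_mul, map_sub, map_smul, ← mulVec_mulVec, sub_mulVec, smul_mulVec,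
    hρ, hμ, sub_self, mulVec_zero]

theorem mulVec_eq_zero_of_forall_approx {A : Type*} [CStarAlgebra A]
    (ρ : A →⋆ₙₐ[ℂ] Matrix n n ℂ) {v : n → ℂ} {f : A}
    (h : ∀ ε > 0, ∃ g, ρ g *ᵥ v = 0 ∧ ‖f - g‖ < ε) : ρ f *ᵥ v = 0 := by
  have hcont : Continuous ρ :=
    AddMonoidHomClass.continuous_of_bound ρ 1 fun a => by
      rw [one_mul]; exact NonUnitalStarAlgHom.norm_apply_le ρ a
  have hclosed : IsClosed {a : A | ρ a *ᵥ v = 0} :=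
    isClosed_eq (by fun_prop) continuous_const
  refine hclosed.closure_subset_iff.2 subset_rfl (Metric.mem_closure_iff.2 fun ε hε => ?_)
  obtain ⟨g, h1, h2⟩ := h ε hε
  exact ⟨g, h1, by rwa [dist_eq_norm]⟩

/-- The eigenvalues of the coordinate function lie in `[0,1]`, as `s ↦ s - μ` is invertible for all
other `μ`. -/
theorem eigenvalue_mem (ρ : Z p q →⋆ₙₐ[ℂ] Matrix n n ℂ) (hρ : ρ 1 = 1) {v : n → ℂ} (hv : v ≠ 0)
    {μ : ℂ} (hμ : ρ (scal idC) *ᵥ v = μ • v) : ∃ t : I, μ = (t : ℝ) := by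
  by_contra! h
  have hne : ∀ t : I, ((t : ℝ) : ℂ) - μ ≠ 0 := fun t => sub_ne_zero.2 (h t).symm
  set g : C(I, ℂ) := ⟨fun t => (((t : ℝ) : ℂ) - μ)⁻¹,
    Continuous.inv₀ (by fun_prop) hne⟩
  have h1 : (scal g : Z p q) * (scal idC - μ • 1) = 1 := by
    refine ext_Z fun t => ?_
    change (g t • (1 : MatPQ p q)) * (idC t • 1 - μ • 1) = 1
    rw [← sub_smul, smul_mul_smul_comm, one_mul]
    change ((((t : ℝ) : ℂ) - μ)⁻¹ * (((t : ℝ) : ℂ) - μ)) • _ = _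
    rw [inv_mul_cancel₀ (hne t), one_smul]
  exact hv (eq_zero_of_sub_smul_invertible ρ (by rw [hρ, one_mulVec]) hμ h1)

/-- An eigenvector of the image of the coordinate function for the eigenvalue `t` only sees the
fibre of `Z_{p,q}` at `t`: a function `f` vanishing at `t` is the limit of the functions
`(s - t)² ((s - t)² + δ)⁻¹ f(s)`. -/
theorem mulVec_eq_zero_of_apply_eq_zero (ρ : Z p q →⋆ₙₐ[ℂ] Matrix n n ℂ) {v : n → ℂ} {t : I}
    (ht : ρ (scal idC) *ᵥ v = ((t : ℝ) : ℂ) • v) (hρ : ρ 1 = 1) {f : Z p q} (hf : f.1 t = 0) :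
    ρ f *ᵥ v = 0 := by
  refine mulVec_eq_zero_of_forall_approx (A := Z p q) ρ fun ε hε => ?_
  obtain ⟨η, hη, hfη⟩ := Metric.continuousAt_iff.1 (f.1.continuous.continuousAt (x := t))
    (ε / 2) (half_pos hε)
  obtain ⟨δ, hδ, hδε⟩ : ∃ δ : ℝ, 0 < δ ∧ δ * ‖f‖ ≤ ε / 2 * η ^ 2 := by
    refine ⟨ε / 2 * η ^ 2 / (‖f‖ + 1), by positivity, ?_⟩
    rw [div_mul_eq_mul_div, div_le_iff₀ (by positivity)]
    have := norm_nonneg f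
    have h2 : 0 ≤ ε / 2 * η ^ 2 := by positivity
    nlinarith
  have hpos : ∀ s : I, 0 < ((s : ℝ) - t) ^ 2 + δ := fun s => by positivity
  set h : C(I, ℂ) := ⟨fun s => (((((s : ℝ) - t) / (((s : ℝ) - t) ^ 2 + δ) : ℝ)) : ℂ), by
    refine Complex.continuous_ofReal.comp ?_
    exact Continuous.div (by fun_prop) (by fun_prop) fun s => (hpos s).ne'⟩ with hh
  refine ⟨f * (scal h * (scal idC - ((t : ℝ) : ℂ) • 1)), ?_, ?_⟩
  · exact mulVec_mul_sub_smul ρ (by rw [hρ, one_mulVec]) ht f (scal h)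
  · change ‖(f.1 - _ : C(I, MatPQ p q))‖ < ε
    refine lt_of_le_of_lt ((ContinuousMap.norm_le _ (half_pos hε).le).2 fun s => ?_)
      (half_lt_self hε)
    have e1 : (f.1 - (f * (scal h * (scal idC - ((t : ℝ) : ℂ) • 1)) : Z p q).1) s
        = ((δ / (((s : ℝ) - t) ^ 2 + δ) : ℝ) : ℂ) • f.1 s := by
      change f.1 s - f.1 s * ((h s • (1 : MatPQ p q)) * (idC s • 1 - ((t : ℝ) : ℂ) • 1)) = _
      rw [← sub_smul, smul_mul_smul_comm, one_mul, mul_smul_comm, mul_one]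
      conv_lhs => enter [1]; rw [← one_smul ℂ (f.1 s)]
      rw [← sub_smul]
      congr 1
      change 1 - (((((s : ℝ) - t) / (((s : ℝ) - t) ^ 2 + δ) : ℝ)) : ℂ) * (((s : ℝ) : ℂ) - (t : ℝ)) = _
      rw [← Complex.ofReal_sub, ← Complex.ofReal_mul, ← Complex.ofReal_one, ← Complex.ofReal_sub]
      congr 1
      have := (hpos s).ne'
      field_simp
      ring
    change ‖(f.1 - (f * (scal h * (scal idC - ((t : ℝ) : ℂ) • 1)) : Z p q).1) s‖ ≤ ε / 2
    rw [e1, norm_smul, Complex.norm_real, Real.norm_of_nonneg (div_nonneg hδ.le (hpos s).le)]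
    by_cases hs : dist s t < η
    · have h3 := (hfη hs).le
      rw [hf, dist_zero_right] at h3
      refine le_trans (mul_le_of_le_one_left (norm_nonneg _) ?_) h3
      rw [div_le_one (hpos s)]
      linarith [sq_nonneg ((s : ℝ) - t)]
    · have h4 : ‖f.1 s‖ ≤ ‖f‖ := f.1.norm_coe_le_norm s
      have h5 : η ^ 2 ≤ ((s : ℝ) - t) ^ 2 := by
        rw [← sq_abs ((s : ℝ) - t)]
        gcongr
        exact not_lt.1 hs
      rw [div_mul_eq_mul_div, div_le_iff₀ (hpos s)]
      calc δ * ‖f.1 s‖ ≤ δ * ‖f‖ := by gcongr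
        _ ≤ ε / 2 * η ^ 2 := hδε
        _ ≤ ε / 2 * (((s : ℝ) - t) ^ 2 + δ) := by gcongr; linarith

theorem exists_eigenvector {P T : Matrix n n ℂ} (hPP : P * P = P) (hP0 : P ≠ 0)
    (hPT : P * T = T * P) : ∃ v : n → ℂ, v ≠ 0 ∧ P *ᵥ v = v ∧ ∃ μ : ℂ, T *ᵥ v = μ • v := by
  have hinv : ∀ v ∈ LinearMap.range P.mulVecLin, T.mulVecLin v ∈ LinearMap.range P.mulVecLin := by
    rintro _ ⟨w, rfl⟩
    refine ⟨T *ᵥ w, ?_⟩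
    simp [hPT]
  have hnt : Nontrivial (LinearMap.range P.mulVecLin) := by
    rw [Submodule.nontrivial_iff_ne_bot, Ne, LinearMap.range_eq_bot]
    intro h
    refine hP0 ?_
    rw [← Matrix.toLin'_apply', map_eq_zero_iff _ (LinearEquiv.injective _)] at h
    exact h
  obtain ⟨μ, hμ⟩ := Module.End.exists_eigenvalue (T.mulVecLin.restrict hinv)
  obtain ⟨⟨v, w, hw⟩, hv⟩ := hμ.exists_hasEigenvector
  refine ⟨v, fun h => hv.2 (Subtype.ext h), ?_, μ, congrArg Subtype.val hv.apply_eq_smul⟩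
  rw [← hw]
  simp [hPP]

/-- The range of a nonzero projection `P` commuting with the representation contains a copy of the
evaluation at a point of `[0,1]`, at `∞_0` or at `∞_1`. -/
theorem exists_irreducible (hp : 0 < p) (hq : 0 < q) (ρ : Z p q →⋆ₙₐ[ℂ] Matrix n n ℂ)
    (hρ : ρ 1 = 1) {P : Matrix n n ℂ} (hPP : P * P = P) (hP0 : P ≠ 0)
    (hP : ∀ f, P * ρ f = ρ f * P) :
    (∃ (t : I) (Y : Matrix n (Fin p × Fin q) ℂ), Yᴴ * Y = 1 ∧ (∀ f, ρ f * Y = Y * f.1 t) ∧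
      P * Y = Y) ∨
    (∃ Y : Matrix n (Fin p) ℂ, Yᴴ * Y = 1 ∧ (∀ f, ρ f * Y = Y * infZero f) ∧ P * Y = Y) ∨
    (∃ Y : Matrix n (Fin q) ℂ, Yᴴ * Y = 1 ∧ (∀ f, ρ f * Y = Y * infOne f) ∧ P * Y = Y) := by
  obtain ⟨v, hv, hPv, μ, hμ⟩ := exists_eigenvector hPP hP0 (hP (scal idC))
  obtain ⟨t, rfl⟩ := eigenvalue_mem ρ hρ hv hμ
  by_cases h0 : t = 0
  · refine .inr (.inl ?_)
    refine exists_isometry_of_ker_le ρ hρ hP hv hPv (infZeroHom hq) (infZeroHom_surjective hq)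
      (infZero_eq hq (by simp)) fun f hf => mulVec_eq_zero_of_apply_eq_zero ρ hμ hρ ?_
    rw [h0, infZero_spec, show infZero f = 0 from hf, zero_kronecker]
  by_cases h1 : t = 1
  · refine .inr (.inr ?_)
    refine exists_isometry_of_ker_le ρ hρ hP hv hPv (infOneHom hp) (infOneHom_surjective hp)
      (infOne_eq hp (by simp)) fun f hf => mulVec_eq_zero_of_apply_eq_zero ρ hμ hρ ?_
    rw [h1, infOne_spec, show infOne f = 0 from hf, kronecker_zero]
  · refine .inl ⟨t, ?_⟩
    exact exists_isometry_of_ker_le ρ hρ hP hv hPv (evalHom t) (evalHom_surjective h0 h1)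
      rfl fun f hf => mulVec_eq_zero_of_apply_eq_zero ρ hμ hρ hf

end Localization

/-! ### Isometric intertwiners from block diagonal representations -/

section Decomposition

variable {p q : ℕ} {n : Type*} [Fintype n] [DecidableEq n]

/-- The value at `f` of the block diagonal representation with eigenvalues `s i`, and with the
points at infinity repeated `α` and `β` times. -/
def diagRep {ι : Type*} [DecidableEq ι] (α β : Type*) [DecidableEq α] [DecidableEq β]
    (s : ι → I) (f : Z p q) : Matrix (Idx p q ι α β) (Idx p q ι α β) ℂ :=
  blk α β (fun i => f.1 (s i)) (infZero f) (infOne f)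

/-- The columns of `X` are an orthonormal system on which `ρ` acts as a block diagonal
representation. -/
structure IsPartialDiag (ρ : Z p q → Matrix n n ℂ) {ι α β : Type*} [Fintype ι] [DecidableEq ι]
    [Fintype α] [DecidableEq α] [Fintype β] [DecidableEq β] (s : ι → I)
    (X : Matrix n (Idx p q ι α β) ℂ) : Prop where
  isometry : Xᴴ * X = 1
  intertwines : ∀ f, ρ f * X = X * diagRep α β s f

variable {ι α β : Type*} [Fintype ι] [DecidableEq ι] [Fintype α] [DecidableEq α]
  [Fintype β] [DecidableEq β]

omit [DecidableEq n] in
theorem isPartialDiag_of_equiv {ρ : Z p q → Matrix n n ℂ} {J : Type*} [Fintype J] [DecidableEq J]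
    {s : ι → I} (E : J ≃ Idx p q ι α β) {X : Matrix n J ℂ} (hX : Xᴴ * X = 1)
    (hXf : ∀ f, ρ f * X = X * (diagRep α β s f).submatrix E E) :
    IsPartialDiag ρ s (X.submatrix id E.symm) where
  isometry := by
    rw [conjTranspose_submatrix, ← submatrix_mul _ _ _ _ _ Function.bijective_id, hX,
      submatrix_one_equiv]
  intertwines f := by
    have h1 : ρ f * X.submatrix id E.symm = (ρ f * X).submatrix id E.symm := by
      rw [← submatrix_id_id (ρ f), ← submatrix_mul _ _ _ _ _ Function.bijective_id, submatrix_id_id]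
    rw [h1, hXf, submatrix_mul _ _ id E.symm E.symm E.symm.bijective]
    simp [submatrix_submatrix]

omit [DecidableEq n] in
/-- Two isometric intertwiners with orthogonal ranges combine to one for the direct sum. -/
theorem fromCols_intertwines {A J k : Type*} [Fintype J] [DecidableEq J] [Fintype k]
    [DecidableEq k] {ρ : A → Matrix n n ℂ} {X : Matrix n J ℂ} {Δ : A → Matrix J J ℂ}
    {Y : Matrix n k ℂ} {π : A → Matrix k k ℂ} (hX : Xᴴ * X = 1) (hXf : ∀ f, ρ f * X = X * Δ f)
    (hY : Yᴴ * Y = 1) (hYf : ∀ f, ρ f * Y = Y * π f) (hXY : Xᴴ * Y = 0) :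
    (fromCols X Y)ᴴ * fromCols X Y = 1 ∧ ∀ f, ρ f * fromCols X Y =
      fromCols X Y * fromBlocks (Δ f) 0 0 (π f) := by
  have hYX : Yᴴ * X = 0 := by
    rw [← conjTranspose_conjTranspose (Yᴴ * X), conjTranspose_mul, conjTranspose_conjTranspose,
      hXY, conjTranspose_zero]
  refine ⟨?_, fun f => ?_⟩
  · rw [conjTranspose_fromCols_eq_fromRows_conjTranspose, fromRows_mul_fromCols, hX, hY,
      hXY, hYX, fromBlocks_one]
  · rw [mul_fromCols, fromCols_mul_fromBlocks, hXf, hYf]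
    simp

omit [Fintype ι] [Fintype α] [Fintype β] in
theorem diagRep_conjTranspose (hp : 0 < p) (hq : 0 < q) (s : ι → I) (f : Z p q) :
    (diagRep α β s f)ᴴ = diagRep α β s (star f) := by
  rw [diagRep, blk_conjTranspose]
  have h1 : infZero (star f) = (infZero f)ᴴ := map_star (infZeroHom hq) f
  have h2 : infOne (star f) = (infOne f)ᴴ := map_star (infOneHom hp) f
  rw [diagRep, h1, h2]; rfl

omit [DecidableEq n] in
/-- The range projection of an isometric intertwiner commutes with the representation. -/
theorem IsPartialDiag.commute (hp : 0 < p) (hq : 0 < q) {ρ : Z p q →⋆ₙₐ[ℂ] Matrix n n ℂ}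
    {s : ι → I} {X : Matrix n (Idx p q ι α β) ℂ} (hX : IsPartialDiag ρ s X) (f : Z p q) :
    X * Xᴴ * ρ f = ρ f * (X * Xᴴ) := by
  have h1 := congrArg conjTranspose (hX.intertwines (star f))
  have h2 : ρ (star f) = (ρ f)ᴴ := map_star ρ f
  rw [conjTranspose_mul, conjTranspose_mul, h2, conjTranspose_conjTranspose,
    diagRep_conjTranspose hp hq, star_star] at h1
  rw [Matrix.mul_assoc, h1, ← Matrix.mul_assoc, ← Matrix.mul_assoc, hX.intertwines]

/-- Splitting off one block at a point of the interval. -/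
def idxAddPoint (p q : ℕ) (ι α β : Type*) :
    Idx p q ι α β ⊕ (Fin p × Fin q) ≃ Idx p q (ι ⊕ Unit) α β where
  toFun := Sum.elim (Sum.elim (fun x => .inl (x.1, .inl x.2)) .inr) (fun x => .inl (x, .inr ()))
  invFun := Sum.elim (fun x => Sum.elim (fun i => .inl (.inl (x.1, i))) (fun _ => .inr x.1) x.2)
    (fun y => .inl (.inr y))
  left_inv := by rintro ((⟨x, i⟩ | y) | x) <;> rfl
  right_inv := by rintro (⟨x, i | i⟩ | y) <;> rfl

/-- Splitting off one block at `∞_0`. -/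
def idxAddZero (p q : ℕ) (ι α β : Type*) :
    Idx p q ι α β ⊕ Fin p ≃ Idx p q ι (α ⊕ Unit) β where
  toFun := Sum.elim (Sum.elim .inl (Sum.elim (fun x => .inr (.inl (x.1, .inl x.2)))
    (fun y => .inr (.inr y)))) (fun x => .inr (.inl (x, .inr ())))
  invFun := Sum.elim (fun x => .inl (.inl x)) (Sum.elim
    (fun x => Sum.elim (fun i => .inl (.inr (.inl (x.1, i)))) (fun _ => .inr x.1) x.2)
    (fun y => .inl (.inr (.inr y))))
  left_inv := by rintro ((⟨x, i⟩ | y | y) | x) <;> rfl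
  right_inv := by rintro (x | ⟨x, i | i⟩ | y) <;> rfl

/-- Splitting off one block at `∞_1`. -/
def idxAddOne (p q : ℕ) (ι α β : Type*) :
    Idx p q ι α β ⊕ Fin q ≃ Idx p q ι α (β ⊕ Unit) where
  toFun := Sum.elim (Sum.elim .inl (Sum.elim (fun x => .inr (.inl x))
    (fun y => .inr (.inr (y.1, .inl y.2))))) (fun x => .inr (.inr (x, .inr ())))
  invFun := Sum.elim (fun x => .inl (.inl x)) (Sum.elim (fun y => .inl (.inr (.inl y)))
    (fun x => Sum.elim (fun i => .inl (.inr (.inr (x.1, i)))) (fun _ => .inr x.1) x.2))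
  left_inv := by rintro ((⟨x, i⟩ | y | y) | x) <;> rfl
  right_inv := by rintro (x | y | ⟨x, i | i⟩) <;> rfl

/-- Reindexing the three kinds of blocks. -/
def idxCongr (p q : ℕ) {ι ι' α α' β β' : Type*} (e₁ : ι ≃ ι') (e₂ : α ≃ α') (e₃ : β ≃ β') :
    Idx p q ι α β ≃ Idx p q ι' α' β' :=
  Equiv.sumCongr (Equiv.prodCongr (.refl _) e₁)
    (Equiv.sumCongr (Equiv.prodCongr (.refl _) e₂) (Equiv.prodCongr (.refl _) e₃))

omit [Fintype ι] [Fintype α] [Fintype β] in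
theorem blk_idxCongr {ι' α' β' : Type*} [DecidableEq ι']
    [DecidableEq α'] [DecidableEq β'] (e₁ : ι ≃ ι') (e₂ : α ≃ α')
    (e₃ : β ≃ β') (F : ι' → MatPQ p q) (x : Matrix (Fin p) (Fin p) ℂ)
    (y : Matrix (Fin q) (Fin q) ℂ) :
    (blk α' β' F x y).submatrix (idxCongr p q e₁ e₂ e₃) (idxCongr p q e₁ e₂ e₃) =
      blk α β (fun i => F (e₁ i)) x y := by
  ext i j
  rcases i with ⟨i, a⟩ | ⟨i, a⟩ | ⟨i, a⟩ <;> rcases j with ⟨j, b⟩ | ⟨j, b⟩ | ⟨j, b⟩ <;>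
    simp [blk, idxCongr, blockDiagonal_apply]

omit [DecidableEq n] in
theorem IsPartialDiag.congr {ρ : Z p q → Matrix n n ℂ} {ι' α' β' : Type*} [Fintype ι']
    [DecidableEq ι'] [Fintype α'] [DecidableEq α'] [Fintype β'] [DecidableEq β'] {s : ι' → I}
    (e₁ : ι ≃ ι') (e₂ : α ≃ α') (e₃ : β ≃ β') {X : Matrix n (Idx p q ι α β) ℂ}
    (hX : IsPartialDiag ρ (fun i => s (e₁ i)) X) :
    IsPartialDiag ρ s (X.submatrix id (idxCongr p q e₁ e₂ e₃).symm) := by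
  refine isPartialDiag_of_equiv _ hX.isometry fun f => ?_
  rw [hX.intertwines, diagRep, diagRep, blk_idxCongr]

omit [Fintype ι] [Fintype α] [Fintype β] in
theorem blk_addPoint (F : ι ⊕ Unit → MatPQ p q) (x : Matrix (Fin p) (Fin p) ℂ)
    (y : Matrix (Fin q) (Fin q) ℂ) :
    (blk α β F x y).submatrix (idxAddPoint p q ι α β) (idxAddPoint p q ι α β) =
      fromBlocks (blk α β (fun i => F (.inl i)) x y) 0 0 (F (.inr ())) := by
  ext i j
  rcases i with (⟨i, a⟩ | ⟨i, a⟩ | ⟨i, a⟩) | i <;> rcases j with (⟨j, b⟩ | ⟨j, b⟩ | ⟨j, b⟩) | j <;>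
    simp [blk, idxAddPoint, blockDiagonal_apply]

omit [Fintype ι] [Fintype α] [Fintype β] in
theorem blk_addZero (F : ι → MatPQ p q) (x : Matrix (Fin p) (Fin p) ℂ)
    (y : Matrix (Fin q) (Fin q) ℂ) :
    (blk (α ⊕ Unit) β F x y).submatrix (idxAddZero p q ι α β) (idxAddZero p q ι α β) =
      fromBlocks (blk α β F x y) 0 0 x := by
  ext i j
  rcases i with (⟨i, a⟩ | ⟨i, a⟩ | ⟨i, a⟩) | i <;> rcases j with (⟨j, b⟩ | ⟨j, b⟩ | ⟨j, b⟩) | j <;>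
    simp [blk, idxAddZero, blockDiagonal_apply]

omit [Fintype ι] [Fintype α] [Fintype β] in
theorem blk_addOne (F : ι → MatPQ p q) (x : Matrix (Fin p) (Fin p) ℂ)
    (y : Matrix (Fin q) (Fin q) ℂ) :
    (blk α (β ⊕ Unit) F x y).submatrix (idxAddOne p q ι α β) (idxAddOne p q ι α β) =
      fromBlocks (blk α β F x y) 0 0 y := by
  ext i j
  rcases i with (⟨i, a⟩ | ⟨i, a⟩ | ⟨i, a⟩) | i <;> rcases j with (⟨j, b⟩ | ⟨j, b⟩ | ⟨j, b⟩) | j <;>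
    simp [blk, idxAddOne, blockDiagonal_apply]

end Decomposition

/-! ### Diagonalization of finite-dimensional representations -/

section Existence

variable {p q : ℕ} {n : Type*} [Fintype n]

/-- The columns of `X` are an orthonormal basis on which `ρ` acts as a block diagonal
representation. -/
structure IsDiag (ρ : Z p q → Matrix n n ℂ) {ι α β : Type*} [Fintype ι] [DecidableEq ι]
    [Fintype α] [DecidableEq α] [Fintype β] [DecidableEq β] [DecidableEq n] (s : ι → I)
    (X : Matrix n (Idx p q ι α β) ℂ) : Prop extends IsPartialDiag ρ s X where
  coisometry : X * Xᴴ = 1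

theorem card_le_of_isometry {J : Type*} [Fintype J] [DecidableEq J] {X : Matrix n J ℂ}
    (hX : Xᴴ * X = 1) : Fintype.card J ≤ Fintype.card n := by
  calc Fintype.card J = (Xᴴ * X).rank := by rw [hX, rank_one]
    _ ≤ X.rank := rank_mul_le_right _ _
    _ ≤ Fintype.card n := rank_le_card_height X

variable [DecidableEq n]

omit [DecidableEq n] in
theorem IsPartialDiag.exists_fin {ρ : Z p q → Matrix n n ℂ} {ι α β : Type*} [Fintype ι]
    [DecidableEq ι] [Fintype α] [DecidableEq α] [Fintype β] [DecidableEq β] {s : ι → I}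
    {X : Matrix n (Idx p q ι α β) ℂ} (hX : IsPartialDiag ρ s X) :
    ∃ (l a b : ℕ) (s' : Fin l → I) (X' : Matrix n (Idx p q (Fin l) (Fin a) (Fin b)) ℂ),
      IsPartialDiag ρ s' X' ∧ Fintype.card (Idx p q ι α β) =
        Fintype.card (Idx p q (Fin l) (Fin a) (Fin b)) := by
  refine ⟨_, _, _, fun i => s ((Fintype.equivFin ι).symm i), _,
    IsPartialDiag.congr (Fintype.equivFin ι) (Fintype.equivFin α) (Fintype.equivFin β)
      (by simpa using hX), ?_⟩
  simp

/-- An isometric intertwiner that is not onto extends by a further irreducible block. -/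
theorem IsPartialDiag.exists_extension (hp : 0 < p) (hq : 0 < q)
    {ρ : Z p q →⋆ₙₐ[ℂ] Matrix n n ℂ} (hρ : ρ 1 = 1) {l a b : ℕ} {s : Fin l → I}
    {X : Matrix n (Idx p q (Fin l) (Fin a) (Fin b)) ℂ} (hX : IsPartialDiag ρ s X)
    (hne : X * Xᴴ ≠ 1) :
    ∃ (l' a' b' : ℕ) (s' : Fin l' → I) (X' : Matrix n (Idx p q (Fin l') (Fin a') (Fin b')) ℂ),
      IsPartialDiag ρ s' X' ∧ Fintype.card (Idx p q (Fin l) (Fin a) (Fin b)) <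
        Fintype.card (Idx p q (Fin l') (Fin a') (Fin b')) := by
  have hPP : (1 - X * Xᴴ) * (1 - X * Xᴴ) = 1 - X * Xᴴ := by
    have : X * Xᴴ * (X * Xᴴ) = X * Xᴴ := by
      calc X * Xᴴ * (X * Xᴴ) = X * (Xᴴ * X) * Xᴴ := by simp only [Matrix.mul_assoc]
        _ = X * Xᴴ := by rw [hX.isometry, Matrix.mul_one]
    rw [mul_sub, sub_mul, sub_mul, this]; simp
  have hP : ∀ f, (1 - X * Xᴴ) * ρ f = ρ f * (1 - X * Xᴴ) := fun f => by
    rw [sub_mul, mul_sub, hX.commute hp hq, one_mul, mul_one]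
  have horth : ∀ {k : Type} [Fintype k] (Y : Matrix n k ℂ), (1 - X * Xᴴ) * Y = Y → Xᴴ * Y = 0 := by
    intro k _ Y hY
    have h1 : Xᴴ * (1 - X * Xᴴ) = 0 := by
      rw [Matrix.mul_sub, Matrix.mul_one, ← Matrix.mul_assoc, hX.isometry, Matrix.one_mul, sub_self]
    rw [← hY, ← Matrix.mul_assoc, h1, Matrix.zero_mul]
  rcases exists_irreducible hp hq ρ hρ hPP (sub_ne_zero.2 hne.symm) hP with
    ⟨t, Y, hY, hYf, hPY⟩ | ⟨Y, hY, hYf, hPY⟩ | ⟨Y, hY, hYf, hPY⟩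
  · obtain ⟨h1, h2⟩ := fromCols_intertwines hX.isometry hX.intertwines hY hYf (horth Y hPY)
    obtain ⟨l', a', b', s', X', h3, h4⟩ := (isPartialDiag_of_equiv (ρ := ρ)
      (s := Sum.elim s fun _ => t) (idxAddPoint p q (Fin l) (Fin a) (Fin b)) h1 fun f => by
        rw [h2, diagRep, diagRep, blk_addPoint]; rfl).exists_fin
    refine ⟨l', a', b', s', X', h3, ?_⟩
    rw [← h4, ← Fintype.card_congr (idxAddPoint p q (Fin l) (Fin a) (Fin b)), Fintype.card_sum]
    simp [hp, hq]
  · obtain ⟨h1, h2⟩ := fromCols_intertwines hX.isometry hX.intertwines hY hYf (horth Y hPY)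
    obtain ⟨l', a', b', s', X', h3, h4⟩ := (isPartialDiag_of_equiv (ρ := ρ)
      (s := s) (idxAddZero p q (Fin l) (Fin a) (Fin b)) h1 fun f => by
        rw [h2, diagRep, diagRep, blk_addZero]).exists_fin
    refine ⟨l', a', b', s', X', h3, ?_⟩
    rw [← h4, ← Fintype.card_congr (idxAddZero p q (Fin l) (Fin a) (Fin b)), Fintype.card_sum]
    simp [hp]
  · obtain ⟨h1, h2⟩ := fromCols_intertwines hX.isometry hX.intertwines hY hYf (horth Y hPY)
    obtain ⟨l', a', b', s', X', h3, h4⟩ := (isPartialDiag_of_equiv (ρ := ρ)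
      (s := s) (idxAddOne p q (Fin l) (Fin a) (Fin b)) h1 fun f => by
        rw [h2, diagRep, diagRep, blk_addOne]).exists_fin
    refine ⟨l', a', b', s', X', h3, ?_⟩
    rw [← h4, ← Fintype.card_congr (idxAddOne p q (Fin l) (Fin a) (Fin b)), Fintype.card_sum]
    simp [hq]

/-- Every unital finite-dimensional representation of `Z_{p,q}` is block diagonal in a suitable
orthonormal basis. -/
theorem exists_isDiag (hp : 0 < p) (hq : 0 < q) (ρ : Z p q →⋆ₙₐ[ℂ] Matrix n n ℂ) (hρ : ρ 1 = 1) :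
    ∃ (l a b : ℕ) (s : Fin l → I) (X : Matrix n (Idx p q (Fin l) (Fin a) (Fin b)) ℂ),
      IsDiag ρ s X := by
  have key : ∀ (d l a b : ℕ) (s : Fin l → I) (X : Matrix n (Idx p q (Fin l) (Fin a) (Fin b)) ℂ),
      IsPartialDiag ρ s X →
      Fintype.card n - Fintype.card (Idx p q (Fin l) (Fin a) (Fin b)) ≤ d →
      ∃ (l a b : ℕ) (s : Fin l → I) (X : Matrix n (Idx p q (Fin l) (Fin a) (Fin b)) ℂ),
      IsDiag ρ s X := by
    intro d
    induction d with
    | zero =>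
      intro l a b s X hX hd
      by_cases hne : X * Xᴴ = 1
      · exact ⟨l, a, b, s, X, hX, hne⟩
      · obtain ⟨l', a', b', s', X', hX', h2⟩ := hX.exists_extension hp hq hρ hne
        have h3 := card_le_of_isometry hX'.isometry
        omega
    | succ d ih =>
      intro l a b s X hX hd
      by_cases hne : X * Xᴴ = 1
      · exact ⟨l, a, b, s, X, hX, hne⟩
      · obtain ⟨l', a', b', s', X', hX', h2⟩ := hX.exists_extension hp hq hρ hne
        exact ih l' a' b' s' X' hX' (by omega)
  refine key _ 0 0 0 Fin.elim0 0 ⟨?_, fun f => ?_⟩ le_rfl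
  · ext i j
    rcases i with ⟨-, i⟩ | ⟨-, i⟩ | ⟨-, i⟩ <;> exact i.elim0
  · ext i j
    rcases j with ⟨-, i⟩ | ⟨-, i⟩ | ⟨-, i⟩ <;> exact i.elim0

theorem isDiag_of_equiv {ρ : Z p q → Matrix n n ℂ} {J ι α β : Type*} [Fintype J] [DecidableEq J]
    [Fintype ι] [DecidableEq ι] [Fintype α] [DecidableEq α] [Fintype β] [DecidableEq β]
    {s : ι → I} (E : J ≃ Idx p q ι α β) {X : Matrix n J ℂ} (hX : Xᴴ * X = 1) (hX' : X * Xᴴ = 1)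
    (hXf : ∀ f, ρ f * X = X * (diagRep α β s f).submatrix E E) :
    IsDiag ρ s (X.submatrix id E.symm) where
  toIsPartialDiag := isPartialDiag_of_equiv E hX hXf
  coisometry := by
    rw [conjTranspose_submatrix, submatrix_mul_equiv, hX', submatrix_id_id]

end Existence

/-! ### Absorbing residual multiplicities -/

section Padding

variable {p q : ℕ} {ι α β κ κ' : Type*} [DecidableEq ι]
  [DecidableEq α] [DecidableEq β] [DecidableEq κ] [DecidableEq κ']

/-- `q` copies of the point `∞_0` make up one copy of the point `0`, and `p` copies of `∞_1` make
up one copy of the point `1`. -/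
def idxAbsorb (p q : ℕ) (ι α β κ κ' : Type*) :
    Idx p q ι ((κ × Fin q) ⊕ α) ((κ' × Fin p) ⊕ β) ≃ Idx p q (κ ⊕ ι ⊕ κ') α β where
  toFun := Sum.elim (fun z => .inl (z.1, .inr (.inl z.2))) (Sum.elim
    (fun z => Sum.elim (fun c => .inl ((z.1, c.2), .inl c.1)) (fun a => .inr (.inl (z.1, a))) z.2)
    (fun z => Sum.elim (fun c => .inl ((c.2, z.1), .inr (.inr c.1)))
      (fun b => .inr (.inr (z.1, b))) z.2))
  invFun := Sum.elim (fun z => Sum.elim (fun c => .inr (.inl (z.1.1, .inl (c, z.1.2))))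
    (Sum.elim (fun i => .inl (z.1, i)) (fun c => .inr (.inr (z.1.2, .inl (c, z.1.1))))) z.2)
    (Sum.elim (fun z => .inr (.inl (z.1, .inr z.2))) (fun z => .inr (.inr (z.1, .inr z.2))))
  left_inv := by rintro (⟨z, i⟩ | ⟨x, ⟨c, y⟩ | a⟩ | ⟨y, ⟨c, x⟩ | b⟩) <;> rfl
  right_inv := by rintro (⟨⟨x, y⟩, c | i | c⟩ | ⟨x, a⟩ | ⟨y, b⟩) <;> rfl

theorem blk_absorb (F : ι → MatPQ p q) (x : Matrix (Fin p) (Fin p) ℂ)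
    (y : Matrix (Fin q) (Fin q) ℂ) :
    (blk α β (Sum.elim (fun _ : κ => x ⊗ₖ (1 : Matrix (Fin q) (Fin q) ℂ))
      (Sum.elim F fun _ : κ' => (1 : Matrix (Fin p) (Fin p) ℂ) ⊗ₖ y)) x y).submatrix
        (idxAbsorb p q ι α β κ κ') (idxAbsorb p q ι α β κ κ') =
      blk ((κ × Fin q) ⊕ α) ((κ' × Fin p) ⊕ β) F x y := by
  ext i j
  rcases i with ⟨i, i'⟩ | ⟨i, ⟨i', i''⟩ | i'⟩ | ⟨i, ⟨i', i''⟩ | i'⟩ <;>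
  rcases j with ⟨j, j'⟩ | ⟨j, ⟨j', j''⟩ | j'⟩ | ⟨j, ⟨j', j''⟩ | j'⟩ <;>
    simp [blk, idxAbsorb, blockDiagonal_apply, kroneckerMap_apply, one_apply, ite_and]

/-- The tuple `s` preceded by `k` copies of `z` and followed by `k'` copies of `o`. -/
def pad {T : Type*} (k k' : ℕ) (z o : T) {l : ℕ} (s : Fin l → T) : Fin (k + (l + k')) → T :=
  Fin.append (fun _ => z) (Fin.append s fun _ => o)

theorem pad_comp {T S : Type*} (g : T → S) (k k' : ℕ) (z o : T) {l : ℕ} (s : Fin l → T)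
    (i : Fin (k + (l + k'))) :
    g (pad k k' z o s i) = pad k k' (g z) (g o) (fun j => g (s j)) i := by
  unfold pad
  refine Fin.addCases (fun i => ?_) (fun i => Fin.addCases (fun i => ?_) (fun i => ?_) i) i <;> simp

theorem monotone_append {T : Type*} [Preorder T] {m n : ℕ} {u : Fin m → T} {v : Fin n → T}
    (hu : Monotone u) (hv : Monotone v) (huv : ∀ i j, u i ≤ v j) : Monotone (Fin.append u v) := by
  intro i j hij
  induction i using Fin.addCases with
  | left i =>
    induction j using Fin.addCases with
    | left j => simpa using hu (show i ≤ j from hij)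
    | right j => simpa using huv i j
  | right i =>
    induction j using Fin.addCases with
    | left j =>
      have h1 := Fin.le_def.1 hij
      simp at h1
      omega
    | right j => simpa using hv (by rw [Fin.le_def] at hij ⊢; simpa using hij)

theorem monotone_pad (k k' : ℕ) {l : ℕ} {s : Fin l → I} (hs : Monotone s) :
    Monotone (pad k k' 0 1 s) := by
  refine monotone_append monotone_const (monotone_append hs monotone_const fun i j => ?_)
    fun i j => ?_
  · exact unitInterval.le_one'
  · exact unitInterval.nonneg'

/-- A decomposition of `Fin a` into `a / q` groups of size `q` and a remainder. -/
def divModEquiv (a q : ℕ) : Fin a ≃ (Fin (a / q) × Fin q) ⊕ Fin (a % q) :=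
  ((finCongr (by rw [mul_comm]; exact (Nat.div_add_mod a q).symm)).trans
    finSumFinEquiv.symm).trans (Equiv.sumCongr finProdFinEquiv.symm (.refl _))

/-- The rearrangement of the basis that turns as many of the residual copies of the points at
infinity as possible into copies of the points `0` and `1`. -/
def idxPad (p q l a b : ℕ) : Idx p q (Fin l) (Fin a) (Fin b) ≃
    Idx p q (Fin (a / q + (l + b / p))) (Fin (a % q)) (Fin (b % p)) :=
  ((idxCongr p q (.refl _) (divModEquiv a q) (divModEquiv b p)).trans (idxAbsorb p q _ _ _ _ _)).trans
    (idxCongr p q ((Equiv.sumCongr (.refl _) finSumFinEquiv).trans finSumFinEquiv) (.refl _)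
      (.refl _))

theorem blk_pad {l a b : ℕ} (F : Fin l → MatPQ p q) (x : Matrix (Fin p) (Fin p) ℂ)
    (y : Matrix (Fin q) (Fin q) ℂ) :
    (blk (Fin (a % q)) (Fin (b % p)) (pad (a / q) (b / p)
      (x ⊗ₖ (1 : Matrix (Fin q) (Fin q) ℂ)) ((1 : Matrix (Fin p) (Fin p) ℂ) ⊗ₖ y) F) x y).submatrix
        (idxPad p q l a b) (idxPad p q l a b) = blk (Fin a) (Fin b) F x y := by
  have h1 := blk_idxCongr (.refl (Fin l)) (divModEquiv a q) (divModEquiv b p) F x y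
  rw [← blk_absorb] at h1
  have h2 := blk_idxCongr (((Equiv.refl _).sumCongr finSumFinEquiv).trans finSumFinEquiv)
    (.refl (Fin (a % q))) (.refl (Fin (b % p))) (pad (a / q) (b / p)
      (x ⊗ₖ (1 : Matrix (Fin q) (Fin q) ℂ)) ((1 : Matrix (Fin p) (Fin p) ℂ) ⊗ₖ y) F) x y
  have h3 : (fun i => pad (a / q) (b / p) (x ⊗ₖ (1 : Matrix (Fin q) (Fin q) ℂ))
      ((1 : Matrix (Fin p) (Fin p) ℂ) ⊗ₖ y) F
      ((((Equiv.refl _).sumCongr finSumFinEquiv).trans finSumFinEquiv) i)) =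
      Sum.elim (fun _ => x ⊗ₖ (1 : Matrix (Fin q) (Fin q) ℂ))
      (Sum.elim F fun _ => (1 : Matrix (Fin p) (Fin p) ℂ) ⊗ₖ y) := by
    funext i
    rcases i with i | i | i <;> simp [pad]
  rw [h3] at h2
  rw [← h2] at h1
  exact h1

theorem diagRep_pad {l a b : ℕ} (s : Fin l → I) (f : Z p q) :
    (diagRep (Fin (a % q)) (Fin (b % p)) (pad (a / q) (b / p) 0 1 s) f).submatrix
        (idxPad p q l a b) (idxPad p q l a b) = diagRep (Fin a) (Fin b) s f := by
  have h1 : (fun i => f.1 (pad (a / q) (b / p) 0 1 s i)) = pad (a / q) (b / p)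
      (infZero f ⊗ₖ (1 : Matrix (Fin q) (Fin q) ℂ)) ((1 : Matrix (Fin p) (Fin p) ℂ) ⊗ₖ infOne f)
      (fun i => f.1 (s i)) := by
    funext i
    rw [pad_comp (fun t => f.1 t), infZero_spec, infOne_spec]
  rw [diagRep, h1, blk_pad, diagRep]

end Padding

/-! ### Sorted tuples and their sums under continuous functions -/

section Sorting

theorem card_ge_eq {l : ℕ} (i : Fin l) : (Finset.Ici i).card = l - i := by simp

/-- A piecewise linear function rising from `0` at `c` to `1` at `d`. -/
def ramp (c d t : ℝ) : ℝ := max 0 (min 1 ((t - c) / (d - c)))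

theorem continuous_ramp (c d : ℝ) : Continuous (ramp c d) := by
  unfold ramp; fun_prop

theorem ramp_nonneg (c d t : ℝ) : 0 ≤ ramp c d t := le_max_left _ _

theorem ramp_le_one (c d t : ℝ) : ramp c d t ≤ 1 := max_le zero_le_one (min_le_left _ _)

theorem ramp_eq_one {c d t : ℝ} (hcd : c < d) (h : d ≤ t) : ramp c d t = 1 := by
  have : 1 ≤ (t - c) / (d - c) := by rw [le_div_iff₀ (by linarith)]; linarith
  rw [ramp, min_eq_left this, max_eq_right zero_le_one]

theorem ramp_eq_zero {c d t : ℝ} (hcd : c < d) (h : t ≤ c) : ramp c d t = 0 := by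
  have : (t - c) / (d - c) ≤ 0 := div_nonpos_of_nonpos_of_nonneg (by linarith) (by linarith)
  rw [ramp, max_eq_left ((min_le_right _ _).trans this)]

/-- Sums of a ramp function detect the order of the entries of sorted tuples. -/
theorem lt_of_sum_ramp_lt {l : ℕ} {x y : Fin l → ℝ} (hx : Monotone x) (hy : Monotone y)
    {c d : ℝ} (hcd : c < d) {i : Fin l} (hi : d ≤ x i)
    (h : ∑ j, ramp c d (x j) < ∑ j, ramp c d (y j) + 1) : c < y i := by
  by_contra! hle
  have h1 : ((l - i : ℕ) : ℝ) ≤ ∑ j, ramp c d (x j) := by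
    rw [← card_ge_eq i]
    calc ((Finset.Ici i).card : ℝ) = ∑ j ∈ Finset.Ici i, ramp c d (x j) := by
          rw [Finset.sum_congr rfl fun j hj =>
            ramp_eq_one hcd (hi.trans (hx (Finset.mem_Ici.1 hj)))]
          simp
      _ ≤ _ := Finset.sum_le_univ_sum_of_nonneg fun j => ramp_nonneg _ _ _
  have h2 : ∑ j, ramp c d (y j) ≤ ((l - i - 1 : ℕ) : ℝ) := by
    have h3 : (Finset.Ioi i).card = l - i - 1 := by simp; omega
    rw [← h3]
    calc ∑ j, ramp c d (y j) = ∑ j ∈ Finset.Ioi i, ramp c d (y j) := by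
          refine (Finset.sum_subset (Finset.subset_univ _) fun j _ hj => ?_).symm
          rw [Finset.mem_Ioi, not_lt] at hj
          exact ramp_eq_zero hcd ((hy hj).trans hle)
      _ ≤ ∑ j ∈ Finset.Ioi i, 1 := Finset.sum_le_sum fun j _ => ramp_le_one _ _ _
      _ = _ := by simp
  have h4 : l - i = (l - i - 1) + 1 := by have := i.2; omega
  rw [h4] at h1
  push_cast at h1
  linarith

/-- The ramp function as a complex function on the interval. -/
def rampC (c d : ℝ) : C(I, ℂ) := ⟨fun t => (ramp c d t : ℂ), by
  have := continuous_ramp c d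
  fun_prop⟩

theorem sum_rampC {l : ℕ} (c d : ℝ) (x : Fin l → I) :
    ∑ j, rampC c d (x j) = ((∑ j, ramp c d (x j) : ℝ) : ℂ) := by
  simp [rampC]

/-- A sorted tuple is determined by its sums under continuous functions. -/
theorem eq_of_sum_eq {l : ℕ} {x y : Fin l → I} (hx : Monotone x) (hy : Monotone y)
    (h : ∀ g : C(I, ℂ), ∑ j, g (x j) = ∑ j, g (y j)) : x = y := by
  have key : ∀ {x y : Fin l → I}, Monotone x → Monotone y →
      (∀ g : C(I, ℂ), ∑ j, g (x j) = ∑ j, g (y j)) → ∀ i, (x i : ℝ) ≤ y i := by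
    intro x y hx hy h i
    refine le_of_forall_lt fun c hc => ?_
    refine lt_of_sum_ramp_lt (x := fun j => (x j : ℝ)) (y := fun j => (y j : ℝ))
      (fun _ _ hij => hx hij) (fun _ _ hij => hy hij) hc le_rfl ?_
    have h1 := h (rampC c (x i))
    rw [sum_rampC, sum_rampC, Complex.ofReal_inj] at h1
    rw [h1]; linarith
  funext i
  exact le_antisymm (key hx hy h i) (key hy hx (fun g => (h g).symm) i)

/-- The entries of sorted tuples vary continuously if all their sums under continuous functions do. -/
theorem continuous_of_continuous_sum {T : Type*} [TopologicalSpace T] {l : ℕ} {x : T → Fin l → I}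
    (hx : ∀ t, Monotone (x t)) (h : ∀ g : C(I, ℂ), Continuous fun t => ∑ j, g (x t j))
    (i : Fin l) : Continuous fun t => x t i := by
  refine continuous_induced_rng.2 (continuous_iff_continuousAt.2 fun t₀ => ?_)
  have hmono : ∀ t, Monotone fun j => (x t j : ℝ) := fun t _ _ hij => hx t hij
  have hnear : ∀ c d : ℝ, ∀ᶠ t in 𝓝 t₀,
      |∑ j, ramp c d (x t j) - ∑ j, ramp c d (x t₀ j)| < 1 := by
    intro c d
    have h1 : Continuous fun t => ∑ j, ramp c d (x t j) := by
      have h2 := Complex.continuous_re.comp (h (rampC c d))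
      refine h2.congr fun t => ?_
      rw [Function.comp_apply, sum_rampC, Complex.ofReal_re]
    exact (Metric.continuous_iff'.1 h1 t₀ 1 one_pos)
  rw [ContinuousAt, tendsto_order]
  simp only [Function.comp_apply]
  constructor
  · intro c hc
    filter_upwards [hnear c (x t₀ i)] with t ht
    rw [abs_lt] at ht
    exact lt_of_sum_ramp_lt (hmono t₀) (hmono t) hc le_rfl (by linarith [ht.1])
  · intro d hd
    filter_upwards [hnear (x t₀ i) d] with t ht
    rw [abs_lt] at ht
    by_contra! hle
    exact lt_irrefl _ (lt_of_sum_ramp_lt (hmono t) (hmono t₀) hd hle (by linarith [ht.2]))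

end Sorting

/-! ### Uniqueness of reduced diagonal forms -/

section Reduced

variable {p q : ℕ} {n : Type*} [Fintype n] [DecidableEq n] {ι α β : Type*} [Fintype ι]
  [DecidableEq ι] [Fintype α] [DecidableEq α] [Fintype β] [DecidableEq β]

theorem IsDiag.eq_conj {ρ : Z p q → Matrix n n ℂ} {s : ι → I} {X : Matrix n (Idx p q ι α β) ℂ}
    (hX : IsDiag ρ s X) (f : Z p q) : ρ f = X * diagRep α β s f * Xᴴ := by
  rw [← hX.intertwines, Matrix.mul_assoc, hX.coisometry, Matrix.mul_one]

theorem IsDiag.trace_eq {ρ : Z p q → Matrix n n ℂ} {s : ι → I} {X : Matrix n (Idx p q ι α β) ℂ}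
    (hX : IsDiag ρ s X) (f : Z p q) : (ρ f).trace = (diagRep α β s f).trace := by
  rw [hX.eq_conj, trace_mul_comm, ← Matrix.mul_assoc, hX.isometry, Matrix.one_mul]

theorem IsDiag.card_eq {ρ : Z p q → Matrix n n ℂ} {s : ι → I} {X : Matrix n (Idx p q ι α β) ℂ}
    (hX : IsDiag ρ s X) :
    Fintype.card n = Fintype.card ι * (p * q) + Fintype.card α * p + Fintype.card β * q := by
  have h1 : Fintype.card n = Fintype.card (Idx p q ι α β) :=
    le_antisymm (card_le_of_isometry (X := Xᴴ) (by
      rw [conjTranspose_conjTranspose]; exact hX.coisometry)) (card_le_of_isometry hX.isometry)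
  rw [h1]
  simp only [Fintype.card_sum, Fintype.card_prod, Fintype.card_fin]
  ring

theorem trace_diagRep_scal (hp : 0 < p) (hq : 0 < q) (s : ι → I) (g : C(I, ℂ)) :
    (diagRep α β s (scal g : Z p q)).trace = p * q * ∑ i, g (s i) +
      Fintype.card α * (g 0 * p) + Fintype.card β * (g 1 * q) := by
  rw [diagRep, trace_blk, infZero_scal hq, infOne_scal hp, Finset.mul_sum]
  simp [mul_comm]

/-- Sorted eigenvalues are determined by the representation and the residual multiplicities. -/
theorem IsDiag.eigenvalues_unique (hp : 0 < p) (hq : 0 < q) {ρ : Z p q → Matrix n n ℂ} {l : ℕ}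
    {s s' : Fin l → I} {X X' : Matrix n (Idx p q (Fin l) α β) ℂ} (hX : IsDiag ρ s X)
    (hX' : IsDiag ρ s' X') (hs : Monotone s) (hs' : Monotone s') : s = s' := by
  refine eq_of_sum_eq hs hs' fun g => ?_
  have h1 := (hX.trace_eq (scal g)).symm.trans (hX'.trace_eq (scal g))
  rw [trace_diagRep_scal hp hq, trace_diagRep_scal hp hq] at h1
  have h2 : (p : ℂ) * q ≠ 0 := by
    exact_mod_cast (Nat.mul_pos hp hq).ne'
  exact mul_left_cancel₀ h2 (by linear_combination h1)

/-- Modulo `q` the dimension is `ap`, which determines `a < q`. -/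
theorem multiplicity_unique {l a b l' a' b' : ℕ} (hpq : Nat.Coprime p q)
    (ha : a < q) (ha' : a' < q)
    (h : l * (p * q) + a * p + b * q = l' * (p * q) + a' * p + b' * q) : a = a' := by
  have h1 : a * p ≡ a' * p [MOD q] := by
    have h2 : l * (p * q) + a * p + b * q ≡ a * p [MOD q] := by
      have : l * (p * q) + a * p + b * q = a * p + q * (l * p + b) := by ring
      rw [this, Nat.ModEq, Nat.add_mul_mod_self_left]
    have h3 : l' * (p * q) + a' * p + b' * q ≡ a' * p [MOD q] := by
      have : l' * (p * q) + a' * p + b' * q = a' * p + q * (l' * p + b') := by ring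
      rw [this, Nat.ModEq, Nat.add_mul_mod_self_left]
    exact h2.symm.trans ((congrArg (· % q) h).trans h3)
  exact (Nat.ModEq.cancel_right_of_coprime (by rwa [Nat.coprime_comm] at hpq) h1).eq_of_lt_of_lt
    ha ha'

/-- The dimension determines the reduced multiplicities. -/
theorem multiplicities_unique {l a b l' a' b' : ℕ} (hp : 0 < p) (hq : 0 < q)
    (hpq : Nat.Coprime p q) (ha : a < q) (ha' : a' < q) (hb : b < p) (hb' : b' < p)
    (h : l * (p * q) + a * p + b * q = l' * (p * q) + a' * p + b' * q) :
    l = l' ∧ a = a' ∧ b = b' := by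
  have h1 := multiplicity_unique hpq ha ha' h
  have h2 : b = b' := multiplicity_unique (l := l) (l' := l') (b := a) (b' := a') hpq.symm hb hb'
    (by rw [mul_comm q p]; omega)
  subst h1 h2
  refine ⟨?_, rfl, rfl⟩
  have h3 : l * (p * q) = l' * (p * q) := by omega
  exact Nat.eq_of_mul_eq_mul_right (Nat.mul_pos hp hq) h3

theorem IsDiag.pad {ρ : Z p q → Matrix n n ℂ} {l a b : ℕ} {s : Fin l → I}
    {X : Matrix n (Idx p q (Fin l) (Fin a) (Fin b)) ℂ} (hX : IsDiag ρ s X) :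
    IsDiag ρ (pad (a / q) (b / p) 0 1 s) (X.submatrix id (idxPad p q l a b).symm) :=
  isDiag_of_equiv _ hX.isometry hX.coisometry fun f => by
    rw [hX.intertwines, diagRep_pad]

theorem IsDiag.sort {ρ : Z p q → Matrix n n ℂ} {l : ℕ} {s : Fin l → I}
    {X : Matrix n (Idx p q (Fin l) α β) ℂ} (hX : IsDiag ρ s X) :
    ∃ (s' : Fin l → I) (X' : Matrix n (Idx p q (Fin l) α β) ℂ), Monotone s' ∧
      IsDiag ρ s' X' := by
  refine ⟨s ∘ Tuple.sort s, _, Tuple.monotone_sort s,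
    isDiag_of_equiv (idxCongr p q (Tuple.sort s).symm (.refl α) (.refl β)) hX.isometry hX.coisometry
      fun f => ?_⟩
  rw [hX.intertwines, diagRep, diagRep, blk_idxCongr]
  simp

/-- A unital representation of dimension `lpq + ap + bq` with `a < q` and `b < p` is block diagonal
with residual multiplicities `a` and `b`. -/
theorem exists_isDiag_of_card (hp : 0 < p) (hq : 0 < q) (hpq : Nat.Coprime p q)
    (ρ : Z p q →⋆ₙₐ[ℂ] Matrix n n ℂ) (hρ : ρ 1 = 1) {l a b : ℕ} (ha : a < q) (hb : b < p)
    (hn : Fintype.card n = l * (p * q) + a * p + b * q) :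
    ∃ (s : Fin l → I) (X : Matrix n (Idx p q (Fin l) (Fin a) (Fin b)) ℂ), Monotone s ∧
      IsDiag ρ s X := by
  obtain ⟨l', a', b', s, X, hX⟩ := exists_isDiag hp hq ρ hρ
  obtain ⟨s', X', hs', hX'⟩ := hX.pad.sort
  have h1 := hX'.card_eq
  rw [hn] at h1
  simp only [Fintype.card_fin] at h1
  obtain ⟨rfl, rfl, rfl⟩ := multiplicities_unique hp hq hpq ha (Nat.mod_lt _ hq) hb
    (Nat.mod_lt _ hp) h1
  exact ⟨s', X', hs', hX'⟩

theorem exists_multiplicities (hp : 0 < p) (hq : 0 < q)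
    (ρ : Z p q →⋆ₙₐ[ℂ] Matrix n n ℂ) (hρ : ρ 1 = 1) :
    ∃ l a b : ℕ, a < q ∧ b < p ∧ Fintype.card n = l * (p * q) + a * p + b * q := by
  obtain ⟨l', a', b', s, X, hX⟩ := exists_isDiag hp hq ρ hρ
  have h1 := hX.pad.card_eq
  simp only [Fintype.card_fin] at h1
  exact ⟨_, _, _, Nat.mod_lt _ hq, Nat.mod_lt _ hp, h1⟩

end Reduced

/-! ### Existence of associated maps -/

section Associated

variable {p q p' q' : ℕ}

/-- The fibre of a *-homomorphism into `Z_{p',q'}` at the point `t`. -/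
def fibre (φ : Z p q →⋆ₙₐ[ℂ] Z p' q') (t : I) : Z p q →⋆ₙₐ[ℂ] MatPQ p' q' := (evalHom t).comp φ

@[simp] theorem fibre_apply (φ : Z p q →⋆ₙₐ[ℂ] Z p' q') (t : I) (f : Z p q) :
    fibre φ t f = (φ f).1 t := rfl

theorem fibre_one {φ : Z p q →⋆ₙₐ[ℂ] Z p' q'} (hφ : φ 1 = 1) (t : I) : fibre φ t 1 = 1 := by
  rw [fibre_apply, hφ]; rfl

theorem IsAssociated.exists_isDiag {φ : Z p q →⋆ₙₐ[ℂ] Z p' q'} {l a b : ℕ} {ξ : Fin l → C(I, I)}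
    (h : IsAssociated φ l a b ξ) (t : I) :
    ∃ X : Matrix (Fin p' × Fin q') (Idx p q (Fin l) (Fin a) (Fin b)) ℂ,
      IsDiag (fibre φ t) (fun i => ξ i t) X := by
  obtain ⟨-, e, he⟩ := h
  obtain ⟨u, hu, huf⟩ := he t
  rw [mem_unitaryGroup_iff'] at hu
  have hu' := mul_eq_one_comm.1 hu
  rw [star_eq_conjTranspose] at hu hu'
  refine ⟨_, isDiag_of_equiv e.symm hu hu' fun f => ?_⟩
  rw [fibre_apply, huf, star_eq_conjTranspose, Matrix.mul_assoc, hu, Matrix.mul_one]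
  rfl

theorem isAssociated_of_isDiag {φ : Z p q →⋆ₙₐ[ℂ] Z p' q'} {l a b : ℕ} {ξ : Fin l → C(I, I)}
    (hξ : ∀ t, Monotone fun i => ξ i t)
    (hcard : p' * q' = l * (p * q) + a * p + b * q)
    (h : ∀ t, ∃ X : Matrix (Fin p' × Fin q') (Idx p q (Fin l) (Fin a) (Fin b)) ℂ,
      IsDiag (fibre φ t) (fun i => ξ i t) X) : IsAssociated φ l a b ξ := by
  have e : Idx p q (Fin l) (Fin a) (Fin b) ≃ Fin p' × Fin q' := by
    refine Fintype.equivOfCardEq ?_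
    simp only [Fintype.card_sum, Fintype.card_prod, Fintype.card_fin]
    rw [hcard]; ring
  refine ⟨fun i j hij t => hξ t hij, e, fun t => ?_⟩
  obtain ⟨X, hX⟩ := h t
  refine ⟨X.submatrix id e.symm, ?_, fun f => ?_⟩
  · rw [mem_unitaryGroup_iff, star_eq_conjTranspose, conjTranspose_submatrix, submatrix_mul_equiv,
      hX.coisometry, submatrix_id_id]
  · rw [← fibre_apply, hX.eq_conj, star_eq_conjTranspose, conjTranspose_submatrix, reindex_apply,
      submatrix_mul_equiv, submatrix_mul_equiv, submatrix_id_id]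
    rfl

/-- Unital *-homomorphisms have associated maps: the sorted eigenvalues depend continuously on the
point, since their sums under continuous functions are traces. -/
theorem exists_isAssociated (hp : 0 < p) (hq : 0 < q) (hpq : Nat.Coprime p q)
    {φ : Z p q →⋆ₙₐ[ℂ] Z p' q'} (hφ : φ 1 = 1) {l a b : ℕ} (ha : a < q) (hb : b < p)
    (hcard : p' * q' = l * (p * q) + a * p + b * q) :
    ∃ ξ : Fin l → C(I, I), IsAssociated φ l a b ξ := by
  choose s X hs hX using fun t => exists_isDiag_of_card hp hq hpq (fibre φ t) (fibre_one hφ t)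
    (l := l) ha hb (by simpa using hcard)
  have hcont : ∀ i, Continuous fun t => s t i := continuous_of_continuous_sum hs fun g => by
    have h0 : (p : ℂ) * q ≠ 0 := by exact_mod_cast (Nat.mul_pos hp hq).ne'
    have h1 : ∀ t, ∑ j, g (s t j) =
        ((p : ℂ) * q)⁻¹ * (((φ (scal g)).1 t).trace - a * (g 0 * p) - b * (g 1 * q)) := by
      intro t
      have h2 := (hX t).trace_eq (scal g)
      rw [trace_diagRep_scal hp hq, fibre_apply] at h2
      rw [h2, eq_inv_mul_iff_mul_eq₀ h0]
      simp only [Fintype.card_fin]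
      ring
    simp only [h1]
    fun_prop
  exact ⟨fun i => ⟨fun t => s t i, hcont i⟩, isAssociated_of_isDiag (ξ := fun i => ⟨_, hcont i⟩)
    hs hcard fun t => ⟨X t, hX t⟩⟩

end Associated

/-! ### Injective homomorphisms are unital -/

section Unital

variable {p' q' : ℕ}

theorem isIdempotentElem_toLin' {n : Type*} [Fintype n] [DecidableEq n] {P : Matrix n n ℂ}
    (hP : P * P = P) : IsIdempotentElem (Matrix.toLin' P) := by
  rw [IsIdempotentElem, Module.End.mul_eq_comp, ← Matrix.toLin'_mul, hP]

/-- Traces of idempotent matrices are natural numbers. -/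
theorem exists_nat_trace {n : Type*} [Fintype n] [DecidableEq n] {P : Matrix n n ℂ}
    (hP : P * P = P) : ∃ k : ℕ, P.trace = k := by
  have h1 := (LinearMap.IsIdempotentElem.isProj_range _ (isIdempotentElem_toLin' hP)).trace
  rw [Matrix.trace_toLin'_eq] at h1
  exact ⟨_, h1⟩

theorem eq_zero_of_trace_eq_zero {n : Type*} [Fintype n] [DecidableEq n] {P : Matrix n n ℂ}
    (hP : P * P = P) (h : P.trace = 0) : P = 0 := by
  have h1 := LinearMap.IsIdempotentElem.eq_zero_of_trace_eq_zero (isIdempotentElem_toLin' hP)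
    (by rw [Matrix.trace_toLin'_eq, h])
  exact (map_eq_zero_iff _ Matrix.toLin'.injective).1 h1

/-- A prime dimension drop algebra has no idempotents except `0` and `1`: the rank of an idempotent
is constant on the interval, and divisible by `q'` at `0` and by `p'` at `1`. -/
theorem eq_zero_or_one_of_idempotent (hpq : Nat.Coprime p' q') (hp' : 0 < p') (hq' : 0 < q')
    {e : Z p' q'} (he : e * e = e) : e = 0 ∨ e = 1 := by
  have het : ∀ t, e.1 t * e.1 t = e.1 t := fun t => congrArg (fun f : Z p' q' => f.1 t) he
  choose k hk using fun t => exists_nat_trace (het t)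
  have hkc : Continuous k := by
    rw [Nat.isClosedEmbedding_coe_real.isEmbedding.continuous_iff]
    have h1 : Continuous fun t => ((e.1 t).trace).re := by fun_prop
    refine h1.congr fun t => ?_
    rw [hk]; simp
  have hconst : ∀ t, k t = k 0 := fun t =>
    PreconnectedSpace.constant inferInstance hkc
  have h0 : q' ∣ k 0 := by
    have h1 : infZero e * infZero e = infZero e :=
      (map_mul (infZeroHom hq') e e).symm.trans (congrArg (infZeroHom hq') he)
    obtain ⟨j, hj⟩ := exists_nat_trace h1
    have h2 := hk 0
    rw [infZero_spec, trace_kronecker, hj, trace_one, Fintype.card_fin] at h2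
    exact ⟨j, by rw [mul_comm]; exact_mod_cast h2.symm⟩
  have h1 : p' ∣ k 0 := by
    have h1 : infOne e * infOne e = infOne e :=
      (map_mul (infOneHom hp') e e).symm.trans (congrArg (infOneHom hp') he)
    obtain ⟨j, hj⟩ := exists_nat_trace h1
    have h2 := hk 1
    rw [infOne_spec, trace_kronecker, hj, trace_one, Fintype.card_fin, hconst] at h2
    exact ⟨j, by exact_mod_cast h2.symm⟩
  have h2 : p' * q' ∣ k 0 := hpq.mul_dvd_of_dvd_of_dvd h1 h0
  have hcomp : ∀ t, (1 - e.1 t) * (1 - e.1 t) = 1 - e.1 t := fun t => by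
    rw [mul_sub, sub_mul, sub_mul, het]; simp
  have htr : ∀ t, (1 - e.1 t).trace = p' * q' - k 0 := fun t => by
    rw [trace_sub, hk, trace_one, hconst]; simp
  have hle : k 0 ≤ p' * q' := by
    obtain ⟨j, hj⟩ := exists_nat_trace (hcomp 0)
    rw [htr, sub_eq_iff_eq_add] at hj
    have : p' * q' = j + k 0 := by exact_mod_cast hj
    omega
  rcases Nat.eq_zero_or_pos (k 0) with h3 | h3
  · refine .inl (ext_Z fun t => ?_)
    exact eq_zero_of_trace_eq_zero (het t) (by rw [hk, hconst, h3]; simp)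
  · refine .inr (ext_Z fun t => ?_)
    have h4 : k 0 = p' * q' := le_antisymm hle (Nat.le_of_dvd h3 h2)
    refine (sub_eq_zero.1 (eq_zero_of_trace_eq_zero (hcomp t) ?_)).symm
    rw [htr, h4]; simp

theorem map_one_of_injective {p q : ℕ} (hp : 0 < p) (hq : 0 < q) (hpq : Nat.Coprime p' q')
    (hp' : 0 < p') (hq' : 0 < q') {φ : Z p q →⋆ₙₐ[ℂ] Z p' q'} (hφ : Function.Injective φ) :
    φ 1 = 1 := by
  have h1 : φ 1 * φ 1 = φ 1 := (map_mul φ 1 1).symm.trans (congrArg φ (mul_one 1))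
  refine (eq_zero_or_one_of_idempotent hpq hp' hq' h1).resolve_left fun h2 => ?_
  have h3 : (1 : Z p q) = 0 := hφ (h2.trans (map_zero φ).symm)
  have h4 := congrArg (fun f : Z p q => f.1 0 (⟨0, hp⟩, ⟨0, hq⟩) (⟨0, hp⟩, ⟨0, hq⟩)) h3
  simp at h4

end Unital

/-! ### Approximate continuous selection -/

section Selection

variable {T : Type*} [TopologicalSpace T]

/-- Approximate continuous selection: if a closed set `K ⊆ [0,1] × T` has path connected fibres and
is contained in the open set `O`, then any two points of `K` over `0` and `1` are joined by the graph
of a continuous map inside `O`. -/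
theorem exists_continuous_selection [CompactSpace T] [LocallyPathConnectedSpace T]
    {K O : Set (I × T)} (hK : IsClosed K) (hO : IsOpen O) (hKO : K ⊆ O)
    (hpath : ∀ t, IsPathConnected {x | (t, x) ∈ K}) {x₀ x₁ : T} (h₀ : (0, x₀) ∈ K)
    (h₁ : (1, x₁) ∈ K) :
    ∃ w : C(I, T), w 0 = x₀ ∧ w 1 = x₁ ∧ ∀ t, (t, w t) ∈ O := by
  -- near each point, the fibres of `K` lie in one path connected set inside the fibres of `O`
  have hlocal : ∀ t₀ : I, ∃ (u : Set I) (V : Set T), IsOpen u ∧ t₀ ∈ u ∧ IsPathConnected V ∧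
      u ×ˢ V ⊆ O ∧ ∀ t ∈ u, {x | (t, x) ∈ K} ⊆ V := by
    intro t₀
    have hKt : IsCompact {x | (t₀, x) ∈ K} := (hK.preimage (by fun_prop)).isCompact
    obtain ⟨u, v, hu, hv, htu, hKv, huv⟩ := generalized_tube_lemma (isCompact_singleton (x := t₀))
      hKt hO (by rintro ⟨t, x⟩ ⟨rfl, hx⟩; exact hKO hx)
    obtain ⟨x, hx, -⟩ := hpath t₀
    have hV : IsOpen (pathComponentIn v x) := hv.pathComponentIn x
    have hcl : IsClosed (Prod.fst '' (K ∩ (Set.univ ×ˢ (pathComponentIn v x)ᶜ))) :=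
      isClosedMap_fst_of_compactSpace _ (hK.inter (isClosed_univ.prod hV.isClosed_compl))
    refine ⟨u ∩ (Prod.fst '' (K ∩ (Set.univ ×ˢ (pathComponentIn v x)ᶜ)))ᶜ, pathComponentIn v x,
      hu.inter hcl.isOpen_compl, ⟨htu rfl, ?_⟩, isPathConnected_pathComponentIn (hKv hx), ?_, ?_⟩
    · rintro ⟨⟨t, y⟩, ⟨hy, -, hy'⟩, rfl⟩
      exact hy' ((hpath _).subset_pathComponentIn hx hKv hy)
    · rintro ⟨t, y⟩ ⟨⟨ht, -⟩, hy⟩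
      exact huv ⟨ht, pathComponentIn_subset hy⟩
    · intro t ht y hy
      by_contra hyV
      exact ht.2 ⟨(t, y), ⟨hy, trivial, hyV⟩, rfl⟩
  choose u V hu htu hV huV hKV using hlocal
  obtain ⟨τ, hτ0, hτ, ⟨N, hN⟩, hcov⟩ := exists_monotone_Icc_subset_open_cover_unitInterval hu
    fun t _ => Set.mem_iUnion.2 ⟨t, htu t⟩
  have key : ∀ n, ∀ x, (τ n, x) ∈ K → (τ n = 0 → x = x₀) →
      ∃ w : C(I, T), w 0 = x₀ ∧ w (τ n) = x ∧ ∀ t ≤ τ n, (t, w t) ∈ O := by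
    intro n
    induction n with
    | zero =>
      intro x hx hx0
      refine ⟨.const _ x, hx0 hτ0, rfl, fun t ht => ?_⟩
      have : t = τ 0 := le_antisymm ht (by rw [hτ0]; exact unitInterval.nonneg')
      subst this
      exact hKO hx
    | succ n ih =>
      intro x hx hx0
      rcases (hτ n.le_succ).eq_or_lt with heq | hlt
      · rw [Nat.succ_eq_add_one] at heq
        rw [← heq] at hx hx0 ⊢
        exact ih x hx hx0
      · obtain ⟨y, hy, hy0⟩ : ∃ y, (τ n, y) ∈ K ∧ (τ n = 0 → y = x₀) := by
          by_cases h : τ n = 0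
          · exact ⟨x₀, by rwa [h], fun _ => rfl⟩
          · obtain ⟨y, hy, -⟩ := hpath (τ n)
            exact ⟨y, hy, fun h' => absurd h' h⟩
        obtain ⟨w, hw0, hwn, hwO⟩ := ih y hy hy0
        obtain ⟨c, hc⟩ := hcov n
        have hγ := (hV c).joinedIn y (hKV c _ (hc ⟨le_rfl, hlt.le⟩) hy) x
          (hKV c _ (hc ⟨hlt.le, le_rfl⟩) hx)
        have hlt' : (0 : ℝ) < τ (n + 1) - τ n := sub_pos.2 hlt
        set g : I → T := fun t =>
          hγ.somePath.extend (((t : ℝ) - τ n) / ((τ (n + 1) : ℝ) - τ n)) with hg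
        have hgc : Continuous g := by fun_prop
        have hgn : g (τ n) = y := by simp [hg]
        have hgV : ∀ t, g t ∈ V c := by
          intro t
          have h1 : g t ∈ Set.range hγ.somePath := by
            rw [← Path.extend_range]; exact Set.mem_range_self _
          obtain ⟨s, hs⟩ := h1
          rw [← hs]
          exact hγ.somePath_mem s
        refine ⟨⟨fun t => if t ≤ τ n then w t else g t, Continuous.if_le w.continuous hgc
          continuous_id continuous_const fun t ht => by
            change t = τ n at ht; rw [ht, hwn, hgn]⟩, ?_, ?_, fun t ht => ?_⟩
        · simp [hw0]
        · have : ¬ τ (n + 1) ≤ τ n := not_le.2 hlt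
          simp [this, hg, div_self hlt'.ne']
        · by_cases h : t ≤ τ n
          · simpa [h] using hwO t h
          · simp only [ContinuousMap.coe_mk, h, if_false]
            exact huV c ⟨hc ⟨(not_le.1 h).le, ht⟩, hgV t⟩
  have hN1 : τ N = 1 := hN N le_rfl
  obtain ⟨w, h1, h2, h3⟩ := key N x₁ (by rwa [hN1]) (by rw [hN1]; exact fun h => absurd h one_ne_zero)
  rw [hN1] at h2 h3
  exact ⟨w, h1, h2, fun t => h3 t unitInterval.le_one'⟩

end Selection

/-! ### Paths in commutants of unitary matrices -/

section UnitaryPaths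

variable {n : Type*} [Fintype n] [DecidableEq n]

theorem expUnitary_argSelfAdjoint_of_continuousOn {A : Type*} [CStarAlgebra A] (u : unitary A)
    (h : ContinuousOn Complex.arg (spectrum ℂ (u : A))) :
    selfAdjoint.expUnitary (Unitary.argSelfAdjoint u) = u := by
  ext
  rw [selfAdjoint.expUnitary_coe, Unitary.argSelfAdjoint_coe, ← CFC.exp_eq_normedSpace_exp (𝕜 := ℂ),
    ← cfc_comp_smul .., ← cfc_comp' ..]
  conv_rhs => rw [← cfc_id' ℂ (u : A)]
  refine cfc_congr fun y hy ↦ ?_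
  have hy₁ : ‖y‖ = 1 := spectrum.norm_eq_one_of_unitary u.2 hy
  have : Complex.I * y.arg = Complex.log y :=
    Complex.ext (by simp [Complex.log_re, hy₁]) (by simp [Complex.log_im])
  simpa [← Complex.exp_eq_exp_ℂ, this] using Complex.exp_log (by aesop)

/-- A unitary matrix is the exponential of a self-adjoint matrix given by functional calculus, as
every function is continuous on its finite spectrum. -/
theorem expUnitary_argSelfAdjoint_matrix (u : unitary (Matrix n n ℂ)) :
    selfAdjoint.expUnitary (Unitary.argSelfAdjoint u) = u :=
  expUnitary_argSelfAdjoint_of_continuousOn u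
    ((Matrix.finite_spectrum (u : Matrix n n ℂ)).continuousOn _)

/-- A unitary matrix is joined to `1` by a path of unitaries in its bicommutant. -/
theorem exists_path_commute (u : unitary (Matrix n n ℂ)) :
    ∃ γ : Path 1 u, ∀ a : Matrix n n ℂ, Commute (u : Matrix n n ℂ) a →
      ∀ t, Commute (γ t : Matrix n n ℂ) a := by
  refine ⟨(selfAdjoint.expUnitaryPathToOne (Unitary.argSelfAdjoint u)).cast rfl
    (expUnitary_argSelfAdjoint_matrix u).symm, fun a ha t => ?_⟩
  have ha' : Commute (star (u : Matrix n n ℂ)) a := by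
    have h1 := Unitary.star_mul_self_of_mem u.2
    have h2 := Unitary.mul_star_self_of_mem u.2
    calc star (u : Matrix n n ℂ) * a = star (u : Matrix n n ℂ) * (a * u) * star (u : Matrix n n ℂ) := by
          rw [mul_assoc, mul_assoc, h2, mul_one]
      _ = a * star (u : Matrix n n ℂ) := by rw [← ha.eq, ← mul_assoc, h1, one_mul]
  have h3 : Commute (Unitary.argSelfAdjoint u : Matrix n n ℂ) a := by
    rw [Unitary.argSelfAdjoint_coe]
    exact ha.cfc ha' _
  rw [Path.cast_coe]
  change Commute ((selfAdjoint.expUnitary ((t : ℝ) • Unitary.argSelfAdjoint u) :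
    unitary (Matrix n n ℂ)) : Matrix n n ℂ) a
  rw [selfAdjoint.expUnitary_coe]
  refine (Commute.symm ?_)
  refine Commute.exp_right ?_
  exact ((h3.smul_left _).smul_left _).symm

theorem norm_le_one_of_isometry {m k : Type*} [Fintype m] [Fintype k] [DecidableEq m]
    [DecidableEq k] {X : Matrix m k ℂ} (hX : Xᴴ * X = 1) : ‖X‖ ≤ 1 := by
  have h1 := l2_opNorm_conjTranspose_mul_self X
  rw [hX] at h1
  have h2 := l2_opNorm_conjTranspose_mul_self (1 : Matrix k k ℂ)
  rw [conjTranspose_one, one_mul] at h2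
  have h3 : ‖(1 : Matrix k k ℂ)‖ ≤ 1 := by nlinarith [norm_nonneg (1 : Matrix k k ℂ)]
  nlinarith [norm_nonneg X]

theorem isCompact_isometries {m k : Type*} [Fintype m] [Fintype k] [DecidableEq m]
    [DecidableEq k] : IsCompact {X : Matrix m k ℂ | Xᴴ * X = 1} := by
  have : ProperSpace (Matrix m k ℂ) := FiniteDimensional.proper ℂ _
  refine Metric.isCompact_of_isClosed_isBounded ?_ ?_
  · exact isClosed_eq (by fun_prop) continuous_const
  · exact isBounded_iff_forall_norm_le.2 ⟨1, fun X hX => norm_le_one_of_isometry hX⟩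

instance : CompactSpace (unitary (Matrix n n ℂ)) := by
  refine isCompact_iff_compactSpace.1 ?_
  refine isCompact_isometries.of_isClosed_subset (isClosed_unitary) fun X hX => ?_
  exact hX.1

end UnitaryPaths

/-! ### Unitaries matching two diagonal forms -/

section Gauge

variable {p q : ℕ} {n : Type*} [Fintype n] [DecidableEq n] {ι α β : Type*} [Fintype ι]
  [DecidableEq ι] [Fintype α] [DecidableEq α] [Fintype β] [DecidableEq β]

omit [Fintype ι] in
/-- The block diagonal matrix with blocks `U(s' i) U(s i)*`; it carries the frame `U` at the
eigenvalues `s` to the frame at the eigenvalues `s'`. -/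
def gauge (α β : Type*) [DecidableEq α] [DecidableEq β] (U : I → MatPQ p q) (s s' : ι → I) :
    Matrix (Idx p q ι α β) (Idx p q ι α β) ℂ :=
  blk α β (fun i => U (s' i) * (U (s i))ᴴ) 1 1

/-- The unitaries `Y G X*`, where `X` and `Y` diagonalize `ρ` and `ρ'` and `G` is the gauge
matrix from the eigenvalues `s` of `ρ` to the eigenvalues `s'` of `ρ'`. -/
def twists (α β : Type*) [Fintype α] [DecidableEq α] [Fintype β] [DecidableEq β]
    (U : I → MatPQ p q) (ρ ρ' : Z p q → Matrix n n ℂ) (s s' : ι → I) :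
    Set (Matrix n n ℂ) :=
  {w | ∃ X Y : Matrix n (Idx p q ι α β) ℂ, IsDiag ρ s X ∧ IsDiag ρ' s' Y ∧
    w = Y * gauge α β U s s' * Xᴴ}

variable {U : I → MatPQ p q}

theorem gauge_isometry (hU : ∀ t, (U t)ᴴ * U t = 1) (s s' : ι → I) :
    (gauge α β U s s')ᴴ * gauge α β U s s' = 1 := by
  rw [gauge, blk_conjTranspose, blk_mul, ← blk_one]
  congr 1
  · funext i
    rw [conjTranspose_mul, conjTranspose_conjTranspose, Matrix.mul_assoc,
      ← Matrix.mul_assoc (U (s' i))ᴴ, hU, Matrix.one_mul, mul_eq_one_comm.1 (hU _)]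
  · simp
  · simp

theorem twists_subset_unitary (hU : ∀ t, (U t)ᴴ * U t = 1) {ρ ρ' : Z p q → Matrix n n ℂ}
    {s s' : ι → I} {w : Matrix n n ℂ} (hw : w ∈ twists α β U ρ ρ' s s') :
    w ∈ unitary (Matrix n n ℂ) := by
  obtain ⟨X, Y, hX, hY, rfl⟩ := hw
  refine mem_unitaryGroup_iff'.2 ?_
  rw [star_eq_conjTranspose, conjTranspose_mul, conjTranspose_mul, conjTranspose_conjTranspose]
  calc X * ((gauge α β U s s')ᴴ * Yᴴ) * (Y * gauge α β U s s' * Xᴴ)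
      = X * ((gauge α β U s s')ᴴ * (Yᴴ * Y) * gauge α β U s s') * Xᴴ := by
        simp only [Matrix.mul_assoc]
    _ = 1 := by
        rw [hY.isometry, Matrix.mul_one, gauge_isometry hU, Matrix.mul_one, hX.coisometry]

theorem norm_blk_le {F : ι → MatPQ p q} {D : ℝ} (hD : 0 ≤ D) (hF : ∀ i, ‖F i‖ ≤ D) :
    ‖blk α β F 0 0‖ ≤ D := by
  let Φ : (ι → MatPQ p q) →⋆ₙₐ[ℂ] Matrix (Idx p q ι α β) (Idx p q ι α β) ℂ :=
    { toFun := fun F => blk α β F 0 0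
      map_smul' := fun c F => by
        have h : blockDiagonal (c • F) = c • blockDiagonal F := blockDiagonal_smul c F
        have h2 : blockDiagonal (fun _ : α => (0 : Matrix (Fin p) (Fin p) ℂ)) = 0 :=
          blockDiagonal_zero
        have h3 : blockDiagonal (fun _ : β => (0 : Matrix (Fin q) (Fin q) ℂ)) = 0 :=
          blockDiagonal_zero
        simp only [blk, h, h2, h3]
        ext i j
        rcases i with i | i | i <;> rcases j with j | j | j <;> simp
      map_zero' := by
        have h : blockDiagonal (0 : ι → MatPQ p q) = 0 := blockDiagonal_zero
        have h2 : blockDiagonal (fun _ : α => (0 : Matrix (Fin p) (Fin p) ℂ)) = 0 :=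
          blockDiagonal_zero
        have h3 : blockDiagonal (fun _ : β => (0 : Matrix (Fin q) (Fin q) ℂ)) = 0 :=
          blockDiagonal_zero
        simp [blk, h, h2, h3]
      map_add' := fun F F' => by
        have h : blockDiagonal (F + F') = blockDiagonal F + blockDiagonal F' :=
          blockDiagonal_add F F'
        have h2 : blockDiagonal (fun _ : α => (0 : Matrix (Fin p) (Fin p) ℂ)) = 0 :=
          blockDiagonal_zero
        have h3 : blockDiagonal (fun _ : β => (0 : Matrix (Fin q) (Fin q) ℂ)) = 0 :=
          blockDiagonal_zero
        simp [blk, h, h2, h3, fromBlocks_add]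
      map_mul' := fun F F' => by
        rw [blk_mul, Matrix.mul_zero, Matrix.mul_zero]; rfl
      map_star' := fun F => by
        rw [star_eq_conjTranspose, blk_conjTranspose, conjTranspose_zero, conjTranspose_zero]; rfl }
  exact (NonUnitalStarAlgHom.norm_apply_le Φ F).trans ((pi_norm_le_iff_of_nonneg hD).2 hF)

/-- Elements of `twists` almost conjugate `ρ` to `ρ'` on elements of the form `U h U*`. -/
theorem norm_conj_sub_le (hU : ∀ t, (U t)ᴴ * U t = 1) {ρ ρ' : Z p q → Matrix n n ℂ}
    {s s' : ι → I} {w : Matrix n n ℂ} (hw : w ∈ twists α β U ρ ρ' s s') {f : Z p q}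
    {h : I → MatPQ p q} (hf : ∀ t, f.1 t = U t * h t * (U t)ᴴ) {D : ℝ} (hD : 0 ≤ D)
    (hh : ∀ i, ‖h (s i) - h (s' i)‖ ≤ D) : ‖w * ρ f * wᴴ - ρ' f‖ ≤ D := by
  obtain ⟨X, Y, hX, hY, rfl⟩ := hw
  set G := gauge α β U s s' with hG
  have h1 : G * diagRep α β s f * Gᴴ - diagRep α β s' f =
      blk α β (fun i => U (s' i) * (h (s i) - h (s' i)) * (U (s' i))ᴴ) 0 0 := by
    rw [hG, gauge, blk_conjTranspose, diagRep, diagRep, blk_mul, blk_mul, blk_sub]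
    congr 1
    · funext i
      rw [conjTranspose_mul, conjTranspose_conjTranspose, hf, hf]
      calc U (s' i) * (U (s i))ᴴ * (U (s i) * h (s i) * (U (s i))ᴴ) * (U (s i) * (U (s' i))ᴴ) -
            U (s' i) * h (s' i) * (U (s' i))ᴴ
          = U (s' i) * ((U (s i))ᴴ * U (s i)) * h (s i) * ((U (s i))ᴴ * U (s i)) * (U (s' i))ᴴ -
            U (s' i) * h (s' i) * (U (s' i))ᴴ := by simp only [Matrix.mul_assoc]
        _ = _ := by
          rw [hU, Matrix.mul_one, Matrix.mul_one, Matrix.mul_sub, Matrix.sub_mul]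
    · simp
    · simp
  have h2 : Y * G * Xᴴ * ρ f * (Y * G * Xᴴ)ᴴ - ρ' f =
      Y * (G * diagRep α β s f * Gᴴ - diagRep α β s' f) * Yᴴ := by
    rw [hX.eq_conj, hY.eq_conj, Matrix.mul_sub, Matrix.sub_mul]
    congr 1
    rw [conjTranspose_mul, conjTranspose_mul, conjTranspose_conjTranspose]
    calc Y * G * Xᴴ * (X * diagRep α β s f * Xᴴ) * (X * (Gᴴ * Yᴴ))
        = Y * G * (Xᴴ * X) * diagRep α β s f * (Xᴴ * X) * Gᴴ * Yᴴ := by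
          simp only [Matrix.mul_assoc]
      _ = _ := by rw [hX.isometry, Matrix.mul_one, Matrix.mul_one]; simp only [Matrix.mul_assoc]
  have hle : ∀ {k m : Type _} [Fintype k] [Fintype m] [DecidableEq k] [DecidableEq m]
      (V : Matrix k m ℂ) (M : Matrix m m ℂ), Vᴴ * V = 1 → ‖M‖ ≤ D → ‖V * M * Vᴴ‖ ≤ D := by
    intro k m _ _ _ _ V M hV hM
    have h3 := norm_le_one_of_isometry hV
    calc ‖V * M * Vᴴ‖ ≤ ‖V * M‖ * ‖Vᴴ‖ := l2_opNorm_mul _ _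
      _ ≤ ‖V‖ * ‖M‖ * ‖Vᴴ‖ := by gcongr; exact l2_opNorm_mul _ _
      _ = ‖V‖ * ‖M‖ * ‖V‖ := by rw [l2_opNorm_conjTranspose]
      _ ≤ 1 * D * 1 := by gcongr
      _ = D := by ring
  rw [h2, h1]
  refine hle Y _ hY.isometry (norm_blk_le hD fun i => ?_)
  have h3 := norm_le_one_of_isometry (hU (s' i))
  calc ‖U (s' i) * (h (s i) - h (s' i)) * (U (s' i))ᴴ‖
      ≤ ‖U (s' i) * (h (s i) - h (s' i))‖ * ‖(U (s' i))ᴴ‖ := l2_opNorm_mul _ _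
    _ ≤ ‖U (s' i)‖ * ‖h (s i) - h (s' i)‖ * ‖(U (s' i))ᴴ‖ := by gcongr; exact l2_opNorm_mul _ _
    _ = ‖U (s' i)‖ * ‖h (s i) - h (s' i)‖ * ‖U (s' i)‖ := by rw [l2_opNorm_conjTranspose]
    _ ≤ 1 * D * 1 := by gcongr; exact hh i
    _ = D := by ring

/-- Two diagonalizing isometries differ by a unitary in the commutant. -/
theorem IsDiag.exists_commuting {ρ : Z p q → Matrix n n ℂ} {s : ι → I}
    {X X' : Matrix n (Idx p q ι α β) ℂ} (hX : IsDiag ρ s X) (hX' : IsDiag ρ s X') :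
    ∃ d : unitary (Matrix n n ℂ), (∀ f, Commute (d : Matrix n n ℂ) (ρ f)) ∧
      X' = (d : Matrix n n ℂ) * X := by
  refine ⟨⟨X' * Xᴴ, mem_unitaryGroup_iff.2 ?_⟩, fun f => ?_, ?_⟩
  · rw [star_eq_conjTranspose, conjTranspose_mul, conjTranspose_conjTranspose]
    calc X' * Xᴴ * (X * X'ᴴ) = X' * (Xᴴ * X) * X'ᴴ := by simp only [Matrix.mul_assoc]
      _ = 1 := by rw [hX.isometry, Matrix.mul_one, hX'.coisometry]
  · change X' * Xᴴ * ρ f = ρ f * (X' * Xᴴ)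
    rw [← Matrix.mul_assoc, hX'.intertwines, hX.eq_conj]
    calc X' * Xᴴ * (X * diagRep α β s f * Xᴴ) = X' * (Xᴴ * X) * diagRep α β s f * Xᴴ := by
          simp only [Matrix.mul_assoc]
      _ = _ := by rw [hX.isometry, Matrix.mul_one]
  · rw [Matrix.mul_assoc, hX.isometry, Matrix.mul_one]

theorem IsDiag.mul_left {ρ : Z p q → Matrix n n ℂ} {s : ι → I}
    {X : Matrix n (Idx p q ι α β) ℂ} (hX : IsDiag ρ s X) {d : Matrix n n ℂ}
    (hd : d ∈ unitary (Matrix n n ℂ)) (hdρ : ∀ f, Commute d (ρ f)) : IsDiag ρ s (d * X) where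
  isometry := by
    have h1 : dᴴ * d = 1 := hd.1
    calc (d * X)ᴴ * (d * X) = Xᴴ * (dᴴ * d) * X := by
          rw [conjTranspose_mul]; simp only [Matrix.mul_assoc]
      _ = 1 := by rw [h1, Matrix.mul_one, hX.isometry]
  intertwines f := by
    rw [← Matrix.mul_assoc, ← (hdρ f).eq, Matrix.mul_assoc, hX.intertwines, ← Matrix.mul_assoc]
  coisometry := by
    have h1 : d * dᴴ = 1 := hd.2
    calc d * X * (d * X)ᴴ = d * (X * Xᴴ) * dᴴ := by
          rw [conjTranspose_mul]; simp only [Matrix.mul_assoc]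
      _ = 1 := by rw [hX.coisometry, Matrix.mul_one, h1]

theorem isPathConnected_twists (hU : ∀ t, (U t)ᴴ * U t = 1) {ρ ρ' : Z p q → Matrix n n ℂ}
    {s s' : ι → I} {X₀ Y₀ : Matrix n (Idx p q ι α β) ℂ} (hX₀ : IsDiag ρ s X₀)
    (hY₀ : IsDiag ρ' s' Y₀) :
    IsPathConnected {w : unitary (Matrix n n ℂ) | (w : Matrix n n ℂ) ∈ twists α β U ρ ρ' s s'} := by
  set w₀ : unitary (Matrix n n ℂ) := ⟨Y₀ * gauge α β U s s' * X₀ᴴ,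
    twists_subset_unitary hU ⟨X₀, Y₀, hX₀, hY₀, rfl⟩⟩ with hw₀
  refine ⟨w₀, ⟨X₀, Y₀, hX₀, hY₀, rfl⟩, ?_⟩
  rintro w ⟨X, Y, hX, hY, hw⟩
  obtain ⟨d, hd, rfl⟩ := hX₀.exists_commuting hX
  obtain ⟨c, hc, rfl⟩ := hY₀.exists_commuting hY
  obtain ⟨γ, hγ⟩ := exists_path_commute d
  obtain ⟨δ, hδ⟩ := exists_path_commute c
  have hval : ∀ t, ((δ t * w₀ * star (γ t) : unitary (Matrix n n ℂ)) : Matrix n n ℂ) =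
      (δ t : Matrix n n ℂ) * Y₀ * gauge α β U s s' * ((γ t : Matrix n n ℂ) * X₀)ᴴ := by
    intro t
    rw [conjTranspose_mul]
    change (δ t : Matrix n n ℂ) * (Y₀ * gauge α β U s s' * X₀ᴴ) * (γ t : Matrix n n ℂ)ᴴ = _
    simp only [Matrix.mul_assoc]
  refine ⟨⟨⟨fun t => δ t * w₀ * star (γ t), by fun_prop⟩, ?_, ?_⟩, fun t => ?_⟩
  · simp
  · refine Subtype.ext ?_
    change ((δ 1 * w₀ * star (γ 1) : unitary (Matrix n n ℂ)) : Matrix n n ℂ) = _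
    rw [hval, δ.target, γ.target, hw]
  · exact ⟨_, _, hX₀.mul_left (γ t).2 fun f => hγ _ (hd f) t,
      hY₀.mul_left (δ t).2 fun f => hδ _ (hc f) t, hval t⟩

/-- The sets `twists` depend on continuous data in a closed way. -/
theorem isClosed_twists (hU : Continuous U) {ρ ρ' : I → Z p q → Matrix n n ℂ}
    (hρ : ∀ f, Continuous fun t => ρ t f) (hρ' : ∀ f, Continuous fun t => ρ' t f)
    {s s' : ι → C(I, I)} :
    IsClosed {z : I × unitary (Matrix n n ℂ) | (z.2 : Matrix n n ℂ) ∈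
      twists α β U (ρ z.1) (ρ' z.1) (fun i => s i z.1) (fun i => s' i z.1)} := by
  have hdiag : ∀ (s : ι → C(I, I)) (f : Z p q),
      Continuous fun t => diagRep α β (fun i => s i t) f := fun s f =>
    continuous_blk (fun i => f.1.continuous.comp (s i).continuous) _ _
  have hclosed : ∀ {ρ : I → Z p q → Matrix n n ℂ} (_ : ∀ f, Continuous fun t => ρ t f)
      (s : ι → C(I, I)), IsClosed {z : I × Matrix n (Idx p q ι α β) ℂ |
        IsDiag (ρ z.1) (fun i => s i z.1) z.2} := by
    intro ρ hρ s
    have h1 : {z : I × Matrix n (Idx p q ι α β) ℂ | IsDiag (ρ z.1) (fun i => s i z.1) z.2} =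
        {z : I × Matrix n (Idx p q ι α β) ℂ | z.2ᴴ * z.2 = 1} ∩
        {z : I × Matrix n (Idx p q ι α β) ℂ | z.2 * z.2ᴴ = 1} ∩
        ⋂ f, {z : I × Matrix n (Idx p q ι α β) ℂ | ρ z.1 f * z.2 = z.2 * diagRep α β (fun i => s i z.1) f} := by
      ext z
      simp only [Set.mem_ofPred_eq, Set.mem_inter_iff, Set.mem_iInter]
      exact ⟨fun h => ⟨⟨h.isometry, h.coisometry⟩, h.intertwines⟩, fun h => ⟨⟨h.1.1, h.2⟩, h.1.2⟩⟩
    rw [h1]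
    refine ((isClosed_eq (by fun_prop) continuous_const).inter
      (isClosed_eq (by fun_prop) continuous_const)).inter (isClosed_iInter fun f => ?_)
    have h2 := hρ f
    have h3 := hdiag s f
    exact isClosed_eq (by fun_prop) (continuous_snd.matrix_mul (h3.comp continuous_fst))
  set C : Set (I × Matrix n (Idx p q ι α β) ℂ × Matrix n (Idx p q ι α β) ℂ) :=
    {z | IsDiag (ρ z.1) (fun i => s i z.1) z.2.1 ∧ IsDiag (ρ' z.1) (fun i => s' i z.1) z.2.2}
  have hC : IsCompact C := by
    refine (isCompact_univ.prod (isCompact_isometries.prod isCompact_isometries)).of_isClosed_subset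
      ?_ fun z hz => ⟨trivial, hz.1.isometry, hz.2.isometry⟩
    exact ((hclosed hρ s).preimage 
        (f := fun z : I × Matrix n (Idx p q ι α β) ℂ × Matrix n (Idx p q ι α β) ℂ => (z.1, z.2.1))
        (by fun_prop)).inter
      ((hclosed hρ' s').preimage 
        (f := fun z : I × Matrix n (Idx p q ι α β) ℂ × Matrix n (Idx p q ι α β) ℂ => (z.1, z.2.2))
        (by fun_prop))
  have hgauge : Continuous fun t => gauge α β U (fun i => s i t) (fun i => s' i t) :=
    continuous_blk (fun i => by fun_prop) _ _
  have himage : IsClosed ((fun z : I × Matrix n (Idx p q ι α β) ℂ × Matrix n (Idx p q ι α β) ℂ =>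
      (z.1, z.2.2 * gauge α β U (fun i => s i z.1) (fun i => s' i z.1) * z.2.1ᴴ)) '' C) :=
    (hC.image (continuous_fst.prodMk (((continuous_snd.comp continuous_snd).matrix_mul
      (hgauge.comp continuous_fst)).matrix_mul
      (continuous_fst.comp continuous_snd).matrix_conjTranspose))).isClosed
  convert himage.preimage (f := fun z : I × unitary (Matrix n n ℂ) => (z.1, (z.2 : Matrix n n ℂ)))
    (by fun_prop) using 1
  ext ⟨t, w⟩
  constructor
  · rintro ⟨X, Y, hX, hY, hw⟩
    exact ⟨(t, X, Y), ⟨hX, hY⟩, Prod.ext rfl hw.symm⟩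
  · rintro ⟨⟨t', X, Y⟩, ⟨hX, hY⟩, h⟩
    obtain ⟨h1, h2⟩ := Prod.ext_iff.1 h
    change t' = t at h1
    subst h1
    exact ⟨X, Y, hX, hY, h2.symm⟩

end Gauge

/-! ### Unitaries of tensor product form -/

section Endpoints

variable {p q : ℕ} {n : Type*} [Fintype n] [DecidableEq n] {U : I → MatPQ p q}

omit [Fintype n] [DecidableEq n] in
theorem submatrix_mul_mul_conjTranspose {J J' : Type*} [Fintype J] [Fintype J'] (E : J ≃ J')
    (X Y : Matrix n J ℂ) (G : Matrix J J ℂ) :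
    Y.submatrix id E.symm * G.submatrix E.symm E.symm * (X.submatrix id E.symm)ᴴ =
      Y * G * Xᴴ := by
  rw [conjTranspose_submatrix, submatrix_mul_equiv, submatrix_mul_equiv, submatrix_id_id]

theorem gauge_pad (hU : ∀ t, (U t)ᴴ * U t = 1) {l a b : ℕ} (s s' : Fin l → I) :
    (gauge (Fin (a % q)) (Fin (b % p)) U (pad (a / q) (b / p) 0 1 s)
      (pad (a / q) (b / p) 0 1 s')).submatrix (idxPad p q l a b) (idxPad p q l a b) =
      gauge (Fin a) (Fin b) U s s' := by
  have h1 : (fun i => U (pad (a / q) (b / p) 0 1 s' i) * (U (pad (a / q) (b / p) 0 1 s i))ᴴ) =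
      pad (a / q) (b / p) ((1 : Matrix (Fin p) (Fin p) ℂ) ⊗ₖ (1 : Matrix (Fin q) (Fin q) ℂ))
        ((1 : Matrix (Fin p) (Fin p) ℂ) ⊗ₖ (1 : Matrix (Fin q) (Fin q) ℂ))
        (fun i => U (s' i) * (U (s i))ᴴ) := by
    have hU' : ∀ t, U t * (U t)ᴴ = 1 := fun t => mul_eq_one_comm.1 (hU t)
    funext i
    unfold pad
    refine Fin.addCases (fun i => ?_) (fun i => Fin.addCases (fun i => ?_) (fun i => ?_) i) i <;>
      simp [hU']
  rw [gauge, h1, blk_pad, gauge]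

/-- Absorbing residual copies of the points at infinity does not change `twists`, since the gauge
matrix is the identity on the blocks where both eigenvalues are `0` or both are `1`. -/
theorem mem_twists_pad (hU : ∀ t, (U t)ᴴ * U t = 1) {ρ ρ' : Z p q → Matrix n n ℂ} {l a b : ℕ}
    {s s' : Fin l → I} {w : Matrix n n ℂ} :
    w ∈ twists (Fin (a % q)) (Fin (b % p)) U ρ ρ' (pad (a / q) (b / p) 0 1 s)
      (pad (a / q) (b / p) 0 1 s') ↔ w ∈ twists (Fin a) (Fin b) U ρ ρ' s s' := by
  constructor
  · rintro ⟨X, Y, hX, hY, rfl⟩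
    have hs : ∀ (s : Fin l → I) (f : Z p q),
        (diagRep (Fin a) (Fin b) s f).submatrix (idxPad p q l a b).symm (idxPad p q l a b).symm =
        diagRep (Fin (a % q)) (Fin (b % p)) (pad (a / q) (b / p) 0 1 s) f := by
      intro s f
      rw [← diagRep_pad]
      simp [submatrix_submatrix]
    refine ⟨_, _, isDiag_of_equiv (idxPad p q l a b).symm hX.isometry hX.coisometry fun f => by
      rw [hX.intertwines, hs], isDiag_of_equiv (idxPad p q l a b).symm hY.isometry hY.coisometry
      fun f => by rw [hY.intertwines, hs], ?_⟩
    rw [← gauge_pad hU s s']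
    simp
  · rintro ⟨X, Y, hX, hY, rfl⟩
    refine ⟨_, _, hX.pad, hY.pad, ?_⟩
    rw [← submatrix_mul_mul_conjTranspose (idxPad p q l a b), ← gauge_pad hU s s']
    simp [submatrix_submatrix]

/-- Reduced sorted diagonal forms are unique, hence so are the sets `twists` built from them. -/
theorem mem_twists_of_reduced (hp : 0 < p) (hq : 0 < q) (hpq : Nat.Coprime p q)
    {ρ ρ' : Z p q → Matrix n n ℂ} {l a b l₁ a₁ b₁ : ℕ}
    {s s' : Fin l → I} {s₁ s₁' : Fin l₁ → I} {w w₁ : Matrix n n ℂ} (ha : a < q) (hb : b < p)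
    (ha₁ : a₁ < q) (hb₁ : b₁ < p) (hs : Monotone s) (hs' : Monotone s') (hs₁ : Monotone s₁)
    (hs₁' : Monotone s₁') (hw : w ∈ twists (Fin a) (Fin b) U ρ ρ' s s')
    (hw₁ : w₁ ∈ twists (Fin a₁) (Fin b₁) U ρ ρ' s₁ s₁') :
    w ∈ twists (Fin a₁) (Fin b₁) U ρ ρ' s₁ s₁' := by
  obtain ⟨X, Y, hX, hY, rfl⟩ := hw
  obtain ⟨X₁, Y₁, hX₁, hY₁, -⟩ := hw₁
  have h1 := hX.card_eq.symm.trans hX₁.card_eq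
  simp only [Fintype.card_fin] at h1
  obtain ⟨rfl, rfl, rfl⟩ := multiplicities_unique hp hq hpq ha ha₁ hb hb₁ h1
  obtain rfl := hX.eigenvalues_unique hp hq hX₁ hs hs₁
  obtain rfl := hY.eigenvalues_unique hp hq hY₁ hs' hs₁'
  exact ⟨X, Y, hX, hY, rfl⟩

/-- Tensoring a block diagonal matrix with the unit matrix of size `r` multiplies the multiplicities
by `r`. -/
def idxTensor (p q l a b r : ℕ) : Idx p q (Fin l) (Fin a) (Fin b) × Fin r ≃
    Idx p q (Fin (l * r)) (Fin (a * r)) (Fin (b * r)) :=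
  (((Equiv.sumProdDistrib _ _ _).trans (Equiv.sumCongr (Equiv.prodAssoc _ _ _)
    ((Equiv.sumProdDistrib _ _ _).trans
      (Equiv.sumCongr (Equiv.prodAssoc _ _ _) (Equiv.prodAssoc _ _ _)))))).trans
    (idxCongr p q finProdFinEquiv finProdFinEquiv finProdFinEquiv)

theorem blk_tensor {l a b r : ℕ} (F : Fin l → MatPQ p q) (x : Matrix (Fin p) (Fin p) ℂ)
    (y : Matrix (Fin q) (Fin q) ℂ) :
    (blk (Fin (a * r)) (Fin (b * r)) (fun i => F (Fin.divNat i)) x y).submatrix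
      (idxTensor p q l a b r) (idxTensor p q l a b r) =
      blk (Fin a) (Fin b) F x y ⊗ₖ (1 : Matrix (Fin r) (Fin r) ℂ) := by
  rw [idxTensor, Equiv.coe_trans, ← submatrix_submatrix, blk_idxCongr]
  have h : ∀ z : Fin l × Fin r, (finProdFinEquiv z).divNat = z.1 := fun z =>
    congrArg Prod.fst (finProdFinEquiv.symm_apply_apply z)
  simp only [h]
  ext ⟨i, i'⟩ ⟨j, j'⟩
  rcases i with i | i | i <;> rcases j with j | j | j <;>
    simp [blk, kroneckerMap_apply, blockDiagonal_apply, one_apply] <;>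
    by_cases h1 : i' = j' <;> by_cases h2 : i.2 = j.2 <;> simp [h1, h2]

theorem monotone_divNat {l r : ℕ} : Monotone (Fin.divNat : Fin (l * r) → Fin l) := fun i j h => by
  rw [Fin.le_def] at h ⊢
  exact Nat.div_le_div_right h

theorem IsDiag.tensor {m : Type*} [Fintype m] [DecidableEq m] {r : ℕ} (c : n ≃ m × Fin r)
    {ρ₀ : Z p q → Matrix m m ℂ} {ρ : Z p q → Matrix n n ℂ}
    (hρ : ∀ f, ρ f = (ρ₀ f ⊗ₖ (1 : Matrix (Fin r) (Fin r) ℂ)).submatrix c c) {l a b : ℕ}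
    {s : Fin l → I} {X : Matrix m (Idx p q (Fin l) (Fin a) (Fin b)) ℂ} (hX : IsDiag ρ₀ s X) :
    IsDiag ρ (fun i => s (Fin.divNat i))
      (((X ⊗ₖ (1 : Matrix (Fin r) (Fin r) ℂ)).submatrix c id).submatrix id
        (idxTensor p q l a b r).symm) := by
  refine isDiag_of_equiv _ ?_ ?_ fun f => ?_
  · rw [conjTranspose_submatrix, submatrix_mul_equiv, conjTranspose_kronecker, ← mul_kronecker_mul,
      hX.isometry]
    simp
  · rw [conjTranspose_submatrix, ← submatrix_mul _ _ _ _ _ Function.bijective_id,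
      conjTranspose_kronecker, ← mul_kronecker_mul, hX.coisometry]
    simp
  · rw [hρ, submatrix_mul_equiv, ← mul_kronecker_mul, hX.intertwines, diagRep, diagRep,
      blk_tensor (fun i => f.1 (s i)),
      Matrix.one_mul]
    conv_rhs => rw [← submatrix_id_id (blk _ _ _ _ _ ⊗ₖ _)]
    rw [← submatrix_mul _ _ _ _ _ Function.bijective_id, ← mul_kronecker_mul, Matrix.one_mul]

/-- If two representations are both amplifications of lower dimensional ones, then one of the
unitaries in `twists` is an amplification as well: sorted and reduced diagonal forms of the smaller
representations give, after amplification, the same reduced form as the given one. -/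
theorem exists_tensor_mem_twists (hp : 0 < p) (hq : 0 < q) (hpq : Nat.Coprime p q)
    (hU : ∀ t, (U t)ᴴ * U t = 1) {m : Type*} [Fintype m] [DecidableEq m] {r : ℕ}
    (c : n ≃ m × Fin r) {ρ₀ ρ₀' : Z p q →⋆ₙₐ[ℂ] Matrix m m ℂ} (h₀ : ρ₀ 1 = 1) (h₀' : ρ₀' 1 = 1)
    {ρ ρ' : Z p q → Matrix n n ℂ}
    (hρ : ∀ f, ρ f = (ρ₀ f ⊗ₖ (1 : Matrix (Fin r) (Fin r) ℂ)).submatrix c c)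
    (hρ' : ∀ f, ρ' f = (ρ₀' f ⊗ₖ (1 : Matrix (Fin r) (Fin r) ℂ)).submatrix c c)
    {l a b : ℕ} {s s' : Fin l → I} (hs : Monotone s) (hs' : Monotone s')
    {X Y : Matrix n (Idx p q (Fin l) (Fin a) (Fin b)) ℂ} (hX : IsDiag ρ s X)
    (hY : IsDiag ρ' s' Y) :
    ∃ x ∈ unitary (Matrix m m ℂ), (x ⊗ₖ (1 : Matrix (Fin r) (Fin r) ℂ)).submatrix c c ∈
      twists (Fin a) (Fin b) U ρ ρ' s s' := by
  obtain ⟨l₀, a₀, b₀, ha₀, hb₀, hm⟩ := exists_multiplicities hp hq ρ₀ h₀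
  obtain ⟨s₀, X₀, hs₀, hX₀⟩ := exists_isDiag_of_card hp hq hpq ρ₀ h₀ ha₀ hb₀ hm
  obtain ⟨s₀', Y₀, hs₀', hY₀⟩ := exists_isDiag_of_card hp hq hpq ρ₀' h₀' ha₀ hb₀ hm
  refine ⟨Y₀ * gauge (Fin a₀) (Fin b₀) U s₀ s₀' * X₀ᴴ,
    twists_subset_unitary hU ⟨X₀, Y₀, hX₀, hY₀, rfl⟩, ?_⟩
  refine (mem_twists_pad hU).1 (mem_twists_of_reduced hp hq hpq (Nat.mod_lt _ hq) (Nat.mod_lt _ hp)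
    (Nat.mod_lt _ hq) (Nat.mod_lt _ hp) (monotone_pad _ _ (hs₀.comp monotone_divNat))
    (monotone_pad _ _ (hs₀'.comp monotone_divNat)) (monotone_pad _ _ hs) (monotone_pad _ _ hs')
    ((mem_twists_pad hU (a := a₀ * r) (b := b₀ * r)).2
    ⟨_, _, hX₀.tensor c hρ, hY₀.tensor c hρ', ?_⟩) ((mem_twists_pad hU).2 ⟨X, Y, hX, hY, rfl⟩))
  have h1 : gauge (Fin (a₀ * r)) (Fin (b₀ * r)) U (s₀ ∘ Fin.divNat)
      (s₀' ∘ Fin.divNat) = (gauge (Fin a₀) (Fin b₀) U s₀ s₀' ⊗ₖ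
        (1 : Matrix (Fin r) (Fin r) ℂ)).submatrix (idxTensor p q l₀ a₀ b₀ r).symm
        (idxTensor p q l₀ a₀ b₀ r).symm := by
    rw [gauge, gauge, ← blk_tensor fun i => U (s₀' i) * (U (s₀ i))ᴴ]
    simp [submatrix_submatrix]
  rw [h1, submatrix_mul_mul_conjTranspose, conjTranspose_submatrix]
  conv_rhs => rw [← submatrix_id_id (gauge _ _ _ _ _ ⊗ₖ _)]
  rw [← submatrix_mul _ _ _ _ _ Function.bijective_id,
    ← submatrix_mul _ _ _ _ _ Function.bijective_id, conjTranspose_kronecker, ← mul_kronecker_mul,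
    ← mul_kronecker_mul]
  simp

end Endpoints

/-! ### The unitary distance is at most the diagonal distance -/

section UnitaryDistance

variable {p q p' q' : ℕ}

theorem abs_sub_le_diagDist {l : ℕ} (ξ η : Fin l → C(I, I)) (t : I) (i : Fin l) :
    |(ξ i t : ℝ) - η i t| ≤ (diagDist ξ η).toReal := by
  have h1 : diagDist ξ η ≤ ENNReal.ofReal 1 := by
    refine iSup_le fun t => iSup_le fun i => ENNReal.ofReal_le_ofReal ?_
    have h1 := (ξ i t).2
    have h2 := (η i t).2
    rw [abs_le]
    constructor <;> linarith [h1.1, h1.2, h2.1, h2.2]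
  rw [← ENNReal.ofReal_le_iff_le_toReal (ne_top_of_le_ne_top ENNReal.ofReal_ne_top h1)]
  exact le_iSup_of_le t (le_iSup_of_le i le_rfl)

/-- A continuous path of unitaries of the form `x ⊗ 1` at `0` and `1 ⊗ y` at `1`, as a unitary of
the dimension drop algebra. -/
def unitaryOfPath (w : C(I, unitary (MatPQ p q))) {x : Matrix (Fin p) (Fin p) ℂ}
    {y : Matrix (Fin q) (Fin q) ℂ} (h0 : (w 0 : MatPQ p q) = x ⊗ₖ (1 : Matrix (Fin q) (Fin q) ℂ))
    (h1 : (w 1 : MatPQ p q) = (1 : Matrix (Fin p) (Fin p) ℂ) ⊗ₖ y) : unitary (Z p q) :=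
  ⟨⟨⟨fun t => w t, by fun_prop⟩, ⟨x, h0⟩, ⟨y, h1⟩⟩,
    ext_Z fun t => Unitary.star_mul_self_of_mem (w t).2,
    ext_Z fun t => Unitary.mul_star_self_of_mem (w t).2⟩

variable {U : C(I, MatPQ p q)} {φ ψ : Z p q →⋆ₙₐ[ℂ] Z p' q'} {l a b : ℕ} {ξ η : Fin l → C(I, I)}

/-- The fibre of a *-homomorphism into `Z_{p',q'}` at the point `∞_0`. -/
def fibreZero (hq' : 0 < q') (φ : Z p q →⋆ₙₐ[ℂ] Z p' q') :
    Z p q →⋆ₙₐ[ℂ] Matrix (Fin p') (Fin p') ℂ :=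
  (infZeroHom hq' : Z p' q' →⋆ₙₐ[ℂ] Matrix (Fin p') (Fin p') ℂ).comp φ

/-- The fibre of a *-homomorphism into `Z_{p',q'}` at the point `∞_1`. -/
def fibreOne (hp' : 0 < p') (φ : Z p q →⋆ₙₐ[ℂ] Z p' q') :
    Z p q →⋆ₙₐ[ℂ] Matrix (Fin q') (Fin q') ℂ :=
  (infOneHom hp' : Z p' q' →⋆ₙₐ[ℂ] Matrix (Fin q') (Fin q') ℂ).comp φ

theorem fibreZero_one (hq' : 0 < q') (hφ : φ 1 = 1) : fibreZero hq' φ 1 = 1 :=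
  (congrArg infZero hφ).trans (infZero_eq hq' (by simp))

theorem fibreOne_one (hp' : 0 < p') (hφ : φ 1 = 1) : fibreOne hp' φ 1 = 1 :=
  (congrArg infOne hφ).trans (infOne_eq hp' (by simp))

theorem fibre_zero_eq (hq' : 0 < q') (φ : Z p q →⋆ₙₐ[ℂ] Z p' q') (f : Z p q) :
    fibre φ 0 f = (fibreZero hq' φ f ⊗ₖ (1 : Matrix (Fin q') (Fin q') ℂ)).submatrix
      (Equiv.refl _) (Equiv.refl _) :=
  infZero_spec (φ f)

theorem one_kronecker_eq_submatrix (y : Matrix (Fin q') (Fin q') ℂ) :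
    (1 : Matrix (Fin p') (Fin p') ℂ) ⊗ₖ y =
      (y ⊗ₖ (1 : Matrix (Fin p') (Fin p') ℂ)).submatrix (Equiv.prodComm _ _)
        (Equiv.prodComm _ _) := by
  ext ⟨i, i'⟩ ⟨j, j'⟩
  simp [kroneckerMap_apply, mul_comm]

theorem fibre_one_eq (hp' : 0 < p') (φ : Z p q →⋆ₙₐ[ℂ] Z p' q') (f : Z p q) :
    fibre φ 1 f = (fibreOne hp' φ f ⊗ₖ (1 : Matrix (Fin p') (Fin p') ℂ)).submatrix
      (Equiv.prodComm _ _) (Equiv.prodComm _ _) :=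
  (infOne_spec (φ f)).trans (one_kronecker_eq_submatrix _)

theorem exists_twist_zero (hp : 0 < p) (hq : 0 < q) (hq' : 0 < q')
    (hpq : Nat.Coprime p q) (hU : ∀ t, (U t)ᴴ * U t = 1) (hφ : φ 1 = 1) (hψ : ψ 1 = 1)
    (hξ : IsAssociated φ l a b ξ) (hη : IsAssociated ψ l a b η) :
    ∃ x : Matrix (Fin p') (Fin p') ℂ, x ⊗ₖ (1 : Matrix (Fin q') (Fin q') ℂ) ∈
      twists (Fin a) (Fin b) U (fibre φ 0) (fibre ψ 0) (fun i => ξ i 0) (fun i => η i 0) := by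
  obtain ⟨X, hX⟩ := hξ.exists_isDiag 0
  obtain ⟨Y, hY⟩ := hη.exists_isDiag 0
  obtain ⟨x, -, hx⟩ := exists_tensor_mem_twists hp hq hpq hU (.refl (Fin p' × Fin q'))
    (fibreZero_one hq' hφ) (fibreZero_one hq' hψ) (fibre_zero_eq hq' φ) (fibre_zero_eq hq' ψ)
    (fun i j hij => hξ.1 i j hij 0) (fun i j hij => hη.1 i j hij 0) hX hY
  exact ⟨x, hx⟩

theorem exists_twist_one (hp : 0 < p) (hq : 0 < q) (hp' : 0 < p')
    (hpq : Nat.Coprime p q) (hU : ∀ t, (U t)ᴴ * U t = 1) (hφ : φ 1 = 1) (hψ : ψ 1 = 1)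
    (hξ : IsAssociated φ l a b ξ) (hη : IsAssociated ψ l a b η) :
    ∃ y : Matrix (Fin q') (Fin q') ℂ, (1 : Matrix (Fin p') (Fin p') ℂ) ⊗ₖ y ∈
      twists (Fin a) (Fin b) U (fibre φ 1) (fibre ψ 1) (fun i => ξ i 1) (fun i => η i 1) := by
  obtain ⟨X, hX⟩ := hξ.exists_isDiag 1
  obtain ⟨Y, hY⟩ := hη.exists_isDiag 1
  obtain ⟨y, -, hy⟩ := exists_tensor_mem_twists hp hq hpq hU (Equiv.prodComm (Fin p') (Fin q'))
    (fibreOne_one hp' hφ) (fibreOne_one hp' hψ) (fibre_one_eq hp' φ) (fibre_one_eq hp' ψ)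
    (fun i j hij => hξ.1 i j hij 1) (fun i j hij => hη.1 i j hij 1) hX hY
  exact ⟨y, by rwa [one_kronecker_eq_submatrix]⟩

theorem isOpen_norm_conj_sub_lt (φ ψ : Z p q →⋆ₙₐ[ℂ] Z p' q') (F : Finset (Z p q)) (r : ℝ) :
    IsOpen {z : I × unitary (MatPQ p' q') | ∀ f ∈ F, ‖(z.2 : MatPQ p' q') * (φ f).1 z.1 *
      (z.2 : MatPQ p' q')ᴴ - (ψ f).1 z.1‖ < r} := by
  have h3 : Continuous fun z : I × unitary (MatPQ p' q') => (z.2 : MatPQ p' q') :=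
    continuous_subtype_val.comp continuous_snd
  have h4 : ∀ f ∈ F, IsOpen {z : I × unitary (MatPQ p' q') | ‖(z.2 : MatPQ p' q') * (φ f).1 z.1 *
      (z.2 : MatPQ p' q')ᴴ - (ψ f).1 z.1‖ < r} := by
    intro f _
    have h1 := (φ f).1.continuous
    have h2 := (ψ f).1.continuous
    exact isOpen_lt (((h3.matrix_mul (h1.comp continuous_fst)).matrix_mul
      h3.matrix_conjTranspose).sub (h2.comp continuous_fst)).norm continuous_const
  simpa only [Set.ofPred_forall] using isOpen_biInter_finset h4

/-- A finite part of a Lipschitz family is conjugated by a unitary of `Z_{p',q'}`, up to `ε`, within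
the diagonal distance. -/
theorem exists_unitary_norm_conj_sub_le (hp : 0 < p) (hq : 0 < q) (hp' : 0 < p') (hq' : 0 < q')
    (hpq : Nat.Coprime p q) (hφ : φ 1 = 1) (hψ : ψ 1 = 1) (hU : ∀ t, (U t)ᴴ * U t = 1)
    (hξ : IsAssociated φ l a b ξ) (hη : IsAssociated ψ l a b η) {D ε : ℝ} (hD : 0 ≤ D)
    (hε : 0 < ε) (hdist : ∀ t i, |(ξ i t : ℝ) - η i t| ≤ D) {F : Finset (Z p q)}
    (hF : ∀ f ∈ F, ∃ h : C(I, MatPQ p q), (∀ t, f.1 t = U t * h t * (U t)ᴴ) ∧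
      ∀ x y : I, ‖h x - h y‖ ≤ |(x : ℝ) - y|) :
    ∃ u : unitary (Z p' q'), ∀ f ∈ F,
      ‖(u : Z p' q') * φ f * star (u : Z p' q') - ψ f‖ ≤ D + ε := by
  obtain ⟨x, hx⟩ := exists_twist_zero hp hq hq' hpq hU hφ hψ hξ hη
  obtain ⟨y, hy⟩ := exists_twist_one hp hq hp' hpq hU hφ hψ hξ hη
  obtain ⟨w, hw0, hw1, hwO⟩ := exists_continuous_selection
    (isClosed_twists (α := Fin a) (β := Fin b) U.continuous (ρ := fun t => fibre φ t)
      (ρ' := fun t => fibre ψ t) (fun f => (φ f).1.continuous) (fun f => (ψ f).1.continuous)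
      (s := ξ) (s' := η))
    (isOpen_norm_conj_sub_lt φ ψ F (D + ε))
    (fun z hz f hf => by
      obtain ⟨h, hfh, hlip⟩ := hF f hf
      exact (norm_conj_sub_le hU hz hfh hD fun i => (hlip _ _).trans (hdist z.1 i)).trans_lt
        (lt_add_of_pos_right _ hε))
    (fun t => by
      obtain ⟨X, hX⟩ := hξ.exists_isDiag t
      obtain ⟨Y, hY⟩ := hη.exists_isDiag t
      exact isPathConnected_twists hU hX hY)
    (x₀ := ⟨_, twists_subset_unitary hU hx⟩) (x₁ := ⟨_, twists_subset_unitary hU hy⟩) hx hy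
  refine ⟨unitaryOfPath w (congrArg Subtype.val hw0) (congrArg Subtype.val hw1), fun f hf => ?_⟩
  exact (ContinuousMap.norm_le _ (by positivity)).2 fun t => (hwO t f hf).le

/-- Two unital *-homomorphisms are approximately conjugate within the diagonal distance of their
associated maps. -/
theorem dU_le_diagDist (hp : 0 < p) (hq : 0 < q) (hp' : 0 < p') (hq' : 0 < q')
    (hpq : Nat.Coprime p q) (hφ : φ 1 = 1) (hψ : ψ 1 = 1)
    {𝓛 : Set (Z p q)} (h𝓛 : IsLipschitzFamily 𝓛)
    (hξ : IsAssociated φ l a b ξ) (hη : IsAssociated ψ l a b η) :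
    dU 𝓛 φ ψ ≤ diagDist ξ η := by
  obtain ⟨U, hU, -, -, rfl⟩ := h𝓛
  refine iSup₂_le fun F hF => ENNReal.le_of_forall_pos_le_add fun ε hε hfin => ?_
  obtain ⟨u, hu⟩ := exists_unitary_norm_conj_sub_le hp hq hp' hq' hpq hφ hψ
    (fun t => mem_unitaryGroup_iff'.1 (hU t)) hξ hη ENNReal.toReal_nonneg hε
    (abs_sub_le_diagDist ξ η) (F := F) fun f hf => by
      obtain ⟨h, ⟨-, -, -, hlip⟩, hfh⟩ := hF hf
      exact ⟨h, fun t => by rw [hfh]; rfl, hlip⟩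
  refine iInf_le_of_le u (iSup₂_le fun f hf => ?_)
  rw [← ENNReal.ofReal_toReal hfin.ne, ← ENNReal.ofReal_coe_nnreal,
    ← ENNReal.ofReal_add ENNReal.toReal_nonneg ε.coe_nonneg]
  exact ENNReal.ofReal_le_ofReal (hu f hf)

end UnitaryDistance

/-! ### Ranks and Cuntz comparison of matrices -/

section Rank

theorem continuous_starAlgHom {A B : Type*} [CStarAlgebra A] [CStarAlgebra B] (π : A →⋆ₐ[ℂ] B) :
    Continuous π :=
  AddMonoidHomClass.continuous_of_bound π 1 fun a => by
    rw [one_mul]; exact NonUnitalStarAlgHom.norm_apply_le π a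

theorem map_cfc_real {A B : Type*} [CStarAlgebra A] [CStarAlgebra B] (π : A →⋆ₐ[ℂ] B) {a : A}
    (ha : IsSelfAdjoint a) {f : ℝ → ℝ} (hf : Continuous f) : π (cfc f a) = cfc f (π a) :=
  StarAlgHomClass.map_cfc (S := ℂ) π f a hf.continuousOn (continuous_starAlgHom π) ha (ha.map π)

theorem OpenLE.map {A B : Type*} [CStarAlgebra A] [CStarAlgebra B] (π : A →⋆ₐ[ℂ] B) {c d : A}
    (hc : IsSelfAdjoint c) (hd : IsSelfAdjoint d) {O O' : Set ℝ} (h : OpenLE c d O O') :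
    OpenLE (π c) (π d) O O' := by
  obtain ⟨f, g, hf, hg, x, hx⟩ := h
  refine ⟨f, g, hf, hg, fun k => π (x k), ?_⟩
  rw [← map_cfc_real π hc hf.1, ← map_cfc_real π hd hg.1]
  simpa only [Function.comp_def, map_mul, map_star] using
    ((continuous_starAlgHom π).tendsto _).comp hx

variable {n : Type*} [Fintype n] [DecidableEq n]

theorem isClosed_rank_le (k : ℕ) : IsClosed {M : Matrix n n ℂ | M.rank ≤ k} := by
  let L : Matrix n n ℂ →ₗ[ℂ] ((n → ℂ) →L[ℂ] (n → ℂ)) :=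
    (LinearMap.toContinuousLinearMap (𝕜 := ℂ) (E := n → ℂ) (F' := n → ℂ)).toLinearMap.comp
      Matrix.toLin'.toLinearMap
  have hL : Continuous L := L.continuous_of_finiteDimensional
  have h1 := (isOpen_setOfPred_nat_le_rank (𝕜 := ℂ) (E := n → ℂ) (F := n → ℂ) (k + 1)).preimage hL
  convert h1.isClosed_compl using 1
  ext M
  simp only [Set.mem_compl_iff, Set.mem_preimage, Set.mem_ofPred_eq, LinearMap.rank, not_le]
  rw [← Module.finrank_eq_rank, Nat.cast_lt, Nat.lt_succ_iff]
  rfl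

theorem rank_le_of_cuntzLE {c d : Matrix n n ℂ} (h : CuntzLE c d) : c.rank ≤ d.rank := by
  obtain ⟨x, hx⟩ := h
  exact (isClosed_rank_le d.rank).mem_of_tendsto hx (Filter.Eventually.of_forall fun k =>
    (rank_mul_le_left _ _).trans (rank_mul_le_right _ _))

variable {J : Type*} [Fintype J] [DecidableEq J]

/-- Diagonal matrices in the orthonormal basis formed by the columns of `X`. -/
def diagonalHom {X : Matrix n J ℂ} (hX : Xᴴ * X = 1) (hX' : X * Xᴴ = 1) :
    (J → ℂ) →⋆ₐ[ℂ] Matrix n n ℂ where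
  toFun v := X * diagonal v * Xᴴ
  map_one' := by rw [diagonal_one', Matrix.mul_one, hX']
  map_zero' := by simp
  map_mul' v w := by
    calc X * diagonal (v * w) * Xᴴ = X * diagonal v * (Xᴴ * X) * diagonal w * Xᴴ := by
          rw [hX, Matrix.mul_one, Matrix.mul_assoc X (diagonal v), diagonal_mul_diagonal]; rfl
      _ = _ := by simp only [Matrix.mul_assoc]
  map_add' v w := by
    rw [← Matrix.add_mul, ← Matrix.mul_add, diagonal_add]; rfl
  commutes' c := by
    have : diagonal (algebraMap ℂ (J → ℂ) c) = c • (1 : Matrix J J ℂ) := by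
      ext i j; simp [diagonal_apply, one_apply]
    rw [this, Matrix.mul_smul, Matrix.smul_mul, Matrix.mul_one, hX', Algebra.algebraMap_eq_smul_one]
  map_star' v := by
    rw [star_eq_conjTranspose, conjTranspose_mul, conjTranspose_mul, conjTranspose_conjTranspose,
      diagonal_conjTranspose, Matrix.mul_assoc]

omit [Fintype J] [DecidableEq J] in
/-- Functional calculus in the image of a C*-algebra `A` with a separating family of characters. -/
theorem cfc_of_characters {A B : Type*} [CStarAlgebra A] [CStarAlgebra B] (π : A →⋆ₐ[ℂ] B)
    (χ : J → A →⋆ₐ[ℂ] ℂ) (hχ : ∀ x y, (∀ j, χ j x = χ j y) → x = y) {a a' : A}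
    (ha : IsSelfAdjoint a) {d : J → ℝ} {f : ℝ → ℝ} (hf : Continuous f)
    (hd : ∀ j, χ j a = (d j : ℂ)) (hd' : ∀ j, χ j a' = ((f (d j) : ℝ) : ℂ)) :
    cfc f (π a) = π a' := by
  have h1 : cfc f a = a' := hχ _ _ fun j => by
    rw [map_cfc_real (χ j) ha hf, hd, hd']
    exact cfc_algebraMap (A := ℂ) (d j) f
  rw [← map_cfc_real π ha hf, h1]

theorem cfc_conj_diagonal {X : Matrix n J ℂ} (hX : Xᴴ * X = 1) (hX' : X * Xᴴ = 1) (d : J → ℝ)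
    {f : ℝ → ℝ} (hf : Continuous f) :
    cfc f (X * diagonal (fun j => (d j : ℂ)) * Xᴴ) =
      X * diagonal (fun j => ((f (d j) : ℝ) : ℂ)) * Xᴴ := by
  refine cfc_of_characters (diagonalHom hX hX') (fun j => Pi.evalStarAlgHom ℂ (fun _ : J => ℂ) j)
    (fun x y h => funext h) (a := fun j => (d j : ℂ)) (a' := fun j => ((f (d j) : ℝ) : ℂ)) ?_ hf
    (fun _ => rfl) fun _ => rfl
  ext j
  simp

omit [DecidableEq n] in
theorem rank_conj_diagonal {X : Matrix n J ℂ} (hX : Xᴴ * X = 1) (v : J → ℂ) :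
    (X * diagonal v * Xᴴ).rank = Fintype.card {j // v j ≠ 0} := by
  rw [← rank_diagonal]
  refine le_antisymm ((rank_mul_le_left _ _).trans (rank_mul_le_right _ _)) ?_
  have h1 : diagonal v = Xᴴ * (X * diagonal v * Xᴴ) * X := by
    calc diagonal v = (Xᴴ * X) * diagonal v * (Xᴴ * X) := by
          rw [hX, Matrix.one_mul, Matrix.mul_one]
      _ = _ := by simp only [Matrix.mul_assoc]
  conv_lhs => rw [h1]
  exact (rank_mul_le_left _ _).trans (rank_mul_le_right _ _)

open Classical in
/-- Cuntz comparison of diagonalizable matrices bounds the number of eigenvalues in open sets. -/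
theorem card_le_of_openLE {X Y : Matrix n J ℂ} (hX : Xᴴ * X = 1) (hX' : X * Xᴴ = 1)
    (hY : Yᴴ * Y = 1) (hY' : Y * Yᴴ = 1) {d d' : J → ℝ} {O O' : Set ℝ}
    (h : OpenLE (X * diagonal (fun j => (d j : ℂ)) * Xᴴ) (Y * diagonal (fun j => (d' j : ℂ)) * Yᴴ)
      O O') : (Finset.univ.filter fun j => d j ∈ O).card ≤
        (Finset.univ.filter fun j => d' j ∈ O').card := by
  obtain ⟨f, g, hf, hg, hfg⟩ := h
  rw [cfc_conj_diagonal hX hX' d hf.1, cfc_conj_diagonal hY hY' d' hg.1] at hfg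
  have h1 := rank_le_of_cuntzLE hfg
  rw [rank_conj_diagonal hX, rank_conj_diagonal hY, Fintype.card_subtype, Fintype.card_subtype] at h1
  have h2 : ∀ j, ((f (d j) : ℝ) : ℂ) ≠ 0 ↔ d j ∈ O := fun j => by
    rw [Complex.ofReal_ne_zero, ← hf.2.2]; rfl
  have h3 : ∀ j, ((g (d' j) : ℝ) : ℂ) ≠ 0 ↔ d' j ∈ O' := fun j => by
    rw [Complex.ofReal_ne_zero, ← hg.2.2]; rfl
  simpa only [h2, h3] using h1

end Rank

/-! ### The diagonal distance is at most the Cuntz distance -/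

section LowerBound

variable {p q p' q' : ℕ}

/-- Evaluation at `t ∈ [0,1]` as a unital *-homomorphism. -/
def evalStarAlgHom (t : I) : Z p q →⋆ₐ[ℂ] MatPQ p q where
  toFun f := (f : C(I, MatPQ p q)) t
  map_one' := rfl
  map_zero' := rfl
  map_add' _ _ := rfl
  map_mul' _ _ := rfl
  commutes' _ := rfl
  map_star' _ := rfl

/-- The eigenvalues of the coordinate function under a block diagonal representation. -/
def idEigenvalue {ι : Type*} (α β : Type*) (s : ι → I) : Idx p q ι α β → ℝ :=
  Sum.elim (fun z => s z.2) (Sum.elim (fun _ => 0) fun _ => 1)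

theorem diagRep_scal_idC (hp : 0 < p) (hq : 0 < q) {ι α β : Type*} [DecidableEq ι] [DecidableEq α]
    [DecidableEq β] (s : ι → I) : diagRep α β s (scal idC : Z p q) =
      diagonal fun j => (idEigenvalue α β s j : ℂ) := by
  rw [diagRep, infZero_scal hq, infOne_scal hp]
  ext i j
  rcases i with ⟨i, a⟩ | ⟨i, a⟩ | ⟨i, a⟩ <;> rcases j with ⟨j, b⟩ | ⟨j, b⟩ | ⟨j, b⟩ <;>
    simp [blk, idEigenvalue, blockDiagonal_apply, diagonal_apply, one_apply, ite_and]
  all_goals split_ifs <;> rfl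

theorem isSelfAdjoint_scal_idC : IsSelfAdjoint (scal idC : Z p q) := by
  refine ext_Z fun t => ?_
  change star (((t : ℝ) : ℂ) • (1 : MatPQ p q)) = ((t : ℝ) : ℂ) • 1
  simp

/-- The coordinate function belongs to every Lipschitz family. -/
theorem scal_idC_mem {𝓛 : Set (Z p q)} (h𝓛 : IsLipschitzFamily 𝓛) : scal idC ∈ 𝓛 := by
  obtain ⟨U, hU, -, -, rfl⟩ := h𝓛
  have h1 : ∀ t, star (U t) * U t = 1 := fun t => mem_unitaryGroup_iff'.1 (hU t)
  have h2 : ∀ t, U t * star (U t) = 1 := fun t => mem_unitaryGroup_iff.1 (hU t)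
  have hone : ‖(1 : MatPQ p q)‖ ≤ 1 := norm_le_one_of_isometry (by simp)
  refine ⟨(scal idC : Z p q).1, ⟨⟨_, (scal idC : Z p q).2, ?_⟩, ?_, ?_, fun x y => ?_⟩, ?_⟩
  · ext1 t
    change star (U t) * (idC t • (1 : MatPQ p q)) * U t = idC t • 1
    rw [Matrix.mul_smul, Matrix.smul_mul, mul_one, h1]
  · exact congrArg Subtype.val (isSelfAdjoint_scal_idC (p := p) (q := q))
  · refine (ContinuousMap.norm_le _ zero_le_one).2 fun t => ?_
    change ‖((t : ℝ) : ℂ) • (1 : MatPQ p q)‖ ≤ 1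
    rw [norm_smul, Complex.norm_real, Real.norm_of_nonneg t.2.1]
    nlinarith [t.2.1, t.2.2, norm_nonneg (1 : MatPQ p q)]
  · change ‖((x : ℝ) : ℂ) • (1 : MatPQ p q) - ((y : ℝ) : ℂ) • (1 : MatPQ p q)‖ ≤ _
    rw [← sub_smul, ← Complex.ofReal_sub, norm_smul, Complex.norm_real, Real.norm_eq_abs]
    exact mul_le_of_le_one_right (abs_nonneg _) hone
  · ext1 t
    change idC t • (1 : MatPQ p q) = U t * (idC t • 1) * star (U t)
    rw [Matrix.mul_smul, Matrix.smul_mul, mul_one, h2]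

theorem sum_idEigenvalue (l a b : ℕ) (s : Fin l → I) (g : ℝ → ℕ) :
    ∑ j, g (idEigenvalue (p := p) (q := q) (Fin a) (Fin b) s j) =
      p * q * ∑ i, g (s i) + p * a * g 0 + q * b * g 1 := by
  simp [Fintype.sum_sum_type, Fintype.sum_prod_type, idEigenvalue]
  ring

open Classical in
theorem card_filter_idEigenvalue (l a b : ℕ) (s : Fin l → I) (O : Set ℝ) :
    (Finset.univ.filter fun j => idEigenvalue (p := p) (q := q) (Fin a) (Fin b) s j ∈ O).card =
    p * q * (Finset.univ.filter fun i => (s i : ℝ) ∈ O).card +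
      p * a * (if (0 : ℝ) ∈ O then 1 else 0) + q * b * if (1 : ℝ) ∈ O then 1 else 0 := by
  rw [Finset.card_filter, Finset.card_filter]
  exact sum_idEigenvalue l a b s fun x => if x ∈ O then 1 else 0

open Classical in
theorem lt_of_card_le {l : ℕ} {x y : Fin l → ℝ} (hx : Monotone x) (hy : Monotone y) {c d : ℝ}
    {i : Fin l} (hi : d < x i) (h : (Finset.univ.filter fun j => d < x j).card ≤
      (Finset.univ.filter fun j => c < y j).card) : c < y i := by
  by_contra! hle
  have h1 : Finset.Ici i ⊆ Finset.univ.filter fun j => d < x j := fun j hj => by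
    simpa using hi.trans_le (hx (Finset.mem_Ici.1 hj))
  have h2 : (Finset.univ.filter fun j => c < y j) ⊆ Finset.Ioi i := fun j hj => by
    rw [Finset.mem_Ioi]
    by_contra! hji
    have h3 : c < y j := by simpa using hj
    exact absurd (hy hji) (not_le.2 (hle.trans_lt h3))
  have h3 := Finset.card_le_card h1
  have h4 := Finset.card_le_card h2
  rw [Fin.card_Ici] at h3
  rw [Fin.card_Ioi] at h4
  have := i.2
  omega

variable {φ ψ : Z p q →⋆ₙₐ[ℂ] Z p' q'} {l a b : ℕ} {ξ η : Fin l → C(I, I)}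

/-- Comparing the spectral cutoffs of the coordinate function over `(s,∞)` bounds the eigenvalues
of `ψ` from below; for `s - r ≥ 0` the residual copies of `∞_0` do not contribute, and those of
`∞_1` contribute equally to both sides. -/
theorem sub_le_of_openLE (hp : 0 < p) (hq : 0 < q) (hξ : IsAssociated φ l a b ξ)
    (hη : IsAssociated ψ l a b η) {s r : ℝ} (hs : 0 ≤ s) (hr : 0 < r)
    (h : OpenLE (φ (scal idC)) (ψ (scal idC)) (Set.Ioi s) (Metric.thickening r (Set.Ioi s)))
    {t : I} {i : Fin l} (hi : s < ξ i t) : s - r ≤ η i t := by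
  rcases lt_or_ge (s - r) 0 with h0 | h0
  · exact h0.le.trans (η i t).2.1
  have hthick : Metric.thickening r (Set.Ioi s) = Set.Ioi (s - r) := by
    ext x
    rw [Metric.mem_thickening_iff]
    constructor
    · rintro ⟨z, hz, hxz⟩
      rw [Real.dist_eq, abs_lt] at hxz
      rw [Set.mem_Ioi] at hz ⊢
      linarith
    · intro hx
      have hx' : s - r < x := hx
      have h1 : max x s < x + r := max_lt (by linarith) (by linarith)
      refine ⟨(max x s + (x + r)) / 2, ?_, ?_⟩
      · rw [Set.mem_Ioi]
        linarith [le_max_right x s]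
      · rw [Real.dist_eq, abs_lt]
        constructor <;> linarith [le_max_left x s]
  rw [hthick] at h
  have h1 := h.map (evalStarAlgHom t) (isSelfAdjoint_scal_idC.map φ) (isSelfAdjoint_scal_idC.map ψ)
  obtain ⟨X, hX⟩ := hξ.exists_isDiag t
  obtain ⟨Y, hY⟩ := hη.exists_isDiag t
  have hφ : evalStarAlgHom t (φ (scal idC)) = (X * diagonal (α := ℂ)
      (fun j => (idEigenvalue (p := p) (q := q) (Fin a) (Fin b) (fun i => ξ i t) j : ℂ)) * Xᴴ :
        Matrix (Fin p' × Fin q') (Fin p' × Fin q') ℂ) := by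
    rw [← diagRep_scal_idC hp hq]
    exact hX.eq_conj _
  have hψ : evalStarAlgHom t (ψ (scal idC)) = (Y * diagonal (α := ℂ)
      (fun j => (idEigenvalue (p := p) (q := q) (Fin a) (Fin b) (fun i => η i t) j : ℂ)) * Yᴴ :
        Matrix (Fin p' × Fin q') (Fin p' × Fin q') ℂ) := by
    rw [← diagRep_scal_idC hp hq]
    exact hY.eq_conj _
  rw [hφ, hψ] at h1
  have h2 := card_le_of_openLE hX.isometry hX.coisometry hY.isometry hY.coisometry h1
  rw [card_filter_idEigenvalue, card_filter_idEigenvalue] at h2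
  have hs1 : s < 1 := hi.trans_le (ξ i t).2.2
  have hsr : s - r < 1 := by linarith
  simp only [Set.mem_Ioi, not_lt.2 hs, not_lt.2 h0, hs1, hsr, if_true, if_false, mul_zero, add_zero]
    at h2
  have h3 := le_of_mul_le_mul_left (le_of_add_le_add_right h2) (Nat.mul_pos hp hq)
  exact (lt_of_card_le (fun i j hij => hξ.1 i j hij t) (fun i j hij => hη.1 i j hij t) hi h3).le

theorem ofReal_sub_le_cuntzDist (hp : 0 < p) (hq : 0 < q) (hξ : IsAssociated φ l a b ξ)
    (hη : IsAssociated ψ l a b η) (t : I) (i : Fin l) :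
    ENNReal.ofReal ((ξ i t : ℝ) - η i t) ≤
      cuntzDist (Set.Ici 0) (φ (scal idC)) (ψ (scal idC)) := by
  refine ENNReal.le_of_forall_pos_le_add fun ε hε _ => ?_
  rcases le_or_gt ((ξ i t : ℝ) - η i t) ε with h | h
  · exact (ENNReal.ofReal_le_ofReal h).trans (by simp)
  have hs : 0 ≤ (ξ i t : ℝ) - ε := by linarith [(η i t).2.1]
  have h1 : ENNReal.ofReal ((ξ i t : ℝ) - η i t - ε) ≤
      cuntzDist (Set.Ici 0) (φ (scal idC)) (ψ (scal idC)) := by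
    refine le_iSup_of_le (Set.Ioi ((ξ i t : ℝ) - ε)) (le_iSup_of_le isOpen_Ioi
      (le_iSup_of_le (fun x hx => hs.trans (le_of_lt hx)) ?_))
    refine le_iInf fun r => le_iInf fun hr => le_iInf fun h2 => le_iInf fun _ =>
      ENNReal.ofReal_le_ofReal ?_
    have := sub_le_of_openLE hp hq hξ hη hs hr h2 (t := t) (i := i)
      (sub_lt_self _ (NNReal.coe_pos.2 hε))
    linarith
  calc ENNReal.ofReal ((ξ i t : ℝ) - η i t)
      = ENNReal.ofReal ((ξ i t : ℝ) - η i t - ε) + ε := by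
        rw [← ENNReal.ofReal_coe_nnreal, ← ENNReal.ofReal_add (by linarith) ε.coe_nonneg,
          sub_add_cancel]
    _ ≤ _ := by gcongr

theorem cuntzDist_comm {B : Type*} [CStarAlgebra B] (S : Set ℝ) (c d : B) :
    cuntzDist S c d = cuntzDist S d c := by
  unfold cuntzDist
  refine iSup_congr fun U => iSup_congr fun _ => iSup_congr fun _ => iInf_congr fun r =>
    iInf_congr fun _ => iInf_comm

/-- The coordinate function witnesses that the diagonal distance is a lower bound. -/
theorem diagDist_le_dW (hp : 0 < p) (hq : 0 < q) {𝓛 : Set (Z p q)} (h𝓛 : IsLipschitzFamily 𝓛)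
    (hξ : IsAssociated φ l a b ξ) (hη : IsAssociated ψ l a b η) :
    diagDist ξ η ≤ dW (Set.Ici 0) 𝓛 φ ψ := by
  refine iSup_le fun t => iSup_le fun i => le_iSup₂_of_le (scal idC) (scal_idC_mem h𝓛) ?_
  rcases abs_cases ((ξ i t : ℝ) - η i t) with ⟨h, -⟩ | ⟨h, -⟩
  · rw [h]
    exact ofReal_sub_le_cuntzDist hp hq hξ hη t i
  · rw [h, neg_sub, cuntzDist_comm]
    exact ofReal_sub_le_cuntzDist hp hq hη hξ t i

theorem dW_mono {A B : Type*} [CStarAlgebra B] {S S' : Set ℝ} (h : S ⊆ S') (𝓛 : Set A)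
    (φ ψ : A → B) : dW S 𝓛 φ ψ ≤ dW S' 𝓛 φ ψ :=
  iSup₂_mono fun _ _ => iSup_mono fun _ => iSup_mono fun _ => iSup_mono' fun hU =>
    ⟨hU.trans h, le_rfl⟩

end LowerBound

/-! ### Conclusion -/

theorem IsLipschitzFamily.isSelfAdjoint {p q : ℕ} {𝓛 : Set (Z p q)} (h𝓛 : IsLipschitzFamily 𝓛)
    {f : Z p q} (hf : f ∈ 𝓛) : IsSelfAdjoint f := by
  obtain ⟨U, -, -, -, rfl⟩ := h𝓛
  obtain ⟨h, ⟨-, hh, -, -⟩, hfh⟩ := hf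
  refine Subtype.ext ?_
  change star f.1 = f.1
  rw [hfh]
  exact hh.conjugate U

end DimDrop

end

theorem proposition4p7 (p q p' q' : ℕ) (hp : 0 < p) (hq : 0 < q) (hp' : 0 < p') (hq' : 0 < q')
    (hpq : Nat.Coprime p q) (hpq' : Nat.Coprime p' q')
    (φ ψ : DimDrop.Z p q →⋆ₙₐ[ℂ] DimDrop.Z p' q')
    (hφ : Function.Injective φ) (hψ : Function.Injective ψ)
    (𝓛 : Set (DimDrop.Z p q)) (h𝓛 : DimDrop.IsLipschitzFamily 𝓛) :
    φ 1 = 1 ∧ ψ 1 = 1 ∧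
    (∃ (l a b : ℕ) (ξ η : Fin l → C(unitInterval, unitInterval)), a < q ∧ b < p ∧
      DimDrop.IsAssociated φ l a b ξ ∧ DimDrop.IsAssociated ψ l a b η) ∧
    ∀ (l a b : ℕ) (ξ η : Fin l → C(unitInterval, unitInterval)),
      DimDrop.IsAssociated φ l a b ξ → DimDrop.IsAssociated ψ l a b η →
        DimDrop.dU 𝓛 φ ψ = DimDrop.diagDist ξ η ∧
        DimDrop.diagDist ξ η = DimDrop.dW Set.univ 𝓛 φ ψ ∧
        DimDrop.dW (Set.Ici 0) 𝓛 φ ψ = DimDrop.dW Set.univ 𝓛 φ ψ := by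
  have hφ1 := DimDrop.map_one_of_injective hp hq hpq' hp' hq' hφ
  have hψ1 := DimDrop.map_one_of_injective hp hq hpq' hp' hq' hψ
  refine ⟨hφ1, hψ1, ?_, fun l a b ξ η hξ hη => ?_⟩
  · obtain ⟨l, a, b, ha, hb, hcard⟩ :=
      DimDrop.exists_multiplicities hp hq (DimDrop.fibre φ 0) (DimDrop.fibre_one hφ1 0)
    rw [Fintype.card_prod, Fintype.card_fin, Fintype.card_fin] at hcard
    obtain ⟨ξ, hξ⟩ := DimDrop.exists_isAssociated hp hq hpq hφ1 ha hb hcard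
    obtain ⟨η, hη⟩ := DimDrop.exists_isAssociated hp hq hpq hψ1 ha hb hcard
    exact ⟨l, a, b, ξ, η, ha, hb, hξ, hη⟩
  · have h1 := DimDrop.dU_le_diagDist hp hq hp' hq' hpq hφ1 hψ1 h𝓛 hξ hη
    have h2 := DimDrop.diagDist_le_dW hp hq h𝓛 hξ hη
    have h3 := DimDrop.dW_mono (Set.subset_univ (Set.Ici (0 : ℝ))) 𝓛 φ ψ
    have h4 := DimDrop.dW_le_dU Set.univ 𝓛 φ ψ (fun f hf => (h𝓛.isSelfAdjoint hf).map φ)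
      fun f hf => (h𝓛.isSelfAdjoint hf).map ψ
    exact ⟨le_antisymm h1 (h2.trans (h3.trans h4)), le_antisymm (h2.trans h3) (h4.trans h1),
      le_antisymm h3 (h4.trans (h1.trans h2))⟩
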